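/- Let $G$ be a finite directed graph drawn in the plane, with source $s$ and sink $t$, such that $t$ is on the unbounded face, no directed cycle of the drawing is clockwise, $s$ has no incoming arc and exactly one outgoing arc, and every vertex other than $s,t$ has degree (indegree plus outdegree) three. An arc is useful if some simple $s,t$-path contains it, and useless otherwise; a path is useful if some simple $s,t$-path contains it as a subpath. Let $C$ be a strongly connected component of $G$ with at least one arc such that $t\notin V(C)$ and $s$ lies in the unbounded face of the drawing of $C$. An entrance of $C$ is a vertex $v\in V(C)$ for which there is a simple path $P$ from $s$ to $v$ with $V(P)\cap V(C)=\{v\}$; an exit is a vertex $v\in V(C)$ for which there is a simple path $P$ from $v$ to $t$ with $V(P)\cap V(C)=\{v\}$. Then the arcs of $C$ on the unbounded face of the drawing of $C$ form a directed cycle $Q$, and either all arcs of $C$ are useless, or there are nontrivial paths $Q_1$ and $Q_2$ (each with at least one arc) such that 1. $Q$ is the concatenation of $Q_1$ and $Q_2$; in particular $E(Q)=E(Q_1)\cup E(Q_2)$; 2. $Q_1$ is a useful path; 3. all arcs of $Q_2$ are useless; 4. $Q_1$ starts at an entrance and ends at an exit of $C$, it contains all entrances and all exits of $C$, and on $Q_1$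 every entrance precedes every exit. Moreover, there is an algorithm that, given the tails and heads of the arcs of $G$, the cyclic order of the arcs around each vertex, the vertices $s$ and $t$, and a vertex of $C$, decides which of the two cases holds and in the second case computes $Q_1$ and $Q_2$, in time $O(|V(G)|+|E(G)|)$ on a random access machine whose words hold numbers of size $O(|V(G)|+|E(G)|)$. -/

import Mathlib

/-! ### Directed graphs drawn in the plane -/

/-- A directed (multi)graph on the vertices `V` with arcs `A`, together with a rotation system and
marked outer darts. A dart is an end of an arc: `(a, true)` is the end of `a` at its tail `src a`,
and `(a, false)` the end of `a` at its head `tgt a`; we think of a dart as pointing away from its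
vertex along the arc. `rot` sends a dart to the next one in counterclockwise order around its
vertex, and `outer` is the set of darts that have the unbounded face on their left. -/
structure EmbeddedDigraph (V A : Type*) where
  src : A → V
  tgt : A → V
  rot : Equiv.Perm (A × Bool)
  outer : Set (A × Bool)

namespace EmbeddedDigraph

variable {V A : Type*} (G : EmbeddedDigraph V A)

/-- The vertex at which a dart is attached. -/
def vert (d : A × Bool) : V := if d.2 then G.src d.1 else G.tgt d.1

/-- The other end of the same arc. -/
def flip : Equiv.Perm (A × Bool) where
  toFun d := (d.1, !d.2)
  invFun d := (d.1, !d.2)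
  left_inv d := by simp
  right_inv d := by simp

/-- Traversal of the face on the left of a dart: go along the dart to the other end of the arc and
continue with the dart that is next there in clockwise order. -/
def faceNext : Equiv.Perm (A × Bool) := flip.trans G.rot.symm

/-- Two darts are adjacent if they are consecutive at a vertex or are the two ends of an arc. -/
def DartAdj (d d' : A × Bool) : Prop := d' = G.rot d ∨ d' = flip d

/-- Two darts lie in the same connected component of the underlying undirected graph. -/
def Connected (d d' : A × Bool) : Prop := Relation.EqvGen G.DartAdj d d'

/-- The rotation system is one of a drawing in the plane. Isolated vertices have no darts and play
no role. In the Euler formula, the classes of `rot` are the vertices that are not isolated, the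
classes of `faceNext` are the faces (of each connected component), and the classes of `DartAdj` are
the connected components (other than isolated vertices). -/
structure IsPlane : Prop where
  /-- `rot` permutes the darts at each vertex cyclically. -/
  rot_sameCycle : ∀ d d', G.rot.SameCycle d d' ↔ G.vert d = G.vert d'
  /-- Euler's formula: every connected component has genus zero. -/
  euler : Nat.card (Quot fun d d' => d' = G.rot d) + Nat.card (Quot fun d d' => d' = G.faceNext d) =
    Nat.card A + 2 * Nat.card (Quot G.DartAdj)
  /-- In every connected component exactly one face is the unbounded one. -/
  outer_faceNext : ∀ d, G.faceNext d ∈ G.outer ↔ d ∈ G.outer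
  exists_outer : ∀ d, ∃ d' ∈ G.outer, G.Connected d d'
  outer_unique : ∀ d ∈ G.outer, ∀ d' ∈ G.outer, G.Connected d d' → G.faceNext.SameCycle d d'

/-- For a set `S` of arcs, `G.Outside S d` says that the left side of the dart `d` lies in the
unbounded face of the drawing of `S`: it can be reached from an unbounded face of `G` by moving
within faces of `G` and by crossing arcs that are not in `S`. -/
inductive Outside (S : Set A) : A × Bool → Prop
  | outer {d : A × Bool} (h : d ∈ G.outer) : Outside S d
  | face {d : A × Bool} (h : Outside S d) : Outside S (G.faceNext d)
  | cross {d : A × Bool} (h : Outside S d) (hd : d.1 ∉ S) : Outside S (flip d)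

/-! ### Walks, paths and cycles, as lists of arcs -/

/-- The arcs of the list form a directed walk from `u` to `v`. -/
def IsWalk : V → List A → V → Prop
  | u, [], v => u = v
  | u, a :: l, v => G.src a = u ∧ IsWalk (G.tgt a) l v

/-- The sequence of vertices of a walk that starts at `u`. -/
def support (u : V) (l : List A) : List V := u :: l.map G.tgt

/-- A simple directed path from `u` to `v`. -/
def IsPath (u : V) (l : List A) (v : V) : Prop := G.IsWalk u l v ∧ (G.support u l).Nodup

/-- A directed cycle: a nonempty closed walk in which no vertex repeats. -/
def IsCycle (l : List A) : Prop := l ≠ [] ∧ (∃ u, G.IsWalk u l u) ∧ (l.map G.tgt).Nodup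

/-- A directed cycle is clockwise if the unbounded face of its drawing is on the left side of one
(equivalently, of each) of its arcs. -/
def IsClockwise (l : List A) : Prop := G.IsCycle l ∧ ∃ a ∈ l, G.Outside {b | b ∈ l} (a, true)

/-- There is a simple path from `s` to `t` that contains the arc `a`. -/
def UsefulArc (s t : V) (a : A) : Prop := ∃ l, G.IsPath s l t ∧ a ∈ l

/-- There is a simple path from `s` to `t` that contains the path `p`. -/
def UsefulPath (s t : V) (p : List A) : Prop := ∃ l, G.IsPath s l t ∧ p <:+: l

/-! ### Strongly connected components -/

def Reachable (u v : V) : Prop := ∃ l, G.IsWalk u l v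

/-- `C` is the vertex set of a strongly connected component. -/
def IsSCC (C : Set V) : Prop := ∃ c, C = {v | G.Reachable c v ∧ G.Reachable v c}

/-- The arcs of the subgraph induced by `C`. -/
def arcsOf (C : Set V) : Set A := {a | G.src a ∈ C ∧ G.tgt a ∈ C}

/-- The boundary arcs: the arcs of `C` that lie on the unbounded face of the drawing of `C`. -/
def boundary (C : Set V) : Set A :=
  {a ∈ G.arcsOf C | ∃ b : Bool, G.Outside (G.arcsOf C) (a, b)}

/-- `Q` is a directed cycle that forms the boundary of `C`. -/
def IsBoundaryCycle (C : Set V) (Q : List A) : Prop :=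
  G.IsCycle Q ∧ ∀ a, a ∈ Q ↔ a ∈ G.boundary C

/-- The vertex `v` lies in the unbounded face of the drawing of `C`. -/
def InUnboundedFace (C : Set V) (v : V) : Prop :=
  v ∉ C ∧ ∃ d, G.vert d = v ∧ G.Outside (G.arcsOf C) d

/-- `v ∈ C` can be reached from `s` by a path that meets `C` only in `v`. -/
def IsEntrance (s : V) (C : Set V) (v : V) : Prop :=
  v ∈ C ∧ ∃ l, G.IsPath s l v ∧ ∀ w ∈ G.support s l, w ∈ C → w = v

/-- `t` can be reached from `v ∈ C` by a path that meets `C` only in `v`. -/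
def IsExit (t : V) (C : Set V) (v : V) : Prop :=
  v ∈ C ∧ ∃ l, G.IsPath v l t ∧ ∀ w ∈ G.support v l, w ∈ C → w = v

/-- A plane flow network with source `s` and sink `t` that is in the normal form: the sink is on
the unbounded face (no condition if `t` is isolated), there is no clockwise cycle, the source has
no incoming arc and exactly one outgoing arc, and all other vertices except `t` have degree three. -/
structure IsNormalNetwork (s t : V) : Prop where
  plane : G.IsPlane
  sink_outer : (∃ d, G.vert d = t) → ∃ d ∈ G.outer, G.vert d = t
  no_clockwise : ∀ l, ¬ G.IsClockwise l
  source_in : ∀ a, G.tgt a ≠ s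
  source_out : ∃! a, G.src a = s
  degree_three : ∀ v, v ≠ s → v ≠ t → Nat.card {d // G.vert d = v} = 3

/-- `C` is a strongly connected component with at least one arc, `t` is not in `C`, and `s` is in
the unbounded face of `C`. -/
structure IsOutsideComponent (s t : V) (C : Set V) : Prop where
  scc : G.IsSCC C
  nontrivial : (G.arcsOf C).Nonempty
  sink_notMem : t ∉ C
  source_outside : G.InUnboundedFace C s

/-- No arc of `C` is useful. -/
def AllUseless (s t : V) (C : Set V) : Prop := ∀ a ∈ G.arcsOf C, ¬ G.UsefulArc s t a

/-- The cycle `Q` splits into a nontrivial path `Q₁` from an entrance `u` to an exit `v` and a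
nontrivial path `Q₂` from `v` back to `u`, where `Q₁` is useful, all arcs of `Q₂` are useless, and
`Q₁` contains all entrances and exits, every entrance before every exit. -/
def Splits (s t : V) (C : Set V) (Q Q₁ Q₂ : List A) : Prop :=
  Q ~r Q₁ ++ Q₂ ∧ Q₁ ≠ [] ∧ Q₂ ≠ [] ∧ ∃ u v, G.IsEntrance s C u ∧ G.IsExit t C v ∧
    G.IsPath u Q₁ v ∧ G.IsPath v Q₂ u ∧
    G.UsefulPath s t Q₁ ∧ (∀ a ∈ Q₂, ¬ G.UsefulArc s t a) ∧
    ∀ e x, G.IsEntrance s C e → G.IsExit t C x → [e, x].Sublist (G.support u Q₁)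

end EmbeddedDigraph

/-! ### A random access machine with unit cost

Programs of a structured language over numbered registers and numbered arrays. Every node of an
expression and every command costs one step. All numbers that occur have to be at most a word bound
`W`; a run that exceeds it gets stuck. -/

namespace RAM

structure State where
  reg : ℕ → ℕ
  mem : ℕ → ℕ → ℕ

inductive Op
  | add | sub | mul | div | mod | lt | eq

/-- `sub` is truncated; comparisons return `1` or `0`. -/
def Op.eval : Op → ℕ → ℕ → ℕ
  | .add, x, y => x + y
  | .sub, x, y => x - y
  | .mul, x, y => x * y
  | .div, x, y => x / y
  | .mod, x, y => x % y
  | .lt, x, y => if x < y then 1 else 0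
  | .eq, x, y => if x = y then 1 else 0

inductive Expr
  | lit (k : ℕ)
  | reg (i : ℕ)
  | mem (k : ℕ) (e : Expr)
  | op (o : Op) (e₁ e₂ : Expr)

namespace Expr

def eval (σ : State) : Expr → ℕ
  | lit k => k
  | reg i => σ.reg i
  | mem k e => σ.mem k (e.eval σ)
  | op o e₁ e₂ => o.eval (e₁.eval σ) (e₂.eval σ)

def cost : Expr → ℕ
  | lit _ => 1
  | reg _ => 1
  | mem _ e => e.cost + 1
  | op _ e₁ e₂ => e₁.cost + e₂.cost + 1

/-- The values of the expression and of all its subexpressions respect the word bound. -/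
def Fits (W : ℕ) (σ : State) : Expr → Prop
  | lit k => k ≤ W
  | reg i => σ.reg i ≤ W
  | mem k e => e.Fits W σ ∧ σ.mem k (e.eval σ) ≤ W
  | op o e₁ e₂ => e₁.Fits W σ ∧ e₂.Fits W σ ∧ o.eval (e₁.eval σ) (e₂.eval σ) ≤ W

end Expr

/-- `set i e` writes `e` to register `i`; `store k e₁ e₂` writes `e₂` to cell `e₁` of array `k`;
the conditions of `ite` and `loop` (a while loop) are true when nonzero. -/
inductive Program
  | skip
  | set (i : ℕ) (e : Expr)
  | store (k : ℕ) (e₁ e₂ : Expr)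
  | seq (p q : Program)
  | ite (e : Expr) (p q : Program)
  | loop (e : Expr) (p : Program)

def State.setReg (σ : State) (i x : ℕ) : State :=
  { σ with reg := Function.update σ.reg i x }

def State.setMem (σ : State) (k j x : ℕ) : State :=
  { σ with mem := Function.update σ.mem k (Function.update (σ.mem k) j x) }

/-- `Exec W p σ T σ'`: with word bound `W`, the program `p` started in the state `σ` halts after
exactly `T` steps in the state `σ'`. -/
inductive Exec (W : ℕ) : Program → State → ℕ → State → Prop
  | skip (σ : State) : Exec W .skip σ 1 σ
  | set (σ : State) (i : ℕ) (e : Expr) (h : e.Fits W σ) :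
      Exec W (.set i e) σ (e.cost + 1) (σ.setReg i (e.eval σ))
  | store (σ : State) (k : ℕ) (e₁ e₂ : Expr) (h₁ : e₁.Fits W σ) (h₂ : e₂.Fits W σ) :
      Exec W (.store k e₁ e₂) σ (e₁.cost + e₂.cost + 1) (σ.setMem k (e₁.eval σ) (e₂.eval σ))
  | seq {p q : Program} {σ σ₁ σ₂ : State} {T₁ T₂ : ℕ} (h₁ : Exec W p σ T₁ σ₁)
      (h₂ : Exec W q σ₁ T₂ σ₂) : Exec W (.seq p q) σ (T₁ + T₂ + 1) σ₂
  | ite_true {e : Expr} {p q : Program} {σ σ' : State} {T : ℕ} (he : e.Fits W σ)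
      (hc : e.eval σ ≠ 0) (h : Exec W p σ T σ') : Exec W (.ite e p q) σ (e.cost + T + 1) σ'
  | ite_false {e : Expr} {p q : Program} {σ σ' : State} {T : ℕ} (he : e.Fits W σ)
      (hc : e.eval σ = 0) (h : Exec W q σ T σ') : Exec W (.ite e p q) σ (e.cost + T + 1) σ'
  | loop_done {e : Expr} {p : Program} {σ : State} (he : e.Fits W σ) (hc : e.eval σ = 0) :
      Exec W (.loop e p) σ (e.cost + 1) σ
  | loop_step {e : Expr} {p : Program} {σ σ₁ σ₂ : State} {T₁ T₂ : ℕ} (he : e.Fits W σ)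
      (hc : e.eval σ ≠ 0) (h₁ : Exec W p σ T₁ σ₁) (h₂ : Exec W (.loop e p) σ₁ T₂ σ₂) :
      Exec W (.loop e p) σ (e.cost + T₁ + T₂ + 1) σ₂

/-- The number of a dart: `2 a` for the tail end of the arc `a`, and `2 a + 1` for its head end. -/
def dartIndex {m : ℕ} (d : Fin m × Bool) : ℕ := 2 * (d.1 : ℕ) + if d.2 then 0 else 1

/-- The state `σ` holds the input `(G, s, t, c)` and is zero elsewhere. Registers `0` to `4` contain
the number `n` of vertices, the number `m` of arcs, `s`, `t` and `c`. Arrays `0` and `1` contain the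
tails and heads of the arcs; arrays `2` and `3` contain the next dart in counterclockwise and in
clockwise order around the vertex, for each dart; array `4` contains, for each vertex, some dart at
that vertex, or `2 m` if the vertex is isolated. -/
structure IsInput {n m : ℕ} (G : EmbeddedDigraph (Fin n) (Fin m)) (s t c : Fin n) (σ : State) :
    Prop where
  reg_n : σ.reg 0 = n
  reg_m : σ.reg 1 = m
  reg_s : σ.reg 2 = s
  reg_t : σ.reg 3 = t
  reg_c : σ.reg 4 = c
  reg_zero : ∀ i, 5 ≤ i → σ.reg i = 0
  src : ∀ a : Fin m, σ.mem 0 a = G.src a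
  src_zero : ∀ j, m ≤ j → σ.mem 0 j = 0
  tgt : ∀ a : Fin m, σ.mem 1 a = G.tgt a
  tgt_zero : ∀ j, m ≤ j → σ.mem 1 j = 0
  next : ∀ d, σ.mem 2 (dartIndex d) = dartIndex (G.rot d)
  next_zero : ∀ j, 2 * m ≤ j → σ.mem 2 j = 0
  prev : ∀ d, σ.mem 3 (dartIndex d) = dartIndex (G.rot.symm d)
  prev_zero : ∀ j, 2 * m ≤ j → σ.mem 3 j = 0
  first : ∀ v : Fin n, (∃ d, G.vert d = v) → ∃ d, G.vert d = v ∧ σ.mem 4 v = dartIndex d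
  first_isolated : ∀ v : Fin n, (¬ ∃ d, G.vert d = v) → σ.mem 4 v = 2 * m
  first_zero : ∀ j, n ≤ j → σ.mem 4 j = 0
  mem_zero : ∀ k j, 5 ≤ k → σ.mem k j = 0

/-- Register `i` contains the length of the list `l` of arcs, and array `k` its entries. -/
def Holds {m : ℕ} (σ : State) (i k : ℕ) (l : List (Fin m)) : Prop :=
  σ.reg i = l.length ∧ ∀ (j : ℕ) (hj : j < l.length), σ.mem k j = (l[j] : ℕ)

end RAM

/-! ### Darts, and potentials of circulations modulo 2. -/

namespace EmbeddedDigraph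

variable {V A : Type*} (G : EmbeddedDigraph V A)

/-! Homology modulo 2 plays the role of the Jordan curve theorem. By Euler's formula every
circulation over `ZMod 2` is the jump of a function on the faces (`IsPlane.exists_potential`). Each
topological step below forms a circulation from walks, follows its potential through faces and
across arcs without flow, and ends with a wrong jump at some arc.

If the unbounded face of `C` were on the left of an arc of `C`, closing that arc to a directed cycle
inside `C` would give a clockwise cycle. So boundary arcs have the unbounded face on their right
(`IsSCC.not_outside_true`). As all degrees in `C` are three, following the unbounded face leads from
each boundary arc to a unique next one, and this map is injective. The boundary is thus a union of
directed cycles, and `IsOutsideComponent.mem_of_mem_boundary` leaves only one.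

Each vertex of `C` has an in-arc and an out-arc in `C`, hence at most one arc more. At an entrance
or an exit this third arc lies on the outside, so the vertex is on `Q`, and no vertex is both. Walks
to entrances and walks from exits do not meet, since a common vertex would belong to `C`.
Consequently two entrances cannot separate two exits on `Q` (`IsOutsideComponent.not_separated`).

If there is no entrance or no exit, no `s,t`-path uses an arc of `C`. Otherwise `Q₂` is a segment of
`Q` from an exit to an entrance with neither in its interior, and `Q₁` is the rest. By
non-separation every entrance precedes every exit on `Q₁`, and `Q₁` extends to a simple `s,t`-path
by a path to its start and one from its end. A simple `s,t`-path through an arc of `C` contains a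
path inside `C` from an entrance to an exit. Such a path uses no boundary arc outside the segment of
`Q₁` between the two (`IsOutsideComponent.mem_of_mem_path`), so the arcs of `Q₂` are useless.

The algorithm determines `C` by a forward and a backward search, and the entrances and exits by two
searches that stop at `C`. It then walks once around the boundary by local rotation steps, starting
at an exit. Each dart is queued at most once per search, so the time is linear. -/

@[simp] lemma flip_mk (a : A) (b : Bool) : flip (a, b) = (a, !b) := rfl

@[simp] lemma flip_fst (d : A × Bool) : (flip d).1 = d.1 := rfl

@[simp] lemma flip_flip (d : A × Bool) : flip (flip d) = d := by
  rcases d with ⟨a, b⟩; simp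

lemma faceNext_flip (d : A × Bool) : G.faceNext (flip d) = G.rot.symm d := by
  simp [faceNext]

lemma faceNext_apply (d : A × Bool) : G.faceNext d = G.rot.symm (flip d) := rfl

@[simp] lemma vert_true (a : A) : G.vert (a, true) = G.src a := rfl

@[simp] lemma vert_false (a : A) : G.vert (a, false) = G.tgt a := rfl

/-! ### Potentials of circulations -/

section Potential

/-- The incidence matrix over `ZMod 2` of a labelling of the darts. -/
def incidence {X : Type*} [DecidableEq X] (q : A × Bool → X) : Matrix A X (ZMod 2) :=
  fun a x => (if q (a, true) = x then 1 else 0) + if q (a, false) = x then 1 else 0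

lemma incidence_mulVec {X : Type*} [DecidableEq X] [Fintype X] (q : A × Bool → X)
    (φ : X → ZMod 2) (a : A) :
    (incidence q).mulVec φ a = φ (q (a, true)) + φ (q (a, false)) := by
  simp [Matrix.mulVec, dotProduct, incidence, add_mul, Finset.sum_add_distrib]

/-- A kernel vector, pulled back to darts, is invariant under `flip`, and `hadj` makes it invariant
under `rot`. It is therefore constant on connected components, and rank-nullity applies. The form
with `hadj` serves vertices and faces alike. -/
lemma card_le_rank_incidence_add [Fintype A] {X : Type*} [DecidableEq X] [Fintype X]
    (q : A × Bool → X) (hq : Function.Surjective q)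
    (hadj : ∀ ψ : A × Bool → ZMod 2, (∀ d d', q d = q d' → ψ d = ψ d') →
      (∀ d, ψ (flip d) = ψ d) → ∀ d, ψ (G.rot d) = ψ d) :
    Fintype.card X ≤ (incidence q).rank + Nat.card (Quot G.DartAdj) := by
  classical
  have : Finite (Quot G.DartAdj) := Quot.finite _
  have := Fintype.ofFinite (Quot G.DartAdj)
  have h1 := LinearMap.finrank_range_add_finrank_ker (incidence q).mulVecLin
  rw [Module.finrank_fintype_fun_eq_card] at h1
  -- Evaluation at one dart of each component.
  let f : (incidence q).mulVecLin.ker →ₗ[ZMod 2] (Quot G.DartAdj → ZMod 2) :=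
    (LinearMap.funLeft (ZMod 2) (ZMod 2) fun c : Quot G.DartAdj => q c.out).comp
      (Submodule.subtype _)
  have hf : Function.Injective f := by
    rw [← LinearMap.ker_eq_bot, LinearMap.ker_eq_bot']
    rintro ⟨φ, hφ⟩ h0
    have hker : ∀ a, φ (q (a, true)) = φ (q (a, false)) := by
      intro a
      have := congrFun (LinearMap.mem_ker.1 hφ) a
      rw [Matrix.mulVecLin_apply, incidence_mulVec] at this
      exact CharTwo.add_eq_zero.1 this
    have hflip : ∀ d, φ (q (flip d)) = φ (q d) := by
      rintro ⟨a, _ | _⟩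
      · exact hker a
      · exact (hker a).symm
    have hrot := hadj (fun d => φ (q d)) (fun d d' h => by simp [h]) hflip
    have hconst : ∀ d d', Relation.EqvGen G.DartAdj d d' → φ (q d) = φ (q d') := by
      intro d d' h
      induction h with
      | rel d d' h =>
        rcases h with rfl | rfl
        · exact (hrot _).symm
        · exact (hflip _).symm
      | refl => rfl
      | symm _ _ _ ih => exact ih.symm
      | trans _ _ _ _ _ ih1 ih2 => exact ih1.trans ih2
    have : φ = 0 := by
      funext x
      obtain ⟨d, rfl⟩ := hq x
      have h2 : φ (q (Quot.mk G.DartAdj d).out) = 0 := congrFun h0 _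
      refine Eq.trans ?_ h2
      apply hconst
      apply Quot.eqvGen_exact
      exact (Quot.out_eq _).symm
    simpa using this
  have h2 := LinearMap.finrank_le_finrank_of_injective hf
  rw [Module.finrank_fintype_fun_eq_card] at h2
  rw [Nat.card_eq_fintype_card, Matrix.rank]
  omega

lemma sum_dart [Fintype A] (f : A × Bool → ZMod 2) :
    ∑ d, f d = ∑ a, (f (a, true) + f (a, false)) := by
  rw [Fintype.sum_prod_type]
  simp

variable {G} in
/-- In a plane graph, every circulation over `ZMod 2` is the coboundary of a function on the
faces. -/
theorem IsPlane.exists_potential [Fintype A] [DecidableEq V] (hG : G.IsPlane) (h : A → ZMod 2)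
    (hdiv : ∀ v, ∑ a, ((if G.src a = v then h a else 0) + if G.tgt a = v then h a else 0) = 0) :
    ∃ φ : A × Bool → ZMod 2, (∀ d, φ (G.faceNext d) = φ d) ∧ ∀ d, φ d + φ (flip d) = h d.1 := by
  classical
  let rV : A × Bool → A × Bool → Prop := fun d d' => d' = G.rot d
  let rF : A × Bool → A × Bool → Prop := fun d d' => d' = G.faceNext d
  have : Finite (Quot rV) := Quot.finite _
  have : Finite (Quot rF) := Quot.finite _
  have := Fintype.ofFinite (Quot rV)
  have := Fintype.ofFinite (Quot rF)
  let qV : A × Bool → Quot rV := Quot.mk rV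
  let qF : A × Bool → Quot rF := Quot.mk rF
  have hqV : ∀ d, qV (G.rot d) = qV d := fun d => (Quot.sound (r := rV) rfl).symm
  have hqF : ∀ d, qF (G.faceNext d) = qF d := fun d => (Quot.sound (r := rF) rfl).symm
  have hV := G.card_le_rank_incidence_add qV Quot.mk_surjective
    fun ψ h1 _ d => h1 _ _ (hqV d)
  -- Since `faceNext (flip (rot d)) = d`, invariance under `faceNext` and `flip` gives invariance
  -- under `rot`.
  have hF := G.card_le_rank_incidence_add qF Quot.mk_surjective
    (fun ψ h1 h2 d => by
      have := h1 _ _ (hqF (flip (G.rot d)))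
      rw [faceNext_flip, h2] at this
      simpa using this.symm)
  have hE := hG.euler
  change Nat.card (Quot rV) + Nat.card (Quot rF) = _ at hE
  simp only [Nat.card_eq_fintype_card (α := Quot rV), Nat.card_eq_fintype_card (α := Quot rF),
    Nat.card_eq_fintype_card (α := A)] at hE
  have hker := LinearMap.finrank_range_add_finrank_ker (incidence qV).transpose.mulVecLin
  rw [Module.finrank_fintype_fun_eq_card] at hker
  have hrk := Matrix.rank_transpose (incidence qV)
  rw [Matrix.rank] at hrk
  have hmul : ∀ (g : A → ZMod 2) (x : Quot rV), (incidence qV).transpose.mulVec g x =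
      ∑ a, ((if qV (a, true) = x then g a else 0) + if qV (a, false) = x then g a else 0) := by
    intro g x
    simp [Matrix.mulVec, dotProduct, incidence, add_mul]
  -- Jumps of face functions are circulations: the right side of `rot d` is the left side of `d`, so
  -- around a vertex each face corner is counted twice.
  have hle : (incidence qF).mulVecLin.range ≤ (incidence qV).transpose.mulVecLin.ker := by
    rintro _ ⟨φ, rfl⟩
    rw [LinearMap.mem_ker]
    funext x
    rw [Matrix.mulVecLin_apply, hmul]
    simp only [Matrix.mulVecLin_apply, incidence_mulVec, Pi.zero_apply]
    have e1 := sum_dart fun d => if qV d = x then φ (qF d) else 0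
    have e2 := sum_dart fun d => if qV d = x then φ (qF (flip d)) else 0
    have e3 : ∑ d, (if qV d = x then φ (qF (flip d)) else 0) =
        ∑ d, if qV d = x then φ (qF d) else 0 := by
      rw [← Equiv.sum_comp G.rot]
      refine Finset.sum_congr rfl fun d _ => ?_
      rw [hqV, ← hqF (flip (G.rot d)), faceNext_flip, Equiv.symm_apply_apply]
    have e4 := CharTwo.add_self_eq_zero (∑ d, if qV d = x then φ (qF d) else 0)
    nth_rewrite 2 [← e3] at e4
    rw [e1, e2, ← Finset.sum_add_distrib] at e4
    refine Eq.trans ?_ e4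
    refine Finset.sum_congr rfl fun a _ => ?_
    simp only [flip_mk, Bool.not_true, Bool.not_false]
    split_ifs <;> ring
  -- The two rank bounds and Euler's formula show that the rank for faces is at least the number of
  -- arcs minus the rank for vertices, which is the dimension of the space of circulations.
  have heq := Submodule.eq_of_le_of_finrank_le hle (by rw [Matrix.rank] at hF; omega)
  have hmem : h ∈ (incidence qV).transpose.mulVecLin.ker := by
    rw [LinearMap.mem_ker]
    funext x
    obtain ⟨d, rfl⟩ := Quot.mk_surjective x
    rw [Matrix.mulVecLin_apply, hmul]
    have key : ∀ d', qV d' = Quot.mk rV d ↔ G.vert d' = G.vert d := by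
      intro d'
      rw [← hG.rot_sameCycle]
      constructor
      · intro h
        have h' := Quot.eqvGen_exact h
        clear h
        induction h' with
        | rel a b h => cases h; exact Equiv.Perm.sameCycle_apply_right.2 (.refl _ _)
        | refl => exact .refl _ _
        | symm _ _ _ ih => exact ih.symm
        | trans _ _ _ _ _ ih1 ih2 => exact ih1.trans ih2
      · rintro ⟨i, hi⟩
        rw [← hi]
        have hz : ∀ (i : ℤ) (d : A × Bool), qV ((G.rot ^ i) d) = qV d := by
          intro i
          induction i with
          | zero => simp
          | succ i ih => intro d; rw [zpow_add_one, Equiv.Perm.mul_apply, ih, hqV]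
          | pred i ih =>
            intro d
            rw [zpow_sub_one, Equiv.Perm.mul_apply, ih, ← hqV, Equiv.Perm.inv_def,
              Equiv.apply_symm_apply]
        exact (hz i d').symm
    simp only [key, vert_true, vert_false]
    exact hdiv _
  rw [← heq] at hmem
  obtain ⟨φ, hφ⟩ := hmem
  refine ⟨fun d => φ (qF d), fun d => by simp only [hqF], ?_⟩
  rintro ⟨a, _ | _⟩
  all_goals
    have := congrFun hφ a
    rw [Matrix.mulVecLin_apply, incidence_mulVec] at this
    simp only [flip_mk, Bool.not_true, Bool.not_false]
    rw [← this]
  exact add_comm _ _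

end Potential

end EmbeddedDigraph

/-! ### Combinatorics of walks, and their chains modulo 2. -/

namespace EmbeddedDigraph

variable {V A : Type*} (G : EmbeddedDigraph V A)

/-! ### Walks and paths -/

section Walk

variable {G} {u v w : V} {l l₁ l₂ : List A}

@[simp] lemma isWalk_nil : G.IsWalk u [] v ↔ u = v := Iff.rfl

@[simp] lemma isWalk_cons {a : A} :
    G.IsWalk u (a :: l) v ↔ G.src a = u ∧ G.IsWalk (G.tgt a) l v := Iff.rfl

lemma isWalk_append : G.IsWalk u (l₁ ++ l₂) w ↔ ∃ v, G.IsWalk u l₁ v ∧ G.IsWalk v l₂ w := by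
  induction l₁ generalizing u with
  | nil => simp
  | cons a l ih => simp [ih, and_assoc]

lemma IsWalk.append (h₁ : G.IsWalk u l₁ v) (h₂ : G.IsWalk v l₂ w) : G.IsWalk u (l₁ ++ l₂) w :=
  isWalk_append.2 ⟨v, h₁, h₂⟩

lemma IsWalk.unique (h₁ : G.IsWalk u l v) (h₂ : G.IsWalk u l w) : v = w := by
  induction l generalizing u with
  | nil => simp_all
  | cons a l ih => exact ih h₁.2 h₂.2

lemma mem_support : w ∈ G.support u l ↔ w = u ∨ ∃ a ∈ l, G.tgt a = w := by
  simp [support]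

lemma support_append : G.support u (l₁ ++ l₂) = G.support u l₁ ++ l₂.map G.tgt := by
  simp [support]

lemma support_cons (a : A) : G.support u (a :: l) = u :: G.support (G.tgt a) l := by
  simp [support]

lemma start_mem_support : u ∈ G.support u l := by simp [support]

lemma tgt_mem_support {a : A} (ha : a ∈ l) : G.tgt a ∈ G.support u l :=
  mem_support.2 (.inr ⟨a, ha, rfl⟩)

lemma IsWalk.mem_support_iff (h : G.IsWalk u l v) :
    w ∈ G.support u l ↔ w = v ∨ ∃ a ∈ l, G.src a = w := by
  induction l generalizing u with
  | nil => simp_all [support]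
  | cons a l ih =>
    rw [support_cons, List.mem_cons, ih h.2, ← h.1]
    simp only [List.mem_cons, exists_eq_or_imp]
    rw [eq_comm (a := w) (b := G.src a)]
    tauto

lemma IsWalk.end_mem_support (h : G.IsWalk u l v) : v ∈ G.support u l :=
  h.mem_support_iff.2 (.inl rfl)

lemma IsWalk.src_mem_support (h : G.IsWalk u l v) {a : A} (ha : a ∈ l) :
    G.src a ∈ G.support u l :=
  h.mem_support_iff.2 (.inr ⟨a, ha, rfl⟩)

lemma IsWalk.exists_split_of_mem (h : G.IsWalk u l v) (hw : w ∈ G.support u l) :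
    ∃ l₁ l₂, l = l₁ ++ l₂ ∧ G.IsWalk u l₁ w ∧ G.IsWalk w l₂ v := by
  induction l generalizing u with
  | nil => obtain rfl : w = u := by simpa [support] using hw
           exact ⟨[], [], rfl, rfl, h⟩
  | cons a l ih =>
    rw [support_cons, List.mem_cons] at hw
    rcases hw with rfl | hw
    · exact ⟨[], a :: l, rfl, rfl, h⟩
    · obtain ⟨l₁, l₂, rfl, h₁, h₂⟩ := ih h.2 hw
      exact ⟨a :: l₁, l₂, rfl, ⟨h.1, h₁⟩, h₂⟩

lemma IsWalk.exists_split_arc (h : G.IsWalk u l v) {a : A} (ha : a ∈ l) :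
    ∃ l₁ l₂, l = l₁ ++ a :: l₂ ∧ G.IsWalk u l₁ (G.src a) ∧ G.IsWalk (G.tgt a) l₂ v := by
  obtain ⟨l₁, l₂, rfl⟩ := List.append_of_mem ha
  obtain ⟨x, h₁, h₂⟩ := isWalk_append.1 h
  obtain rfl := h₂.1
  exact ⟨l₁, l₂, rfl, h₁, h₂.2⟩

/-- The clause on tails covers every vertex of the initial part before its end `w`, which is how
avoidance of `C` is expressed throughout; for a final part it is put in terms of heads. -/
lemma IsWalk.exists_split_first (P : V → Prop) (h : G.IsWalk u l v)
    (hw : ∃ w ∈ G.support u l, P w) :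
    ∃ l₁ l₂ w, l = l₁ ++ l₂ ∧ G.IsWalk u l₁ w ∧ G.IsWalk w l₂ v ∧ P w ∧
      ∀ a ∈ l₁, ¬ P (G.src a) := by
  induction l generalizing u with
  | nil =>
    obtain ⟨w, hw, hP⟩ := hw
    obtain rfl : w = u := by simpa [support] using hw
    exact ⟨[], [], w, rfl, rfl, h, hP, by simp⟩
  | cons a l ih =>
    by_cases hu : P u
    · exact ⟨[], a :: l, u, rfl, rfl, h, hu, by simp⟩
    obtain ⟨w, hw, hP⟩ := hw
    rw [support_cons, List.mem_cons] at hw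
    rcases hw with rfl | hw
    · exact absurd hP hu
    · obtain ⟨l₁, l₂, x, rfl, h₁, h₂, hx, h₃⟩ := ih h.2 ⟨w, hw, hP⟩
      refine ⟨a :: l₁, l₂, x, rfl, ⟨h.1, h₁⟩, h₂, hx, ?_⟩
      simp only [List.mem_cons, forall_eq_or_imp, h.1]
      exact ⟨hu, h₃⟩

lemma IsWalk.exists_split_last (P : V → Prop) (h : G.IsWalk u l v)
    (hw : ∃ w ∈ G.support u l, P w) :
    ∃ l₁ l₂ w, l = l₁ ++ l₂ ∧ G.IsWalk u l₁ w ∧ G.IsWalk w l₂ v ∧ P w ∧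
      ∀ a ∈ l₂, ¬ P (G.tgt a) := by
  induction l generalizing u with
  | nil =>
    obtain ⟨w, hw, hP⟩ := hw
    obtain rfl : w = u := by simpa [support] using hw
    exact ⟨[], [], w, rfl, rfl, h, hP, by simp⟩
  | cons a l ih =>
    by_cases hl : ∃ w ∈ G.support (G.tgt a) l, P w
    · obtain ⟨l₁, l₂, x, rfl, h₁, h₂, hx, h₃⟩ := ih h.2 hl
      exact ⟨a :: l₁, l₂, x, rfl, ⟨h.1, h₁⟩, h₂, hx, h₃⟩
    · obtain ⟨w, hw, hP⟩ := hw
      rw [support_cons, List.mem_cons] at hw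
      rcases hw with rfl | hw
      · refine ⟨[], a :: l, w, rfl, rfl, h, hP, ?_⟩
        push Not at hl
        simp only [List.mem_cons, forall_eq_or_imp]
        exact ⟨hl _ start_mem_support, fun b hb => hl _ (tgt_mem_support hb)⟩
      · exact absurd ⟨w, hw, hP⟩ hl

lemma IsPath.left_of_append (h : G.IsPath u (l₁ ++ l₂) w) (h₁ : G.IsWalk u l₁ v) :
    G.IsPath u l₁ v := by
  refine ⟨h₁, ?_⟩
  have := h.2
  rw [support_append] at this
  exact this.of_append_left

lemma IsPath.right_of_append (h : G.IsPath u (l₁ ++ l₂) w) (h₁ : G.IsWalk u l₁ v) :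
    G.IsPath v l₂ w := by
  constructor
  · obtain ⟨x, h₂, h₃⟩ := isWalk_append.1 h.1
    rwa [h₁.unique h₂]
  · have := h.2
    rw [support_append, List.nodup_append] at this
    rw [support, List.nodup_cons]
    exact ⟨fun h₂ => this.2.2 v h₁.end_mem_support v h₂ rfl, this.2.1⟩

lemma IsPath.append (h₁ : G.IsPath u l₁ v) (h₂ : G.IsPath v l₂ w)
    (h : ∀ x ∈ G.support u l₁, x ∈ G.support v l₂ → x = v) : G.IsPath u (l₁ ++ l₂) w := by
  refine ⟨h₁.1.append h₂.1, ?_⟩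
  rw [support_append, List.nodup_append]
  have h3 := h₂.2
  rw [support, List.nodup_cons] at h3
  refine ⟨h₁.2, h3.2, ?_⟩
  rintro x hx _ hy rfl
  obtain rfl := h x hx (List.mem_cons_of_mem _ hy)
  exact h3.1 hy

/-- Loop erasure. The inclusion of arc lists lets conditions on the arcs of the walk pass to the
path. -/
lemma IsWalk.exists_path (h : G.IsWalk u l v) : ∃ l', G.IsPath u l' v ∧ l' ⊆ l := by
  induction l generalizing u with
  | nil => exact ⟨[], ⟨h, by simp [support]⟩, by simp⟩
  | cons a l ih =>
    obtain ⟨l', hl', hsub⟩ := ih h.2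
    by_cases hu : u ∈ G.support (G.tgt a) l'
    · obtain ⟨l₁, l₂, rfl, h₁, h₂⟩ := hl'.1.exists_split_of_mem hu
      refine ⟨l₂, hl'.right_of_append h₁, fun x hx => ?_⟩
      exact List.mem_cons_of_mem _ (hsub (List.mem_append_right _ hx))
    · refine ⟨a :: l', ⟨⟨h.1, hl'.1⟩, ?_⟩, List.cons_subset_cons _ hsub⟩
      rw [support_cons, List.nodup_cons]
      exact ⟨hu, hl'.2⟩

lemma IsPath.nodup (h : G.IsPath u l v) : l.Nodup := by
  have := h.2
  rw [support, List.nodup_cons] at this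
  exact this.2.of_map

lemma IsPath.tgt_ne_start (h : G.IsPath u l v) {a : A} (ha : a ∈ l) : G.tgt a ≠ u := by
  have := h.2
  rw [support, List.nodup_cons] at this
  exact fun hu => this.1 (hu ▸ List.mem_map_of_mem ha)

lemma IsPath.tgt_injective (h : G.IsPath u l v) {a b : A} (ha : a ∈ l) (hb : b ∈ l)
    (hab : G.tgt a = G.tgt b) : a = b := by
  have := h.2
  rw [support, List.nodup_cons] at this
  exact List.inj_on_of_nodup_map this.2 ha hb hab

lemma IsPath.src_ne_end (h : G.IsPath u l v) {a : A} (ha : a ∈ l) : G.src a ≠ v := by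
  obtain ⟨l₁, l₂, rfl, h₁, h₂⟩ := h.1.exists_split_arc ha
  rintro rfl
  have h3 := h.right_of_append h₁
  have h4 := h3.2
  rw [support_cons, List.nodup_cons] at h4
  exact h4.1 h₂.end_mem_support

lemma IsPath.src_injective (h : G.IsPath u l v) {a b : A} (ha : a ∈ l) (hb : b ∈ l)
    (hab : G.src a = G.src b) : a = b := by
  induction l generalizing u with
  | nil => simp at ha
  | cons c l ih =>
    have h2 : G.IsPath (G.tgt c) l v := h.right_of_append (l₁ := [c]) ⟨h.1.1, rfl⟩
    have h3 := h.2
    rw [support_cons, List.nodup_cons] at h3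
    rcases List.mem_cons.1 ha with rfl | ha' <;> rcases List.mem_cons.1 hb with rfl | hb'
    · rfl
    · exact absurd (h.1.1 ▸ hab ▸ h2.1.src_mem_support hb') h3.1
    · exact absurd (h.1.1 ▸ hab ▸ h2.1.src_mem_support ha') h3.1
    · exact ih h2 ha' hb'

lemma Reachable.trans (h₁ : G.Reachable u v) (h₂ : G.Reachable v w) : G.Reachable u w := by
  obtain ⟨l₁, h₁⟩ := h₁
  obtain ⟨l₂, h₂⟩ := h₂
  exact ⟨_, h₁.append h₂⟩

lemma IsWalk.reachable_left (h : G.IsWalk u l v) (hw : w ∈ G.support u l) : G.Reachable u w := by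
  obtain ⟨l₁, _, _, h₁, _⟩ := h.exists_split_of_mem hw
  exact ⟨_, h₁⟩

lemma IsWalk.reachable_right (h : G.IsWalk u l v) (hw : w ∈ G.support u l) : G.Reachable w v := by
  obtain ⟨_, l₂, _, _, h₂⟩ := h.exists_split_of_mem hw
  exact ⟨_, h₂⟩

variable {C : Set V}

lemma IsSCC.reachable (hC : G.IsSCC C) (hu : u ∈ C) (hv : v ∈ C) : G.Reachable u v := by
  obtain ⟨c, rfl⟩ := hC
  exact hu.2.trans hv.1

lemma IsSCC.mem_of_reachable (hC : G.IsSCC C) (hu : u ∈ C) (hv : v ∈ C) (h₁ : G.Reachable u w)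
    (h₂ : G.Reachable w v) : w ∈ C := by
  obtain ⟨c, rfl⟩ := hC
  exact ⟨hu.1.trans h₁, h₂.trans hv.2⟩

lemma IsSCC.eq_of_mem (hC : G.IsSCC C) (hu : u ∈ C) :
    C = {v | G.Reachable u v ∧ G.Reachable v u} := by
  ext v
  exact ⟨fun hv => ⟨hC.reachable hu hv, hC.reachable hv hu⟩,
    fun hv => hC.mem_of_reachable hu hu hv.1 hv.2⟩

lemma IsSCC.support_subset (hC : G.IsSCC C) (hu : u ∈ C) (hv : v ∈ C) (h : G.IsWalk u l v) :
    ∀ w ∈ G.support u l, w ∈ C :=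
  fun _ hw => hC.mem_of_reachable hu hv (h.reachable_left hw) (h.reachable_right hw)

lemma IsSCC.mem_arcsOf (hC : G.IsSCC C) (hu : u ∈ C) (hv : v ∈ C) (h : G.IsWalk u l v) {a : A}
    (ha : a ∈ l) : a ∈ G.arcsOf C :=
  ⟨hC.support_subset hu hv h _ (h.src_mem_support ha),
    hC.support_subset hu hv h _ (tgt_mem_support ha)⟩

/-- Induction along a walk, used to carry potentials and outsideness from arc to arc. With `head?`
the base condition is vacuous for the empty walk. -/
lemma IsWalk.arcs_closed (h : G.IsWalk u l v) (P : A → Prop)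
    (h0 : ∀ a ∈ l.head?, P a)
    (hP : ∀ a ∈ l, ∀ b ∈ l, G.src b = G.tgt a → P a → P b) : ∀ a ∈ l, P a := by
  induction l generalizing u with
  | nil => simp
  | cons a l ih =>
    intro b hb
    have ha : P a := h0 a (by simp)
    rcases List.mem_cons.1 hb with rfl | hb
    · exact ha
    · refine ih h.2 (fun c hc => ?_) (fun c hc d hd => hP c (by simp [hc]) d (by simp [hd])) b hb
      cases l with
      | nil => simp at hc
      | cons c' l =>
        obtain rfl : c' = c := by simpa using hc
        exact hP a (by simp) c' (by simp) h.2.1 ha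

lemma IsWalk.src_of_mem_head? (h : G.IsWalk u l v) {a : A} (ha : a ∈ l.head?) : G.src a = u := by
  cases l with
  | nil => simp at ha
  | cons b l =>
    obtain rfl : b = a := by simpa using ha
    exact h.1

lemma IsWalk.exists_pred_of_closed (h : G.IsWalk u l u) {a : A} (ha : a ∈ l) :
    ∃ b ∈ l, G.tgt b = G.src a := by
  rcases mem_support.1 (h.src_mem_support ha) with h1 | h1
  · obtain ⟨l, c, rfl⟩ := (List.eq_nil_or_concat l).resolve_left (List.ne_nil_of_mem ha)
    rw [List.concat_eq_append] at *
    obtain ⟨w, -, h⟩ := isWalk_append.1 h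
    exact ⟨c, by simp, h.2.trans h1.symm⟩
  · exact h1

lemma IsWalk.exists_succ_of_closed (h : G.IsWalk u l u) {a : A} (ha : a ∈ l) :
    ∃ b ∈ l, G.src b = G.tgt a := by
  rcases h.mem_support_iff.1 (tgt_mem_support ha) with h1 | h1
  · cases l with
    | nil => simp at ha
    | cons c l => exact ⟨c, by simp, h.1.trans h1.symm⟩
  · exact h1

end Walk

/-! ### The chain of a walk -/

section Chain

open Classical in
/-- The chain over `ZMod 2` of a list of arcs. -/
noncomputable def chain (l : List A) (a : A) : ZMod 2 := (l.count a : ZMod 2)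

lemma chain_of_mem {l : List A} (h : l.Nodup) {a : A} (ha : a ∈ l) : chain l a = 1 := by
  classical
  simp [chain, List.count_eq_one_of_mem h ha]

lemma chain_of_notMem {l : List A} {a : A} (ha : a ∉ l) : chain l a = 0 := by
  classical
  simp [chain, List.count_eq_zero_of_not_mem ha]

/-- The sum telescopes modulo 2. Hence closed walks, and sums of walks whose end points cancel, are
circulations and have potentials. -/
lemma IsWalk.divergence_chain [Fintype A] [DecidableEq V] {G : EmbeddedDigraph V A} {u v : V}
    {l : List A} (h : G.IsWalk u l v) (w : V) :
    ∑ a, ((if G.src a = w then chain l a else 0) + if G.tgt a = w then chain l a else 0) =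
      (if u = w then 1 else 0) + if v = w then 1 else 0 := by
  classical
  induction l generalizing u with
  | nil =>
    obtain rfl := h
    simp [chain, CharTwo.add_self_eq_zero]
  | cons b l ih =>
    have hc : ∀ a, chain (b :: l) a = chain l a + if b = a then 1 else 0 := by
      intro a
      simp only [chain, List.count_cons, beq_iff_eq]
      push_cast
      rfl
    have := ih h.2
    rw [← h.1]
    have e : ∀ a, ((if G.src a = w then chain (b :: l) a else 0) +
        if G.tgt a = w then chain (b :: l) a else 0) =
        ((if G.src a = w then chain l a else 0) + if G.tgt a = w then chain l a else 0) +
        if b = a then ((if G.src a = w then 1 else 0) + if G.tgt a = w then 1 else 0) else 0 := by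
      intro a
      rw [hc]
      split_ifs <;> ring
    simp only [e]
    rw [Finset.sum_add_distrib, this, Finset.sum_ite_eq]
    simp only [Finset.mem_univ, if_true]
    have := CharTwo.add_self_eq_zero (if G.tgt b = w then (1 : ZMod 2) else 0)
    linear_combination this

end Chain

end EmbeddedDigraph

/-! ### Local structure of a plane drawing. -/

namespace EmbeddedDigraph

variable {V A : Type*} {G : EmbeddedDigraph V A}

/-! ### Rotation at a vertex -/

section Rotation

lemma IsPlane.vert_rot (hG : G.IsPlane) (d : A × Bool) : G.vert (G.rot d) = G.vert d :=
  ((hG.rot_sameCycle _ _).1 (Equiv.Perm.sameCycle_apply_right.2 (.refl _ _))).symm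

lemma IsPlane.vert_rot_symm (hG : G.IsPlane) (d : A × Bool) :
    G.vert (G.rot.symm d) = G.vert d := by
  have := hG.vert_rot (G.rot.symm d)
  rwa [Equiv.apply_symm_apply, eq_comm] at this

lemma IsPlane.isCycleOn (hG : G.IsPlane) (v : V) : G.rot.IsCycleOn {d | G.vert d = v} := by
  refine ⟨⟨fun d hd => (hG.vert_rot d).trans hd, G.rot.injective.injOn, fun d hd =>
    ⟨G.rot.symm d, (hG.vert_rot_symm d).trans hd, by simp⟩⟩, fun d hd d' hd' => ?_⟩
  exact (hG.rot_sameCycle _ _).2 (hd.trans (Eq.symm hd'))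

/-- A transitive permutation of three darts is a 3-cycle; all local case distinctions in `C` rest on
this enumeration of the darts at a vertex. -/
lemma IsPlane.rot_of_degree_three [Finite A] (hG : G.IsPlane) {d : A × Bool}
    (h3 : Nat.card {d' // G.vert d' = G.vert d} = 3) :
    G.rot (G.rot d) = G.rot.symm d ∧ G.rot d ≠ d ∧ G.rot.symm d ≠ d ∧ G.rot.symm d ≠ G.rot d ∧
      ∀ d', G.vert d' = G.vert d → d' = d ∨ d' = G.rot d ∨ d' = G.rot.symm d := by
  classical
  have := Fintype.ofFinite A
  have hcyc := hG.isCycleOn (G.vert d)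
  let S : Finset (A × Bool) := Finset.univ.filter fun d' => G.vert d' = G.vert d
  have hS : {d' | G.vert d' = G.vert d} = (S : Set (A × Bool)) := by ext; simp [S]
  have hcard : S.card = 3 := by
    rw [← h3, Nat.card_eq_fintype_card, Fintype.card_subtype]
  rw [hS] at hcyc
  have hd : d ∈ S := by simp [S]
  have hp := hcyc.pow_card_apply hd
  rw [hcard] at hp
  have hrr : G.rot (G.rot (G.rot d)) = d := hp
  have hrs : G.rot (G.rot d) = G.rot.symm d := by
    rw [Equiv.eq_symm_apply]; exact hrr
  have hall : ∀ d', G.vert d' = G.vert d → d' = d ∨ d' = G.rot d ∨ d' = G.rot.symm d := by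
    intro d' hd'
    obtain ⟨n, hn, rfl⟩ := hcyc.exists_pow_eq hd (b := d') (by simp [S, hd'])
    rw [hcard] at hn
    interval_cases n
    · exact .inl rfl
    · exact .inr (.inl rfl)
    · exact .inr (.inr hrs)
  have hsub : S ⊆ {d, G.rot d, G.rot.symm d} := by
    intro d' hd'
    simpa using hall d' (by simpa [S] using hd')
  have hle := Finset.card_le_card hsub
  have h1 : ∀ {x y : A × Bool}, ({d, G.rot d, G.rot.symm d} : Finset (A × Bool)) ⊆ {x, y} →
      False := by
    intro x y h
    have := Finset.card_le_card h
    have h2 := Finset.card_le_two (a := x) (b := y)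
    omega
  refine ⟨hrs, fun h => ?_, fun h => ?_, fun h => ?_, hall⟩
  · exact h1 (x := d) (y := G.rot.symm d) (by rw [h]; simp)
  · exact h1 (x := d) (y := G.rot d) (by rw [h]; simp [Finset.insert_subset_iff])
  · exact h1 (x := d) (y := G.rot d) (by rw [h]; simp)

/-- Along a path, the potential does not change on the left side of the path unless some arc that
carries flow is attached there. -/
lemma IsPlane.potential_left [Finite A] (hG : G.IsPlane) {φ : A × Bool → ZMod 2} {h : A → ZMod 2}
    (hφ : ∀ d, φ (G.faceNext d) = φ d) (hh : ∀ d, φ d + φ (flip d) = h d.1) {p q : A}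
    (hpq : G.src q = G.tgt p) (h3 : Nat.card {d' // G.vert d' = G.tgt p} = 3)
    (h0 : G.rot.symm (p, false) ≠ (q, true) → h (G.rot.symm (p, false)).1 = 0) :
    φ (p, true) = φ (q, true) := by
  obtain ⟨h1, -, -, -, h5⟩ := hG.rot_of_degree_three (d := (p, false)) h3
  have e1 : φ (G.rot.symm (p, false)) = φ (p, true) := by
    rw [← hφ (p, true)]; rfl
  -- Either `q` follows `p` on the face to the left of `p`, or the third dart lies between them on
  -- that side and has to be crossed.
  by_cases hx : G.rot.symm (p, false) = (q, true)
  · rw [← hx, e1]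
  have h0 := h0 hx
  rw [← hh, CharTwo.add_eq_zero] at h0
  have hq : (q, true) = G.rot (p, false) := by
    rcases h5 (q, true) hpq with h | h | h
    · simp at h
    · exact h
    · exact absurd h.symm hx
  rw [← e1, h0, ← hφ, faceNext_flip, hq, ← h1, Equiv.symm_apply_apply]

end Rotation

/-! ### Connectedness -/

section Connected

lemma Connected.symm {d d' : A × Bool} (h : G.Connected d d') : G.Connected d' d :=
  Relation.EqvGen.symm _ _ h

lemma Connected.trans {d d' d'' : A × Bool} (h : G.Connected d d') (h' : G.Connected d' d'') :
    G.Connected d d'' := Relation.EqvGen.trans _ _ _ h h'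

lemma connected_flip (d : A × Bool) : G.Connected d (flip d) := .rel _ _ (.inr rfl)

lemma connected_rot (d : A × Bool) : G.Connected d (G.rot d) := .rel _ _ (.inl rfl)

lemma connected_faceNext (d : A × Bool) : G.Connected d (G.faceNext d) := by
  refine (connected_flip d).trans (Connected.symm ?_)
  have := connected_rot (G := G) (G.rot.symm (flip d))
  rwa [Equiv.apply_symm_apply] at this

lemma IsPlane.connected_of_vert_eq [Finite A] (hG : G.IsPlane) {d d' : A × Bool}
    (h : G.vert d = G.vert d') : G.Connected d d' := by
  obtain ⟨n, rfl⟩ := ((hG.rot_sameCycle d d').2 h).exists_nat_pow_eq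
  induction n with
  | zero => exact .refl _
  | succ n ih =>
    rw [pow_succ', Equiv.Perm.mul_apply] at h ⊢
    rw [hG.vert_rot] at h
    exact (ih h).trans (connected_rot _)

lemma IsPlane.connected_of_isWalk [Finite A] (hG : G.IsPlane) {u v : V} {l : List A}
    (h : G.IsWalk u l v) {d d' : A × Bool} (hd : G.vert d = u) (hd' : G.vert d' = v) :
    G.Connected d d' := by
  induction l generalizing u d with
  | nil => exact hG.connected_of_vert_eq (hd.trans ((show u = v from h).trans hd'.symm))
  | cons a l ih =>
    refine (hG.connected_of_vert_eq (d' := (a, true)) (hd.trans h.1.symm)).trans ?_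
    exact (connected_flip _).trans (ih h.2 rfl)

end Connected

/-! ### The unbounded face of a set of arcs -/

section Outside

variable {S : Set A} {d d' : A × Bool}

lemma Outside.mono {S' : Set A} (hS : S' ⊆ S) (h : G.Outside S d) : G.Outside S' d := by
  induction h with
  | outer h => exact .outer h
  | face _ ih => exact .face ih
  | cross _ hd ih => exact .cross ih fun h => hd (hS h)

/-- `Outside` moves along faces in one direction only, but on finitely many darts the inverse of
`faceNext` acts as an iterate of it. -/
lemma outside_faceNext_iff [Finite A] : G.Outside S (G.faceNext d) ↔ G.Outside S d := by
  refine ⟨fun h => ?_, .face⟩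
  obtain ⟨n, hn⟩ := (Equiv.Perm.SameCycle.exists_nat_pow_eq (f := G.faceNext)
    (x := G.faceNext d) (y := d) (Equiv.Perm.sameCycle_apply_left.2 (.refl _ _)))
  have : ∀ n d, G.Outside S d → G.Outside S ((G.faceNext ^ n) d) := by
    intro n
    induction n with
    | zero => intro d h; exact h
    | succ n ih =>
      intro d h
      rw [pow_succ', Equiv.Perm.mul_apply]
      exact .face (ih d h)
  exact hn ▸ this n _ h

lemma outside_rot_symm_iff [Finite A] :
    G.Outside S (G.rot.symm d) ↔ G.Outside S (flip d) := by
  rw [← faceNext_flip, outside_faceNext_iff]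

/-- The angle between `d` and `rot d` lies in one face, which is to the left of `d` and to the right
of `rot d`. -/
lemma outside_flip_rot_iff [Finite A] : G.Outside S (flip (G.rot d)) ↔ G.Outside S d := by
  rw [← outside_rot_symm_iff, Equiv.symm_apply_apply]

lemma outside_flip_iff (hd : d.1 ∉ S) : G.Outside S (flip d) ↔ G.Outside S d :=
  ⟨fun h => by simpa using h.cross (d := flip d) hd, fun h => h.cross hd⟩

lemma IsPlane.outside_of_vert_eq [Finite A] (hG : G.IsPlane) (h : G.Outside S d)
    (hS : ∀ d', G.vert d' = G.vert d → d'.1 ∉ S) (hd : G.vert d' = G.vert d) :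
    G.Outside S d' := by
  obtain ⟨n, rfl⟩ := ((hG.rot_sameCycle d d').2 hd.symm).exists_nat_pow_eq
  induction n with
  | zero => exact h
  | succ n ih =>
    have h1 := hS _ hd
    rw [pow_succ', Equiv.Perm.mul_apply] at hd h1 ⊢
    rw [hG.vert_rot] at hd
    rw [← outside_flip_iff h1, outside_flip_rot_iff]
    exact ih hd

/-- Arcs off `S` carry no flow, so crossing them keeps the potential, and the outer darts of one
connected component lie on a single face. Connectedness is needed because potentials of different
components are unrelated. -/
lemma IsPlane.potential_eq_of_outside [Finite A] (hG : G.IsPlane) {φ : A × Bool → ZMod 2}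
    {h : A → ZMod 2} (hφ : ∀ d, φ (G.faceNext d) = φ d) (hh : ∀ d, φ d + φ (flip d) = h d.1)
    (hS : ∀ a ∉ S, h a = 0) (hd : G.Outside S d) (hd' : G.Outside S d') (hc : G.Connected d d') :
    φ d = φ d' := by
  have key : ∀ d, G.Outside S d → ∃ o ∈ G.outer, G.Connected d o ∧ φ d = φ o := by
    intro d hd
    induction hd with
    | @outer d h => exact ⟨d, h, .refl _, rfl⟩
    | @face d _ ih =>
      obtain ⟨o, ho, h1, h2⟩ := ih
      exact ⟨o, ho, (connected_faceNext d).symm.trans h1, (hφ d).trans h2⟩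
    | @cross d _ hd ih =>
      obtain ⟨o, ho, h1, h2⟩ := ih
      refine ⟨o, ho, (connected_flip d).symm.trans h1, ?_⟩
      rw [← h2, eq_comm, ← CharTwo.add_eq_zero, hh, hS _ hd]
  obtain ⟨o, ho, h1, h2⟩ := key d hd
  obtain ⟨o', ho', h1', h2'⟩ := key d' hd'
  obtain ⟨n, rfl⟩ := (hG.outer_unique o ho o' ho'
    (h1.symm.trans (hc.trans h1'))).exists_nat_pow_eq
  rw [h2, h2']
  clear h2 h2' h1 h1' ho'
  induction n with
  | zero => rfl
  | succ n ih => rw [pow_succ', Equiv.Perm.mul_apply, hφ, ih]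

/-- Otherwise outsideness would pass through every `flip`, hence through every `rot`, and spread
from an outer dart over the connected component up to `d` itself. -/
lemma IsPlane.exists_outside [Finite A] (hG : G.IsPlane) {d : A × Bool} (hd : d.1 ∈ S) :
    ∃ d', d'.1 ∈ S ∧ G.Outside S d' := by
  by_contra! hno
  obtain ⟨o, ho, hc⟩ := hG.exists_outer d
  refine hno d hd ?_
  have hflip : ∀ d, G.Outside S d → G.Outside S (flip d) :=
    fun d h => h.cross fun hd => hno d hd h
  have key : ∀ d d', G.Connected d d' → (G.Outside S d ↔ G.Outside S d') := by
    intro d d' h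
    induction h with
    | rel d d' h =>
      rcases h with rfl | rfl
      · constructor
        · intro h
          rw [← outside_flip_rot_iff] at h
          simpa using hflip _ h
        · intro h
          rw [← outside_flip_rot_iff]
          exact hflip _ h
      · exact ⟨hflip d, fun h => by simpa using hflip _ h⟩
    | refl => rfl
    | symm _ _ _ ih => exact ih.symm
    | trans _ _ _ _ _ ih1 ih2 => exact ih1.trans ih2
  exact (key d o hc).2 (.outer ho)

end Outside

end EmbeddedDigraph

/-! ### The outer boundary of the component, its entrances and exits. -/

namespace EmbeddedDigraph

variable {V A : Type*} {G : EmbeddedDigraph V A} {s t : V} {C : Set V}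

/-! ### Components outside of which the source lies -/

namespace IsOutsideComponent

lemma exists_closed_walk (hC : G.IsOutsideComponent s t C) {v : V} (hv : v ∈ C) :
    ∃ l, l ≠ [] ∧ G.IsWalk v l v := by
  obtain ⟨a, ha⟩ := hC.nontrivial
  obtain ⟨l₁, h₁⟩ := hC.scc.reachable hv ha.1
  obtain ⟨l₂, h₂⟩ := hC.scc.reachable ha.2 hv
  exact ⟨l₁ ++ a :: l₂, by simp, h₁.append ⟨rfl, h₂⟩⟩

lemma exists_in (hC : G.IsOutsideComponent s t C) {v : V} (hv : v ∈ C) :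
    ∃ a ∈ G.arcsOf C, G.tgt a = v := by
  obtain ⟨l, hl, h⟩ := hC.exists_closed_walk hv
  obtain ⟨l, a, rfl⟩ := (List.eq_nil_or_concat l).resolve_left hl
  rw [List.concat_eq_append] at h
  refine ⟨a, hC.scc.mem_arcsOf hv hv h (by simp), ?_⟩
  obtain ⟨w, -, h⟩ := isWalk_append.1 h
  exact h.2

lemma exists_out (hC : G.IsOutsideComponent s t C) {v : V} (hv : v ∈ C) :
    ∃ a ∈ G.arcsOf C, G.src a = v := by
  obtain ⟨l, hl, h⟩ := hC.exists_closed_walk hv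
  obtain ⟨a, l, rfl⟩ := List.exists_cons_of_ne_nil hl
  exact ⟨a, hC.scc.mem_arcsOf hv hv h (by simp), h.1⟩

lemma source_notMem (hC : G.IsOutsideComponent s t C) : s ∉ C := hC.source_outside.1

lemma degree_three (hC : G.IsOutsideComponent s t C) (hN : G.IsNormalNetwork s t) {v : V}
    (hv : v ∈ C) : Nat.card {d // G.vert d = v} = 3 :=
  hN.degree_three v (fun h => hC.source_notMem (h ▸ hv)) (fun h => hC.sink_notMem (h ▸ hv))

end IsOutsideComponent

/-- Strong connectivity closes `a` to a directed cycle inside `C`. The unbounded face of `C` is part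
of that of the cycle, so the cycle would be clockwise. -/
lemma IsSCC.not_outside_true (hC : G.IsSCC C) (hN : G.IsNormalNetwork s t) {a : A}
    (ha : a ∈ G.arcsOf C) : ¬ G.Outside (G.arcsOf C) (a, true) := by
  intro h
  obtain ⟨l, hl⟩ := hC.reachable ha.2 ha.1
  obtain ⟨l, hl, -⟩ := hl.exists_path
  refine hN.no_clockwise (a :: l) ⟨⟨by simp, ⟨G.src a, rfl, hl.1⟩, hl.2⟩, a, by simp, ?_⟩
  refine h.mono fun b hb => ?_
  rcases List.mem_cons.1 hb with rfl | hb
  · exact ha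
  · exact hC.mem_arcsOf ha.2 ha.1 hl.1 hb

lemma IsSCC.mem_boundary_iff (hC : G.IsSCC C) (hN : G.IsNormalNetwork s t) {a : A} :
    a ∈ G.boundary C ↔ a ∈ G.arcsOf C ∧ G.Outside (G.arcsOf C) (a, false) := by
  constructor
  · rintro ⟨ha, _ | _, h⟩
    · exact ⟨ha, h⟩
    · exact absurd h (hC.not_outside_true hN ha)
  · rintro ⟨ha, h⟩
    exact ⟨ha, false, h⟩

section Structure

variable [Finite A]

/-- The arc of the unbounded face that follows a boundary arc. -/
lemma IsOutsideComponent.exists_succ (hC : G.IsOutsideComponent s t C)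
    (hN : G.IsNormalNetwork s t) {b : A} (hb : b ∈ G.boundary C) :
    ∃ b' ∈ G.boundary C, G.src b' = G.tgt b ∧
      (G.rot (b, false) = (b', true) ∨
        (G.rot (b, false)).1 ∉ G.arcsOf C ∧ G.rot (G.rot (b, false)) = (b', true)) := by
  obtain ⟨hbC, hout⟩ := (hC.scc.mem_boundary_iff hN).1 hb
  obtain ⟨h1, -, -, -, h5⟩ := hN.plane.rot_of_degree_three (d := (b, false))
    (hC.degree_three hN hbC.2)
  have hv := hN.plane.vert_rot (b, false)
  -- A counterclockwise turn from an outside dart meets a dart with the unbounded face on its right.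
  -- If its arc is in `C`, it must be a tail end by `IsSCC.not_outside_true`.
  have key : ∀ d, G.Outside (G.arcsOf C) d → G.vert d = G.tgt b → (G.rot d).1 ∈ G.arcsOf C →
      ∃ b' ∈ G.boundary C, G.src b' = G.tgt b ∧ G.rot d = (b', true) := by
    intro d hd hdv hdC
    have hv := hN.plane.vert_rot d
    rw [← outside_flip_rot_iff] at hd
    generalize G.rot d = d' at *
    obtain ⟨b', _ | _⟩ := d'
    · exact absurd hd (hC.scc.not_outside_true hN hdC)
    · exact ⟨b', (hC.scc.mem_boundary_iff hN).2 ⟨hdC, hd⟩, hv.trans hdv, rfl⟩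
  by_cases hr : (G.rot (b, false)).1 ∈ G.arcsOf C
  · obtain ⟨b', h2, h3, h4⟩ := key _ hout rfl hr
    exact ⟨b', h2, h3, .inl h4⟩
  -- The counterclockwise neighbour is not in `C`, so the remaining dart is the out-arc that strong
  -- connectivity provides.
  · obtain ⟨o, hoC, ho⟩ := hC.exists_out hbC.2
    have ho' : (o, true) = G.rot (G.rot (b, false)) := by
      rcases h5 (o, true) ho with h | h | h
      · simp at h
      · rw [← h] at hr
        exact absurd hoC hr
      · rw [h, h1]
    obtain ⟨b', h2, h3, h4⟩ := key (G.rot (b, false))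
      (by rwa [← outside_flip_iff hr, outside_flip_rot_iff]) hv (by rwa [← ho'])
    exact ⟨b', h2, h3, .inr ⟨hr, h4⟩⟩

/-- Two boundary in-arcs and an out-arc of `C` exhaust the three darts at the vertex. The unbounded
face would then turn from each in-arc directly into the out-arc, against injectivity of `rot`. -/
lemma IsOutsideComponent.boundary_tgt_injective (hC : G.IsOutsideComponent s t C)
    (hN : G.IsNormalNetwork s t) {a b : A} (ha : a ∈ G.boundary C) (hb : b ∈ G.boundary C)
    (hab : G.tgt a = G.tgt b) : a = b := by
  by_contra hne
  obtain ⟨o, hoC, ho⟩ := hC.exists_out ha.1.2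
  have key : ∀ a b, a ∈ G.boundary C → b ∈ G.boundary C → G.tgt a = G.tgt b → a ≠ b →
      G.src o = G.tgt a → G.rot (a, false) = (o, true) := by
    intro a b ha hb hab hne ho
    obtain ⟨-, -, -, -, h5⟩ := hN.plane.rot_of_degree_three (d := (a, false))
      (hC.degree_three hN ha.1.2)
    have h6 := h5 (o, true) ho
    have h7 := h5 (b, false) hab.symm
    obtain ⟨a', ha', -, h | ⟨h, -⟩⟩ := hC.exists_succ hN ha
    · rw [h] at h6 h7 ⊢
      simp only [Prod.mk.injEq, Bool.true_eq_false, and_false, false_or, and_true,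
        Bool.false_eq_true] at h6 h7
      rcases h6 with rfl | h6
      · rfl
      · rw [← h6] at h7
        simp [Ne.symm hne] at h7
    · exfalso
      rcases h6 with h6 | h6 | h6
      · simp at h6
      · rw [← h6] at h
        exact h hoC
      · rw [← h6] at h7
        rcases h7 with h7 | h7 | h7
        · simp [Ne.symm hne] at h7
        · rw [← h7] at h
          exact h hb.1
        · simp at h7
  have := (key a b ha hb hab hne ho).trans
    (key b a hb ha hab.symm (Ne.symm hne) (ho.trans hab)).symm
  simp [hne] at this

/-- The successor is injective by uniqueness of heads, and the boundary is finite. Surjectivity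
yields predecessors and uniqueness of tails. -/
lemma IsOutsideComponent.exists_bijective_succ (hC : G.IsOutsideComponent s t C)
    (hN : G.IsNormalNetwork s t) : ∃ f : G.boundary C → G.boundary C, Function.Bijective f ∧
      ∀ b, G.src (f b : A) = G.tgt (b : A) := by
  choose! f hf hsrc _ using fun b (hb : b ∈ G.boundary C) => hC.exists_succ hN hb
  refine ⟨fun b => ⟨f b, hf b b.2⟩, ?_, fun b => hsrc b b.2⟩
  rw [← Finite.injective_iff_bijective]
  intro a b hab
  have h : f a = f b := congrArg Subtype.val hab
  apply Subtype.ext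
  apply hC.boundary_tgt_injective hN a.2 b.2
  rw [← hsrc a a.2, ← hsrc b b.2, h]

lemma IsOutsideComponent.exists_pred (hC : G.IsOutsideComponent s t C)
    (hN : G.IsNormalNetwork s t) {b : A} (hb : b ∈ G.boundary C) :
    ∃ a ∈ G.boundary C, G.tgt a = G.src b := by
  obtain ⟨f, hf, hsrc⟩ := hC.exists_bijective_succ hN
  obtain ⟨a, ha⟩ := hf.2 ⟨b, hb⟩
  refine ⟨a, a.2, ?_⟩
  rw [← hsrc a, ha]

lemma IsOutsideComponent.boundary_src_injective (hC : G.IsOutsideComponent s t C)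
    (hN : G.IsNormalNetwork s t) {a b : A} (ha : a ∈ G.boundary C) (hb : b ∈ G.boundary C)
    (hab : G.src a = G.src b) : a = b := by
  obtain ⟨f, hf, hsrc⟩ := hC.exists_bijective_succ hN
  obtain ⟨a', ha'⟩ := hf.2 ⟨a, ha⟩
  obtain ⟨b', hb'⟩ := hf.2 ⟨b, hb⟩
  have h1 := hsrc a'
  have h2 := hsrc b'
  rw [ha'] at h1
  rw [hb'] at h2
  have := hC.boundary_tgt_injective hN a'.2 b'.2 (by rw [← h1, ← h2, hab])
  have h3 : (⟨a, ha⟩ : G.boundary C) = ⟨b, hb⟩ := by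
    rw [← ha', ← hb', Subtype.ext this]
  exact congrArg Subtype.val h3

lemma IsOutsideComponent.rot_of_boundary (hC : G.IsOutsideComponent s t C)
    (hN : G.IsNormalNetwork s t) {a b : A} (ha : a ∈ G.boundary C) (hb : b ∈ G.boundary C)
    (hab : G.src b = G.tgt a) :
    G.rot (a, false) = (b, true) ∨
      (G.rot (a, false)).1 ∉ G.arcsOf C ∧ G.rot (G.rot (a, false)) = (b, true) := by
  obtain ⟨b', hb', h1, h2⟩ := hC.exists_succ hN ha
  rwa [hC.boundary_src_injective hN hb hb' (hab.trans h1.symm)]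

/-- The neighbours of a dart that leaves `C` on the outside. -/
lemma IsOutsideComponent.rot_of_outside (hC : G.IsOutsideComponent s t C)
    (hN : G.IsNormalNetwork s t) {d : A × Bool} (hd : G.Outside (G.arcsOf C) d)
    (hdC : d.1 ∉ G.arcsOf C) (hv : G.vert d ∈ C) :
    ∃ a ∈ G.boundary C, ∃ b ∈ G.boundary C, G.rot.symm d = (a, false) ∧ G.rot d = (b, true) := by
  obtain ⟨h1, h2, -, -, h5⟩ := hN.plane.rot_of_degree_three (hC.degree_three hN hv)
  obtain ⟨i, hiC, hi⟩ := hC.exists_in hv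
  obtain ⟨o, hoC, ho⟩ := hC.exists_out hv
  have hi' : (i, false) = G.rot d ∨ (i, false) = G.rot.symm d :=
    (h5 (i, false) hi).resolve_left fun h => hdC (h ▸ hiC)
  have ho' : (o, true) = G.rot d ∨ (o, true) = G.rot.symm d :=
    (h5 (o, true) ho).resolve_left fun h => hdC (h ▸ hoC)
  have e1 := (outside_flip_rot_iff (S := G.arcsOf C)).2 hd
  have e2 := (outside_rot_symm_iff (S := G.arcsOf C)).2 ((outside_flip_iff hdC).2 hd)
  -- The other two darts are an in-arc and an out-arc of `C`. The reversed cyclic order would put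
  -- the unbounded face on the left of the in-arc.
  rcases hi' with hi' | hi' <;> rcases ho' with ho' | ho'
  · simp [← ho'] at hi'
  · rw [← hi'] at e1
    exact absurd e1 (hC.scc.not_outside_true hN hiC)
  · rw [← hi'] at e2
    rw [← ho'] at e1
    exact ⟨i, (hC.scc.mem_boundary_iff hN).2 ⟨hiC, e2⟩, o,
      (hC.scc.mem_boundary_iff hN).2 ⟨hoC, e1⟩, hi'.symm, ho'.symm⟩
  · simp [← ho'] at hi'

lemma IsOutsideComponent.connected (hC : G.IsOutsideComponent s t C)
    (hN : G.IsNormalNetwork s t) {d d' : A × Bool} (hd : G.vert d ∈ C) (hd' : G.vert d' ∈ C) :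
    G.Connected d d' := by
  obtain ⟨l, hl⟩ := hC.scc.reachable hd hd'
  exact hN.plane.connected_of_isWalk hl rfl rfl

lemma IsOutsideComponent.outside_of_vert_eq (hN : G.IsNormalNetwork s t)
    {d d' : A × Bool} (h : G.Outside (G.arcsOf C) d) (hd : G.vert d ∉ C)
    (hd' : G.vert d' = G.vert d) : G.Outside (G.arcsOf C) d' := by
  refine hN.plane.outside_of_vert_eq h (fun d'' h'' => ?_) hd'
  rw [← h''] at hd
  obtain ⟨a, _ | _⟩ := d''
  · exact fun h => hd h.2
  · exact fun h => hd h.1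

/-- A vertex off `C` that sees the unbounded face of `C` sees nothing else, and arcs with tail off
`C` can be crossed, so outsideness spreads from `s`. -/
lemma IsOutsideComponent.outside_of_walk_from_source (hC : G.IsOutsideComponent s t C)
    (hN : G.IsNormalNetwork s t) {v : V} {l : List A} (hl : G.IsWalk s l v)
    (hlC : ∀ a ∈ l, G.src a ∉ C) {a : A} (ha : a ∈ l) (b : Bool) :
    G.Outside (G.arcsOf C) (a, b) := by
  obtain ⟨hs, d, rfl, hd⟩ := hC.source_outside
  have key : ∀ a ∈ l, G.Outside (G.arcsOf C) (a, true) := by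
    refine hl.arcs_closed _ (fun a h => ?_) fun a ha b hb hab h => ?_
    · exact outside_of_vert_eq hN hd hs (hl.src_of_mem_head? h)
    · have h1 : G.Outside (G.arcsOf C) (a, false) :=
        (outside_flip_iff (d := (a, true)) fun h => hlC a ha h.1).2 h
      exact outside_of_vert_eq hN h1 (by rw [vert_false, ← hab]; exact hlC b hb) hab
  cases b
  · exact (outside_flip_iff (d := (a, true)) fun h => hlC a ha h.1).2 (key a ha)
  · exact key a ha

/-- Outsideness spreads backwards along the walk, starting from the sink, which is on the unbounded
face of `G`. -/
lemma IsOutsideComponent.outside_of_walk_to_sink (hC : G.IsOutsideComponent s t C)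
    (hN : G.IsNormalNetwork s t) {u : V} {l : List A} (hl : G.IsWalk u l t)
    (hlC : ∀ a ∈ l, G.tgt a ∉ C) {a : A} (ha : a ∈ l) (b : Bool) :
    G.Outside (G.arcsOf C) (a, b) := by
  induction l generalizing u a b with
  | nil => simp at ha
  | cons c l ih =>
    have hlC' : ∀ a ∈ l, G.tgt a ∉ C := fun a ha => hlC a (by simp [ha])
    rcases List.mem_cons.1 ha with rfl | ha
    · have h1 : G.Outside (G.arcsOf C) (a, false) := by
        cases l with
        | nil =>
          obtain ⟨d, hd, hdt⟩ := hN.sink_outer ⟨(a, false), hl.2⟩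
          exact outside_of_vert_eq hN (.outer hd) (hdt ▸ hC.sink_notMem) (Eq.trans hl.2 hdt.symm)
        | cons c l =>
          have := ih hl.2 hlC' (a := c) (by simp) true
          refine outside_of_vert_eq hN this ?_ hl.2.1.symm
          rw [vert_true, hl.2.1]
          exact hlC a (by simp)
      cases b
      · exact h1
      · exact (outside_flip_iff (d := (a, false)) fun h => hlC a (by simp) h.2).2 h1
    · exact ih hl.2 hlC' ha b

end Structure

/-! ### Entrances and exits -/

lemma IsEntrance.exists_path {v : V} (h : G.IsEntrance s C v) :
    ∃ l, G.IsPath s l v ∧ ∀ a ∈ l, G.src a ∉ C := by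
  obtain ⟨hv, l, hl, h⟩ := h
  exact ⟨l, hl, fun a ha hC => hl.src_ne_end ha (h _ (hl.1.src_mem_support ha) hC)⟩

lemma IsExit.exists_path {v : V} (h : G.IsExit t C v) :
    ∃ l, G.IsPath v l t ∧ ∀ a ∈ l, G.tgt a ∉ C := by
  obtain ⟨hv, l, hl, h⟩ := h
  exact ⟨l, hl, fun a ha hC => hl.tgt_ne_start ha (h _ (tgt_mem_support ha) hC)⟩

lemma isEntrance_of_walk {v : V} {l : List A} (hv : v ∈ C) (hl : G.IsWalk s l v)
    (h : ∀ a ∈ l, G.src a ∉ C) : G.IsEntrance s C v := by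
  obtain ⟨l', hl', hsub⟩ := hl.exists_path
  refine ⟨hv, l', hl', fun w hw hwC => ?_⟩
  rcases hl'.1.mem_support_iff.1 hw with rfl | ⟨a, ha, rfl⟩
  · rfl
  · exact absurd hwC (h a (hsub ha))

lemma isExit_of_walk {v : V} {l : List A} (hv : v ∈ C) (hl : G.IsWalk v l t)
    (h : ∀ a ∈ l, G.tgt a ∉ C) : G.IsExit t C v := by
  obtain ⟨l', hl', hsub⟩ := hl.exists_path
  refine ⟨hv, l', hl', fun w hw hwC => ?_⟩
  rcases mem_support.1 hw with rfl | ⟨a, ha, rfl⟩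
  · rfl
  · exact absurd hwC (h a (hsub ha))

section EntranceExit

variable [Finite A]

/-- The arc through which a walk from the source enters `C`. -/
lemma IsOutsideComponent.entrance_arc (hC : G.IsOutsideComponent s t C)
    (hN : G.IsNormalNetwork s t) {v : V} (h : G.IsEntrance s C v) :
    ∃ r, r ∉ G.arcsOf C ∧ G.tgt r = v ∧ G.Outside (G.arcsOf C) (r, false) := by
  obtain ⟨l, hl, hlC⟩ := h.exists_path
  have hne : l ≠ [] := by
    rintro rfl
    obtain rfl : s = v := hl.1
    exact hC.source_notMem h.1
  obtain ⟨l, r, rfl⟩ := (List.eq_nil_or_concat l).resolve_left hne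
  rw [List.concat_eq_append] at hl hlC
  refine ⟨r, fun h => hlC r (by simp) h.1, ?_,
    hC.outside_of_walk_from_source hN hl.1 hlC (by simp) _⟩
  obtain ⟨w, -, h⟩ := isWalk_append.1 hl.1
  exact h.2

lemma IsOutsideComponent.exit_arc (hC : G.IsOutsideComponent s t C)
    (hN : G.IsNormalNetwork s t) {v : V} (hv : v ∈ C) {l : List A} (hl : G.IsWalk v l t)
    (hlC : ∀ a ∈ l, G.tgt a ∉ C) :
    ∃ r ∈ l, r ∉ G.arcsOf C ∧ G.src r = v ∧ G.Outside (G.arcsOf C) (r, true) := by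
  cases l with
  | nil =>
    obtain rfl : v = t := hl
    exact absurd hv hC.sink_notMem
  | cons r l =>
    exact ⟨r, by simp, fun h => hlC r (by simp) h.2, hl.1,
      hC.outside_of_walk_to_sink hN hl hlC (by simp) _⟩

/-- An in-arc and an out-arc of `C` leave room for one more dart, which cannot be both the head of
an entering arc and the tail of a leaving one. -/
lemma IsOutsideComponent.not_isExit (hC : G.IsOutsideComponent s t C)
    (hN : G.IsNormalNetwork s t) {v : V} (h : G.IsEntrance s C v) : ¬ G.IsExit t C v := by
  intro h'
  obtain ⟨r, hrC, hr, hro⟩ := hC.entrance_arc hN h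
  obtain ⟨l, hl, hlC⟩ := h'.exists_path
  obtain ⟨r', -, hrC', hr', -⟩ := hC.exit_arc hN h.1 hl.1 hlC
  have hv : G.vert (r, false) ∈ C := by rw [vert_false, hr]; exact h.1
  obtain ⟨a, ha, b, hb, h1, h2⟩ := hC.rot_of_outside hN hro hrC hv
  obtain ⟨-, -, -, -, h5⟩ := hN.plane.rot_of_degree_three (hC.degree_three hN hv)
  rcases h5 (r', true) (by rw [vert_true, vert_false, hr, hr']) with h6 | h6 | h6
  · simp at h6
  · rw [h2] at h6
    obtain rfl : r' = b := congrArg Prod.fst h6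
    exact hrC' hb.1
  · simp [h1] at h6

/-- The boundary arcs before and after an entrance. -/
lemma IsOutsideComponent.boundary_of_isEntrance (hC : G.IsOutsideComponent s t C)
    (hN : G.IsNormalNetwork s t) {v : V} (h : G.IsEntrance s C v) :
    ∃ a ∈ G.boundary C, ∃ b ∈ G.boundary C, G.tgt a = v ∧ G.src b = v ∧
      (∀ c ∈ G.arcsOf C, G.src c = v → c = b) := by
  obtain ⟨r, hrC, hr, hro⟩ := hC.entrance_arc hN h
  have hv : G.vert (r, false) ∈ C := by rw [vert_false, hr]; exact h.1
  obtain ⟨a, ha, b, hb, h1, h2⟩ := hC.rot_of_outside hN hro hrC hv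
  have hva := hN.plane.vert_rot_symm (r, false)
  have hvb := hN.plane.vert_rot (r, false)
  rw [h1, vert_false, vert_false, hr] at hva
  rw [h2, vert_true, vert_false, hr] at hvb
  refine ⟨a, ha, b, hb, hva, hvb, fun c hc hcv => ?_⟩
  obtain ⟨-, -, -, -, h5⟩ := hN.plane.rot_of_degree_three (hC.degree_three hN hv)
  rcases h5 (c, true) (by rw [vert_true, vert_false, hr, hcv]) with h6 | h6 | h6
  · simp at h6
  · rw [h2] at h6
    exact congrArg Prod.fst h6
  · simp [h1] at h6

lemma IsOutsideComponent.boundary_of_isExit (hC : G.IsOutsideComponent s t C)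
    (hN : G.IsNormalNetwork s t) {v : V} (h : G.IsExit t C v) :
    ∃ b ∈ G.boundary C, G.src b = v ∧ ∀ c ∈ G.arcsOf C, G.src c = v → c = b := by
  obtain ⟨l, hl, hlC⟩ := h.exists_path
  obtain ⟨r, -, hrC, hr, hro⟩ := hC.exit_arc hN h.1 hl.1 hlC
  have hv : G.vert (r, true) ∈ C := by rw [vert_true, hr]; exact h.1
  obtain ⟨a, ha, b, hb, h1, h2⟩ := hC.rot_of_outside hN hro hrC hv
  have hvb := hN.plane.vert_rot (r, true)
  rw [h2, vert_true, vert_true, hr] at hvb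
  refine ⟨b, hb, hvb, fun c hc hcv => ?_⟩
  obtain ⟨-, -, -, -, h5⟩ := hN.plane.rot_of_degree_three (hC.degree_three hN hv)
  rcases h5 (c, true) (by rw [vert_true, vert_true, hr, hcv]) with h6 | h6 | h6
  · obtain rfl : c = r := congrArg Prod.fst h6
    exact absurd hc hrC
  · rw [h2] at h6
    exact congrArg Prod.fst h6
  · simp [h1] at h6

/-- Walks that lead to an entrance and walks that lead from an exit are disjoint. -/
lemma IsOutsideComponent.disjoint_walks (hC : G.IsOutsideComponent s t C)
    (hN : G.IsNormalNetwork s t) {e x w : V} (he : G.IsEntrance s C e) (hx : G.IsExit t C x)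
    {l₁ l₂ : List A} (h₁ : G.IsWalk s l₁ e) (hC₁ : ∀ a ∈ l₁, G.src a ∉ C)
    (h₂ : G.IsWalk x l₂ t) (hC₂ : ∀ a ∈ l₂, G.tgt a ∉ C)
    (hw₁ : w ∈ G.support s l₁) (hw₂ : w ∈ G.support x l₂) : False := by
  -- A common vertex is reachable from `C` and reaches `C`, so it lies in `C`; the walks meet `C`
  -- only in `e` and in `x`.
  have hw := hC.scc.mem_of_reachable hx.1 he.1 (h₂.reachable_left hw₂) (h₁.reachable_right hw₁)
  rcases h₁.mem_support_iff.1 hw₁ with rfl | ⟨a, ha, rfl⟩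
  · rcases mem_support.1 hw₂ with rfl | ⟨a, ha, rfl⟩
    · exact hC.not_isExit hN he hx
    · exact hC₂ a ha hw
  · exact hC₁ a ha hw

end EntranceExit

end EmbeddedDigraph

/-! ### Jordan-type arguments by potentials. -/

namespace EmbeddedDigraph

variable {V A : Type*} {G : EmbeddedDigraph V A} {s t : V} {C : Set V}

/-! ### Consequences of planarity -/

section Planarity

variable [Finite A]

/-- The boundary of `C` consists of a single cycle. -/
lemma IsOutsideComponent.mem_of_mem_boundary (hC : G.IsOutsideComponent s t C)
    (hN : G.IsNormalNetwork s t) {z : V} {Z : List A} (hZ : G.IsWalk z Z z) (hnd : Z.Nodup)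
    (hne : Z ≠ []) (hZB : ∀ a ∈ Z, a ∈ G.boundary C) {b : A} (hb : b ∈ G.boundary C) : b ∈ Z := by
  classical
  have := Fintype.ofFinite A
  by_contra hbZ
  obtain ⟨φ, hφ, hh⟩ := hN.plane.exists_potential (chain Z) fun v => by
    rw [hZ.divergence_chain, CharTwo.add_self_eq_zero]
  obtain ⟨z0, hz0⟩ := List.exists_mem_of_ne_nil Z hne
  have hB := fun a => hC.scc.mem_boundary_iff hN (a := a)
  have hout : ∀ a ∈ G.boundary C, φ (a, false) = φ (b, false) := by
    intro a ha
    refine hN.plane.potential_eq_of_outside hφ hh (S := G.arcsOf C) (fun a ha => ?_)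
      ((hB a).1 ha).2 ((hB b).1 hb).2 (hC.connected hN ha.1.2 hb.1.2)
    exact chain_of_notMem fun h => ha (hZB a h).1
  have heq : ∀ p ∉ Z, φ (p, true) = φ (p, false) := fun p hp => by
    rw [← CharTwo.add_eq_zero]
    exact (hh (p, true)).trans (chain_of_notMem hp)
  obtain ⟨R, hR⟩ := hC.scc.reachable hb.1.2 (hZB z0 hz0).1.1
  have hw : G.IsWalk (G.src b) (b :: R ++ [z0]) (G.tgt z0) :=
    IsWalk.append (v := G.src z0) ⟨rfl, hR⟩ ⟨rfl, rfl⟩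
  have hwC := fun a => hC.scc.mem_arcsOf (a := a) hb.1.1 (hZB z0 hz0).1.2 hw
  -- A walk inside `C` from `b` to `Z` starts with the outer potential on its left. It keeps this
  -- potential and therefore never gets onto `Z`.
  have key := hw.arcs_closed (fun p => p ∉ Z ∧ φ (p, true) = φ (b, false)) ?_ ?_
  · exact (key z0 (by simp)).1 hz0
  · intro p hp
    obtain rfl : b = p := by simpa using hp
    exact ⟨hbZ, heq b hbZ⟩
  · rintro p hpR q hqR hpq ⟨hp, hpc⟩
    have hpC := hwC p hpR
    have h3 := hC.degree_three hN hpC.2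
    obtain ⟨h1, h2, h2', h2'', h5⟩ := hN.plane.rot_of_degree_three (d := (p, false)) h3
    -- If `q` were on `Z`, then `p` would join from the left between `q` and its predecessor `i` on
    -- `Z`. The left of `i` is then the right of `p` and has the outer potential, as has the right
    -- of `i`, although `i` carries flow.
    have hqZ : q ∉ Z := by
      intro hqZ
      obtain ⟨i, hi, hiv⟩ := hZ.exists_pred_of_closed hqZ
      have hiv' := hiv.trans hpq
      have hpi : (i, false) ≠ (p, false) := by
        intro h
        obtain rfl : i = p := congrArg Prod.fst h
        exact hp hi
      have hrot : G.rot (i, false) = (q, true) := by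
        rcases hC.rot_of_boundary hN (hZB i hi) (hZB q hqZ) hiv.symm with h | ⟨h, h'⟩
        · exact h
        · exfalso
          have h6 := h5 (G.rot (i, false)) ((hN.plane.vert_rot _).trans hiv')
          have h7 := h5 (i, false) hiv'
          rcases h6 with h6 | h6 | h6
          · rw [h6] at h; exact h hpC
          · exact hpi (G.rot.injective h6)
          · rcases h7 with h7 | h7 | h7
            · exact hpi h7
            · rw [h6, Equiv.apply_symm_apply] at h'
              simp at h'
            · rw [h7] at h6
              have := hN.plane.rot_of_degree_three (d := (i, false))
                (hC.degree_three hN (hZB i hi).1.2)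
              exact this.2.1 (h7 ▸ h6)
      have hsymm : G.rot.symm (i, false) = (p, false) := by
        obtain ⟨-, -, -, -, h5⟩ := hN.plane.rot_of_degree_three (d := (i, false))
          (hC.degree_three hN (hZB i hi).1.2)
        rcases h5 (p, false) hiv'.symm with h | h | h
        · exact absurd h.symm hpi
        · simp [hrot] at h
        · exact h.symm
      have e1 : φ (i, true) = φ (b, false) := by
        rw [← hφ (i, true), faceNext_apply, flip_mk, Bool.not_true, hsymm, ← heq p hp, hpc]
      have e2 := hh (i, true)
      rw [flip_mk, Bool.not_true, e1, hout i (hZB i hi), CharTwo.add_self_eq_zero,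
        chain_of_mem hnd hi] at e2
      exact zero_ne_one e2
    -- The third dart on the left is not on `Z` either: the closed walk `Z` would need a second dart
    -- at this vertex, and that would be `p` or `q`.
    refine ⟨hqZ, ?_⟩
    rw [← hpc, eq_comm]
    refine hN.plane.potential_left hφ hh hpq h3 fun hd => chain_of_notMem fun hdZ => ?_
    have hvd : G.vert (G.rot.symm (p, false)) = G.tgt p := hN.plane.vert_rot_symm (p, false)
    have hq5 : (q, true) = G.rot (p, false) := by
      rcases h5 (q, true) hpq with h | h | h
      · simp at h
      · exact h
      · exact absurd h.symm hd
    generalize G.rot.symm (p, false) = d at *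
    obtain ⟨r, _ | _⟩ := d
    · obtain ⟨o, ho, hov⟩ := hZ.exists_succ_of_closed hdZ
      rcases h5 (o, true) (hov.trans hvd) with h | h | h
      · simp at h
      · rw [← hq5] at h
        obtain rfl : o = q := congrArg Prod.fst h
        exact hqZ ho
      · simp at h
    · obtain ⟨i, hi, hiv⟩ := hZ.exists_pred_of_closed hdZ
      rcases h5 (i, false) (hiv.trans hvd) with h | h | h
      · obtain rfl : i = p := congrArg Prod.fst h
        exact hp hi
      · simp [← hq5] at h
      · simp at h

/-- A path in `C` from an entrance to an exit does not use boundary arcs other than those between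
the two on the boundary. -/
lemma IsOutsideComponent.mem_of_mem_path (hC : G.IsOutsideComponent s t C)
    (hN : G.IsNormalNetwork s t) {e x : V} (he : G.IsEntrance s C e) (hx : G.IsExit t C x)
    {L P : List A} (hL : G.IsWalk e L x) (hLn : L.Nodup) (hLB : ∀ a ∈ L, a ∈ G.boundary C)
    (hP : G.IsPath e P x) {a : A} (ha : a ∈ P) (haB : a ∈ G.boundary C) : a ∈ L := by
  classical
  have := Fintype.ofFinite A
  by_contra haL
  -- The circulation `P + L`. Its potential on the left of `P` turns out to be the outer one all
  -- along, so there is no jump at `a`, although `a` lies on `P` and not on `L`.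
  obtain ⟨g, hg⟩ : ∃ g : A → ZMod 2, ∀ a, g a = chain P a + chain L a := ⟨_, fun _ => rfl⟩
  obtain ⟨φ, hφ, hh⟩ := hN.plane.exists_potential g fun v => by
    have h1 := hP.1.divergence_chain v
    have h2 := hL.divergence_chain v
    have h3 := CharTwo.add_self_eq_zero
      (((if e = v then 1 else 0) + if x = v then 1 else 0 : ZMod 2))
    nth_rewrite 1 [← h1] at h3
    rw [← h2, ← Finset.sum_add_distrib] at h3
    refine Eq.trans (Finset.sum_congr rfl fun a _ => ?_) h3
    rw [hg]
    split_ifs <;> ring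
  have hB := fun a => hC.scc.mem_boundary_iff hN (a := a)
  have hPC := fun a => hC.scc.mem_arcsOf (a := a) he.1 hx.1 hP.1
  have hout : ∀ b ∈ G.boundary C, φ (b, false) = φ (a, false) := by
    intro b hb
    refine hN.plane.potential_eq_of_outside hφ hh (S := G.arcsOf C) (fun b hb => ?_)
      ((hB b).1 hb).2 ((hB a).1 haB).2 (hC.connected hN hb.1.2 haB.1.2)
    rw [hg, chain_of_notMem fun h => hb (hPC b h), chain_of_notMem fun h => hb (hLB b h).1,
      add_zero]
  have key := hP.1.arcs_closed (fun p => φ (p, true) = φ (a, false)) ?_ ?_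
  · have h1 := hh (a, true)
    rw [flip_mk, hg, key a ha, Bool.not_true, CharTwo.add_self_eq_zero, chain_of_mem hP.nodup ha,
      chain_of_notMem haL] at h1
    exact absurd h1 (by decide)
  · intro p hp
    have hpe := hP.1.src_of_mem_head? hp
    have hpP : p ∈ P := List.mem_of_mem_head? hp
    obtain ⟨-, -, b, hb, -, -, hu⟩ := hC.boundary_of_isEntrance hN he
    have hpb : p = b := hu p (hPC p hpP) hpe
    -- Only one arc of `C` leaves the entrance `e`, so `P` and `L` begin with the same arc; there
    -- the flow cancels and the left side has the outer potential.
    have hpL : p ∈ L := by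
      cases L with
      | nil =>
        obtain rfl : e = x := hL
        exact absurd hx (hC.not_isExit hN he)
      | cons c L =>
        have := hu c (hLB c (by simp)).1 hL.1
        simp [hpb, this]
    have h1 := hh (p, true)
    rw [flip_mk, hg, Bool.not_true, chain_of_mem hP.nodup hpP, chain_of_mem hLn hpL,
      CharTwo.add_self_eq_zero, CharTwo.add_eq_zero] at h1
    rw [h1]
    exact hout p (hLB p hpL)
  · intro p hp q hq hpq hpc
    rw [← hpc, eq_comm]
    have hpC := hPC p hp
    have h3 := hC.degree_three hN hpC.2
    obtain ⟨-, -, h2, h2', h5⟩ := hN.plane.rot_of_degree_three (d := (p, false)) h3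
    refine hN.plane.potential_left hφ hh hpq h3 fun hd => ?_
    have hvd : G.vert (G.rot.symm (p, false)) = G.tgt p := hN.plane.vert_rot_symm (p, false)
    have hqr : (q, true) = G.rot (p, false) := by
      rcases h5 (q, true) hpq with h | h | h
      · simp at h
      · exact h
      · exact absurd h.symm hd
    have hdr : G.rot (G.rot.symm (p, false)) = (p, false) := by simp
    generalize G.rot.symm (p, false) = d at *
    have hdP : d.1 ∉ P := by
      intro hdP
      obtain ⟨r, _ | _⟩ := d
      · exact h2 (congrArg (·, false) (hP.tgt_injective hdP hp hvd))
      · exact hd (congrArg (·, true) (hP.src_injective hdP hq (hvd.trans hpq.symm)))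
    rw [hg, chain_of_notMem hdP, zero_add]
    refine chain_of_notMem fun hdL => ?_
    have hdB := hLB _ hdL
    -- If the left dart were on the boundary, all three arcs here would be in `C`. The boundary
    -- would then turn by a single `rot` from its in-arc to its out-arc, which the cyclic order of
    -- `d`, `p` and `q` excludes.
    have hall : ∀ d', G.vert d' = G.tgt p → d'.1 ∈ G.arcsOf C := by
      intro d' hd'
      rcases h5 d' hd' with rfl | rfl | rfl
      · exact hpC
      · rw [← hqr]; exact hPC q hq
      · exact hdB.1
    obtain ⟨r, _ | _⟩ := d
    · obtain ⟨b, hb, hbv, h | ⟨h, -⟩⟩ := hC.exists_succ hN hdB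
      · simp [hdr] at h
      · exact h (hall _ ((hN.plane.vert_rot _).trans hvd))
    · obtain ⟨b, hb, hbv⟩ := hC.exists_pred hN hdB
      have hbp : b = p := by
        rcases h5 (b, false) (hbv.trans hvd) with h | h | h
        · exact congrArg Prod.fst h
        · simp [← hqr] at h
        · simp at h
      subst hbp
      rcases hC.rot_of_boundary hN hb hdB hbv.symm with h | ⟨h, -⟩
      · exact h2' h.symm
      · exact h (hall _ (hN.plane.vert_rot _))

lemma IsPlane.potential_eq_of_vert_eq (hG : G.IsPlane) {φ : A × Bool → ZMod 2} {h : A → ZMod 2}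
    (hφ : ∀ d, φ (G.faceNext d) = φ d) (hh : ∀ d, φ d + φ (flip d) = h d.1) {v : V}
    (h0 : ∀ d, G.vert d = v → h d.1 = 0) {d d' : A × Bool} (hd : G.vert d = v)
    (hd' : G.vert d' = v) : φ d = φ d' := by
  obtain ⟨n, rfl⟩ := ((hG.rot_sameCycle d d').2 (hd.trans hd'.symm)).exists_nat_pow_eq
  induction n with
  | zero => rfl
  | succ n ih =>
    rw [pow_succ', Equiv.Perm.mul_apply] at hd' ⊢
    have h1 := h0 _ hd'
    rw [hG.vert_rot] at hd'
    rw [ih hd']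
    rw [← hh, CharTwo.add_eq_zero] at h1
    rw [h1, ← hφ (flip _), faceNext_flip, Equiv.symm_apply_apply]

/-- A walk whose later vertices avoid the flow stays within one region. Only heads are required to
avoid it, because paths from exits start on the boundary, where there may be flow. -/
lemma IsPlane.potential_eq_of_walk (hG : G.IsPlane) {φ : A × Bool → ZMod 2} {h : A → ZMod 2}
    (hφ : ∀ d, φ (G.faceNext d) = φ d) (hh : ∀ d, φ d + φ (flip d) = h d.1) {u v : V}
    {l : List A} (hl : G.IsWalk u l v)
    (h0 : ∀ a ∈ l, ∀ d, G.vert d = G.tgt a → h d.1 = 0) {d : A × Bool} (hd : G.vert d = v)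
    {a : A} (ha : a ∈ l) (b : Bool) : φ (a, b) = φ d := by
  induction l generalizing u a b with
  | nil => simp at ha
  | cons c l ih =>
    have h0' : ∀ a ∈ l, ∀ d, G.vert d = G.tgt a → h d.1 = 0 := fun a ha => h0 a (by simp [ha])
    rcases List.mem_cons.1 ha with rfl | ha
    · have h1 : φ (a, false) = φ d := by
        cases l with
        | nil => exact hG.potential_eq_of_vert_eq hφ hh (h0 a ha) rfl (hd.trans (Eq.symm hl.2))
        | cons c l =>
          rw [← ih hl.2 h0' (a := c) (by simp) true]
          exact hG.potential_eq_of_vert_eq hφ hh (h0 a (by simp)) rfl hl.2.1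
      cases b
      · exact h1
      · rw [← h1, ← CharTwo.add_eq_zero]
        exact (hh (a, true)).trans (h0 a (by simp) (a, false) rfl)
    · exact ih hl.2 h0' ha b

/-- On the boundary, two entrances do not separate two exits. -/
lemma IsOutsideComponent.not_separated (hC : G.IsOutsideComponent s t C)
    (hN : G.IsNormalNetwork s t) {Q : List A} (hQ : G.IsBoundaryCycle C Q) {e e' : V}
    (he : G.IsEntrance s C e) (he' : G.IsEntrance s C e') {L : List A} (hL : G.IsWalk e L e')
    (hLn : L.Nodup) (hLB : ∀ a ∈ L, a ∈ G.boundary C) {a a' : A} (ha : a ∈ L)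
    (hx : G.IsExit t C (G.tgt a)) (ha' : a' ∈ G.boundary C) (haL : a' ∉ L)
    (hx' : G.IsExit t C (G.tgt a')) : False := by
  classical
  have := Fintype.ofFinite A
  obtain ⟨S, hS, hSC⟩ := he.exists_path
  obtain ⟨S', hS', hSC'⟩ := he'.exists_path
  -- Closed modulo 2: from `s` to `e`, along the boundary to `e'`, and back to `s`. The paths `S`
  -- and `S'` may overlap.
  obtain ⟨g, hg⟩ : ∃ g : A → ZMod 2, ∀ a, g a = chain S a + chain S' a + chain L a :=
    ⟨_, fun _ => rfl⟩
  obtain ⟨φ, hφ, hh⟩ := hN.plane.exists_potential g fun v => by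
    have h1 := hS.1.divergence_chain v
    have h2 := hS'.1.divergence_chain v
    have h3 := hL.divergence_chain v
    have h4 : ((if s = v then 1 else 0) + if e = v then 1 else 0) +
        ((if s = v then 1 else 0) + if e' = v then 1 else 0) +
        ((if e = v then 1 else 0) + if e' = v then 1 else 0) = (0 : ZMod 2) := by
      split_ifs <;> decide
    rw [← h1, ← h2, ← h3, ← Finset.sum_add_distrib, ← Finset.sum_add_distrib] at h4
    refine Eq.trans (Finset.sum_congr rfl fun a _ => ?_) h4
    rw [hg]
    split_ifs <;> ring
  have hoff : ∀ b, b ∉ S → b ∉ S' → b ∉ L → g b = 0 := by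
    intro b h1 h2 h3
    simp [hg, chain_of_notMem h1, chain_of_notMem h2, chain_of_notMem h3]
  have hinS : ∀ b ∈ G.arcsOf C, b ∉ S := fun b hb h => hSC b h hb.1
  have hinS' : ∀ b ∈ G.arcsOf C, b ∉ S' := fun b hb h => hSC' b h hb.1
  have hdt : ∃ d, G.vert d = t := by
    obtain ⟨T, hT, hTC⟩ := hx.exists_path
    obtain ⟨T, b, rfl⟩ := (List.eq_nil_or_concat T).resolve_left (by
      rintro rfl
      exact hC.sink_notMem ((show G.tgt a = t from hT.1) ▸ hx.1))
    rw [List.concat_eq_append] at hT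
    obtain ⟨w, -, h⟩ := isWalk_append.1 hT.1
    exact ⟨(b, false), h.2⟩
  obtain ⟨d, hd⟩ := hdt
  -- The right side of the boundary arc into an exit borders on the path from the exit to `t`. This
  -- path avoids the flow, so all exits see the potential at `t`.
  have hright : ∀ b ∈ G.boundary C, G.IsExit t C (G.tgt b) → φ (b, false) = φ d := by
    intro b hb hx
    obtain ⟨T, hT, hTC⟩ := hx.exists_path
    obtain ⟨r, hr, hrC, hrv, hro⟩ := hC.exit_arc hN hx.1 hT.1 hTC
    obtain ⟨c, hc, -, -, hrc, -⟩ := hC.rot_of_outside hN hro hrC (by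
      rw [vert_true, hrv]; exact hx.1)
    have hcv := hN.plane.vert_rot_symm (r, true)
    rw [hrc, vert_true, vert_false, hrv] at hcv
    obtain rfl := hC.boundary_tgt_injective hN hc hb hcv
    rw [← hrc, ← faceNext_flip, hφ]
    refine hN.plane.potential_eq_of_walk hφ hh hT.1 ?_ hd hr _
    intro a ha d hda
    have hda' : G.src d.1 = G.tgt a ∨ G.tgt d.1 = G.tgt a := by
      obtain ⟨p, _ | _⟩ := d
      · exact .inr hda
      · exact .inl hda
    have hwT : G.tgt a ∈ G.support (G.tgt c) T := tgt_mem_support ha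
    have hno : ∀ e S, G.IsEntrance s C e → G.IsPath s S e → (∀ a ∈ S, G.src a ∉ C) → d.1 ∉ S := by
      intro e S he hS hSC hdS
      refine hC.disjoint_walks hN he hx hS.1 hSC hT.1 hTC ?_ hwT
      rcases hda' with h | h
      · rw [← h]; exact hS.1.src_mem_support hdS
      · rw [← h]; exact tgt_mem_support hdS
    refine hoff _ (hno e S he hS hSC) (hno e' S' he' hS' hSC') fun hdL => ?_
    rcases hda' with h | h
    · exact hTC a ha (h ▸ (hLB _ hdL).1.1)
    · exact hTC a ha (h ▸ (hLB _ hdL).1.2)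
  -- No flow branches off to the left of the boundary: `S` and `S'` arrive from outside, and the
  -- arcs of `L` are boundary arcs, of which only `p` enters and only `q` leaves this vertex.
  have hleft : ∀ p ∈ G.boundary C, ∀ q ∈ G.boundary C, G.src q = G.tgt p →
      φ (p, true) = φ (q, true) := by
    intro p hp q hq hpq
    have h3 := hC.degree_three hN hp.1.2
    obtain ⟨h1, -, h2, h2', h5⟩ := hN.plane.rot_of_degree_three (d := (p, false)) h3
    refine hN.plane.potential_left hφ hh hpq h3 fun hd => ?_
    have hvd : G.vert (G.rot.symm (p, false)) = G.tgt p := hN.plane.vert_rot_symm (p, false)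
    have hdr : G.rot (G.rot.symm (p, false)) = (p, false) := by simp
    generalize G.rot.symm (p, false) = d at *
    have hdv : G.vert d ∈ C := hvd ▸ hp.1.2
    by_cases hdC : d.1 ∈ G.arcsOf C
    · refine hoff _ (hinS _ hdC) (hinS' _ hdC) fun hdL => ?_
      obtain ⟨r, _ | _⟩ := d
      · exact h2 (congrArg (·, false) (hC.boundary_tgt_injective hN (hLB _ hdL) hp hvd))
      · exact hd (congrArg (·, true)
          (hC.boundary_src_injective hN (hLB _ hdL) hq (hvd.trans hpq.symm)))
    · have hno : ∀ e S, G.IsPath s S e → (∀ a ∈ S, G.src a ∉ C) → d.1 ∉ S := by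
        intro e S hS hSC hdS
        obtain ⟨-, -, b, -, -, h⟩ := hC.rot_of_outside hN
          (hC.outside_of_walk_from_source hN hS.1 hSC hdS d.2) hdC hdv
        have := hdr.symm.trans h
        simp at this
      exact hoff _ (hno e S hS hSC) (hno e' S' hS' hSC') fun hdL => hdC (hLB _ hdL).1
  obtain ⟨⟨hQne, ⟨u, hu⟩, -⟩, hQB⟩ := hQ
  obtain ⟨c, Q, rfl⟩ := List.exists_cons_of_ne_nil hQne
  have key := hu.arcs_closed (fun p => φ (p, true) = φ (c, true)) (fun p hp => by
    obtain rfl : c = p := by simpa using hp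
    rfl) fun p hp q hq hpq h => (hleft p ((hQB p).1 hp) q ((hQB q).1 hq) hpq).symm.trans h
  -- The potentials on both sides of `a` agree with those of `a'`, but the jump is 1 at `a`, which
  -- is on `L`, and 0 at `a'`, which is not.
  have haB := hLB a ha
  have e1 := hh (a, true)
  have e2 := hh (a', true)
  rw [flip_mk, Bool.not_true, hright a haB hx, key a ((hQB a).2 haB)] at e1
  rw [flip_mk, Bool.not_true, hright a' ha' hx', key a' ((hQB a').2 ha'), e1,
    hoff a' (hinS _ ha'.1) (hinS' _ ha'.1) haL, hg, chain_of_notMem (hinS _ haB.1),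
    chain_of_notMem (hinS' _ haB.1), chain_of_mem hLn ha] at e2
  exact absurd e2 (by decide)

end Planarity

end EmbeddedDigraph

/-! ### The boundary cycle and its division into two paths. -/

namespace EmbeddedDigraph

variable {V A : Type*} {G : EmbeddedDigraph V A} {s t : V} {C : Set V}

/-! ### The boundary cycle and how it splits -/

section Splitting

variable {Q : List A}

lemma IsBoundaryCycle.nodup (hQ : G.IsBoundaryCycle C Q) : Q.Nodup := hQ.1.2.2.of_map

lemma IsBoundaryCycle.exists_rotation (hQ : G.IsBoundaryCycle C Q) {a : A}
    (ha : a ∈ G.boundary C) : ∃ L, Q ~r a :: L ∧ G.IsWalk (G.src a) (a :: L) (G.src a) := by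
  obtain ⟨u, hu⟩ := hQ.1.2.1
  obtain ⟨l₁, l₂, rfl, h₁, h₂⟩ := hu.exists_split_arc ((hQ.2 a).2 ha)
  refine ⟨l₂ ++ l₁, ?_, rfl, h₂.append h₁⟩
  have := List.isRotated_append (l := l₁) (l' := a :: l₂)
  simpa using this

lemma IsWalk.exists_tgt_eq_end {u v : V} {l : List A} (h : G.IsWalk u l v) (hne : u ≠ v) :
    ∃ a ∈ l, G.tgt a = v := by
  rcases mem_support.1 h.end_mem_support with h1 | h1
  · exact absurd h1.symm hne
  · exact h1

/-- The part of an `s,t`-path that lies in `C`. -/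
lemma IsPath.exists_subpath {l : List A}
    (hl : G.IsPath s l t) {a : A} (ha : a ∈ l) (haC : a ∈ G.arcsOf C) :
    ∃ e x P, G.IsEntrance s C e ∧ G.IsExit t C x ∧ G.IsPath e P x ∧ a ∈ P := by
  obtain ⟨l₁, l₂, e, rfl, h₁, h₂, he, hl₁⟩ :=
    hl.1.exists_split_first (· ∈ C) ⟨_, hl.1.src_mem_support ha, haC.1⟩
  obtain ⟨P, l₃, x, rfl, h₃, h₄, hx, hl₃⟩ :=
    h₂.exists_split_last (· ∈ C) ⟨e, start_mem_support, he⟩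
  refine ⟨e, x, P, isEntrance_of_walk he h₁ hl₁, isExit_of_walk hx h₄ hl₃,
    (hl.right_of_append h₁).left_of_append h₃, ?_⟩
  simp only [List.mem_append] at ha
  rcases ha with ha | ha | ha
  · exact absurd haC.1 (hl₁ a ha)
  · exact ha
  · exact absurd haC.2 (hl₃ a ha)

lemma allUseless_of_not_exists
    (h : ¬ ((∃ e, G.IsEntrance s C e) ∧ ∃ x, G.IsExit t C x)) : G.AllUseless s t C := by
  rintro a haC ⟨l, hl, ha⟩
  obtain ⟨e, x, P, he, hx, -⟩ := hl.exists_subpath ha haC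
  exact h ⟨⟨e, he⟩, x, hx⟩

variable [Finite A]

/-- The orbit of one boundary arc under the successor map is a cycle, and
`IsOutsideComponent.mem_of_mem_boundary` shows that it is the whole boundary. -/
lemma IsOutsideComponent.exists_isBoundaryCycle (hC : G.IsOutsideComponent s t C)
    (hN : G.IsNormalNetwork s t) : ∃ Q, G.IsBoundaryCycle C Q := by
  obtain ⟨f, hf, hsrc⟩ := hC.exists_bijective_succ hN
  obtain ⟨a, ha⟩ := hC.nontrivial
  obtain ⟨⟨b, i⟩, hb, hd⟩ := hN.plane.exists_outside (d := (a, true)) ha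
  let b0 : G.boundary C := ⟨b, hb, i, hd⟩
  have hper : b0 ∈ Function.periodicPts f := hf.1.mem_periodicPts b0
  set n := Function.minimalPeriod f b0 with hn
  have hn0 : 0 < n := Function.minimalPeriod_pos_of_mem_periodicPts hper
  have hfn : f^[n] b0 = b0 := Function.isPeriodicPt_minimalPeriod f b0
  have hinj : Set.InjOn (fun i => f^[i] b0) (Set.Iio n) :=
    Function.iterate_injOn_Iio_minimalPeriod
  let Q : List A := (List.range n).map fun i => (f^[i] b0 : A)
  have hwalk : ∀ k, G.IsWalk (G.src b) ((List.range k).map fun i => (f^[i] b0 : A))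
      (G.src (f^[k] b0 : A)) := by
    intro k
    induction k with
    | zero => rfl
    | succ k ih =>
      rw [List.range_succ, List.map_append]
      refine ih.append ⟨rfl, ?_⟩
      rw [Function.iterate_succ_apply']
      exact (hsrc _).symm
  have hQw : G.IsWalk (G.src b) Q (G.src b) := by
    have := hwalk n
    rwa [hfn] at this
  have hQB : ∀ a ∈ Q, a ∈ G.boundary C := by
    intro a ha
    obtain ⟨i, -, rfl⟩ := List.mem_map.1 ha
    exact Subtype.coe_prop _
  have hQn : Q.Nodup := by
    refine List.Nodup.map_on (fun i hi j hj hij => ?_) List.nodup_range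
    exact hinj (List.mem_range.1 hi) (List.mem_range.1 hj) (Subtype.ext hij)
  have hQne : Q ≠ [] := by simp [Q, hn0.ne']
  refine ⟨Q, ⟨hQne, ⟨_, hQw⟩, ?_⟩, fun a => ⟨hQB a, fun ha => ?_⟩⟩
  · exact List.Nodup.map_on (fun a ha b hb hab =>
      hC.boundary_tgt_injective hN (hQB a ha) (hQB b hb) hab) hQn
  · exact hC.mem_of_mem_boundary hN hQw hQn hQne hQB ha

lemma IsOutsideComponent.walk_eq (hC : G.IsOutsideComponent s t C)
    (hN : G.IsNormalNetwork s t) {u v v' : V} {l l' : List A} (hl : G.IsWalk u l v)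
    (hl' : G.IsWalk u l' v') (h : ∀ a ∈ l, a ∈ G.boundary C) (h' : ∀ a ∈ l', a ∈ G.boundary C)
    (hlen : l.length = l'.length) : l = l' := by
  induction l generalizing u l' with
  | nil => simpa [eq_comm] using hlen
  | cons a l ih =>
    cases l' with
    | nil => simp at hlen
    | cons a' l' =>
      obtain rfl := hC.boundary_src_injective hN (h a (by simp)) (h' a' (by simp))
        (hl.1.trans hl'.1.symm)
      rw [ih hl.2 hl'.2 (fun b hb => h b (by simp [hb])) (fun b hb => h' b (by simp [hb]))
        (by simpa using hlen)]

/-- The tail determines a boundary arc, so two boundary cycles agree once they start with the same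
arc. This makes the output of the algorithm valid for every choice of `Q`. -/
lemma IsOutsideComponent.isRotated (hC : G.IsOutsideComponent s t C)
    (hN : G.IsNormalNetwork s t) {Q' : List A} (hQ : G.IsBoundaryCycle C Q)
    (hQ' : G.IsBoundaryCycle C Q') : Q ~r Q' := by
  obtain ⟨a, ha⟩ := List.exists_mem_of_ne_nil Q hQ.1.1
  rw [hQ.2] at ha
  obtain ⟨L, hL, hLw⟩ := hQ.exists_rotation ha
  obtain ⟨L', hL', hLw'⟩ := hQ'.exists_rotation ha
  have hp : Q.Perm Q' := (List.perm_ext_iff_of_nodup hQ.nodup hQ'.nodup).2 fun a => by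
    rw [hQ.2, hQ'.2]
  have := hC.walk_eq hN hLw hLw' (fun b hb => (hQ.2 b).1 (hL.perm.mem_iff.2 hb))
    (fun b hb => (hQ'.2 b).1 (hL'.perm.mem_iff.2 hb)) (by
      rw [← hL.perm.length_eq, ← hL'.perm.length_eq, hp.length_eq])
  exact hL.trans (this ▸ hL'.symm)

/-- A segment of the boundary cycle from an exit to an entrance without entrances and exits in its
interior can be taken for `Q₂`. -/
lemma IsOutsideComponent.splits (hC : G.IsOutsideComponent s t C)
    (hN : G.IsNormalNetwork s t) (hQ : G.IsBoundaryCycle C Q) {Q₁ Q₂ : List A}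
    (hrot : Q ~r Q₁ ++ Q₂) {e x : V} (he : G.IsEntrance s C e) (hx : G.IsExit t C x)
    (h₁ : G.IsWalk e Q₁ x) (h₂ : G.IsWalk x Q₂ e)
    (hnx : ∀ a ∈ Q₂, ¬ G.IsExit t C (G.tgt a))
    (hne : ∀ a ∈ Q₂, G.IsEntrance s C (G.tgt a) → G.tgt a = e) : G.Splits s t C Q Q₁ Q₂ := by
  have hEX : ∀ {e x}, G.IsEntrance s C e → G.IsExit t C x → e ≠ x := by
    rintro e _ he hx rfl
    exact hC.not_isExit hN he hx
  have hex := hEX he hx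
  have hmem : ∀ a, a ∈ G.boundary C ↔ a ∈ Q₁ ∨ a ∈ Q₂ := fun a => by
    rw [← hQ.2, hrot.perm.mem_iff, List.mem_append]
  have hnd : ((Q₁ ++ Q₂).map G.tgt).Nodup := (hrot.perm.map G.tgt).nodup_iff.1 hQ.1.2.2
  have hnd' : (Q₁ ++ Q₂).Nodup := hnd.of_map
  rw [List.map_append, List.nodup_append] at hnd
  have hB₁ : ∀ a ∈ Q₁, a ∈ G.boundary C := fun a ha => (hmem a).2 (.inl ha)
  have hp₁ : G.IsPath e Q₁ x := by
    refine ⟨h₁, List.nodup_cons.2 ⟨fun h => ?_, hnd.1⟩⟩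
    obtain ⟨a, ha, hae⟩ := h₂.exists_tgt_eq_end hex.symm
    exact hnd.2.2 e h e (List.mem_map.2 ⟨a, ha, hae⟩) rfl
  have hp₂ : G.IsPath x Q₂ e := by
    refine ⟨h₂, List.nodup_cons.2 ⟨fun h => ?_, hnd.2.1⟩⟩
    obtain ⟨a, ha, hax⟩ := h₁.exists_tgt_eq_end hex
    exact hnd.2.2 x (List.mem_map.2 ⟨a, ha, hax⟩) x h rfl
  have hC₁ : ∀ w ∈ G.support e Q₁, w ∈ C := hC.scc.support_subset he.1 hx.1 h₁
  -- Besides the order, this provides the boundary segment `L` from `e'` to `x'` inside `Q₁`. If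
  -- `x'` came before `e'`, the entrances `e` and `e'` would separate the exits `x'` and `x`.
  have horder : ∀ e' x', G.IsEntrance s C e' → G.IsExit t C x' →
      ∃ M₁ L M₂, Q₁ = M₁ ++ (L ++ M₂) ∧ G.IsWalk e M₁ e' ∧ G.IsWalk e' L x' := by
    intro e' x' he' hx'
    have hx'Q : x' ∈ G.support e Q₁ := by
      obtain ⟨b, hb, rfl, -⟩ := hC.boundary_of_isExit hN hx'
      obtain ⟨a, ha, hab⟩ := hC.exists_pred hN hb
      rcases (hmem a).1 ha with h | h
      · exact mem_support.2 (.inr ⟨a, h, hab⟩)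
      · exact absurd (hab ▸ hx') (hnx a h)
    have he'Q : e' ∈ G.support e Q₁ := by
      obtain ⟨a, ha, -, -, hae, -⟩ := hC.boundary_of_isEntrance hN he'
      rcases (hmem a).1 ha with h | h
      · exact mem_support.2 (.inr ⟨a, h, hae⟩)
      · rw [← hae, hne a h (hae ▸ he')]
        exact start_mem_support
    obtain ⟨N₁, N₂, rfl, hN₁, hN₂⟩ := h₁.exists_split_of_mem hx'Q
    by_cases he'N : e' ∈ G.support e N₁
    · obtain ⟨M, L, rfl, hM, hL⟩ := hN₁.exists_split_of_mem he'N
      exact ⟨M, L, N₂, by simp, hM, hL⟩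
    · exfalso
      rw [support_append, List.mem_append] at he'Q
      obtain ⟨c, hc, hce⟩ := List.mem_map.1 (he'Q.resolve_left he'N)
      obtain ⟨M, M', rfl, hM, hM'⟩ := hN₂.exists_split_of_mem
        (mem_support.2 (.inr ⟨c, hc, hce⟩))
      obtain ⟨a, ha, hax⟩ := hN₁.exists_tgt_eq_end (hEX he hx')
      obtain ⟨a', ha', hax'⟩ := hM'.exists_tgt_eq_end (hEX he' hx)
      have hndL : ((N₁ ++ M) ++ M').Nodup := by
        rw [List.append_assoc]
        exact hnd'.of_append_left
      refine hC.not_separated hN hQ he he' (hN₁.append hM) hndL.of_append_left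
        (fun b hb => hB₁ b ?_) (List.mem_append_left _ ha) (hax ▸ hx') (hB₁ a' ?_) ?_ (hax' ▸ hx)
      · rw [← List.append_assoc]
        exact List.mem_append_left _ hb
      · simp [ha']
      · exact fun h => (List.nodup_append.1 hndL).2.2 a' h a' ha' rfl
  refine ⟨hrot, ?_, ?_, e, x, he, hx, hp₁, hp₂, ?_, ?_, ?_⟩
  · rintro rfl
    exact hex h₁
  · rintro rfl
    exact hex (Eq.symm h₂)
  · obtain ⟨S, hS, hSC⟩ := he.exists_path
    obtain ⟨T, hT, hTC⟩ := hx.exists_path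
    refine ⟨S ++ (Q₁ ++ T), hS.append (hp₁.append hT fun w hw hwT => ?_) fun w hwS hw => ?_,
      ⟨S, T, by simp⟩⟩
    · rcases mem_support.1 hwT with h | ⟨a, ha, rfl⟩
      · exact h
      · exact absurd (hC₁ _ hw) (hTC a ha)
    · rw [support_append, List.mem_append] at hw
      rcases hw with hw | hw
      · rcases hS.1.mem_support_iff.1 hwS with h | ⟨a, ha, rfl⟩
        · exact h
        · exact absurd (hC₁ _ hw) (hSC a ha)
      · exact (hC.disjoint_walks hN he hx hS.1 hSC hT.1 hTC hwS (List.mem_cons_of_mem _ hw)).elim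
  -- The part of a useful path inside `C` uses boundary arcs only from a segment of `Q₁`, and `Q₁`
  -- and `Q₂` share no arc.
  · rintro a ha ⟨l, hl, hal⟩
    have haB : a ∈ G.boundary C := (hmem a).2 (.inr ha)
    obtain ⟨e', x', P, he', hx', hP, haP⟩ := hl.exists_subpath hal haB.1
    obtain ⟨M₁, L, M₂, rfl, -, hL⟩ := horder e' x' he' hx'
    have haL := hC.mem_of_mem_path hN he' hx' hL
      hnd'.of_append_left.of_append_right.of_append_left (fun b hb => hB₁ b (by simp [hb]))
      hP haP haB
    exact (List.nodup_append.1 hnd').2.2 a (by simp [haL]) a ha rfl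
  · intro e' x' he' hx'
    obtain ⟨M₁, L, M₂, rfl, hM₁, hL⟩ := horder e' x' he' hx'
    obtain ⟨a, ha, hax⟩ := hL.exists_tgt_eq_end (hEX he' hx')
    rw [support_append]
    refine List.Sublist.append (l₁ := [e']) (r₁ := [x'])
      (List.singleton_sublist.2 hM₁.end_mem_support) (List.singleton_sublist.2 ?_)
    exact List.mem_map.2 ⟨a, by simp [ha], hax⟩

/-- From an exit, follow the boundary to the first entrance and cut at the last exit met on the way.
The piece `Y` after the cut serves as `Q₂`. -/
lemma IsOutsideComponent.allUseless_or_splits (hC : G.IsOutsideComponent s t C)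
    (hN : G.IsNormalNetwork s t) (hQ : G.IsBoundaryCycle C Q) :
    G.AllUseless s t C ∨ ∃ Q₁ Q₂, G.Splits s t C Q Q₁ Q₂ := by
  by_cases h : (∃ e, G.IsEntrance s C e) ∧ ∃ x, G.IsExit t C x
  swap
  · exact .inl (allUseless_of_not_exists h)
  right
  obtain ⟨⟨e₀, he₀⟩, x₀, hx₀⟩ := h
  obtain ⟨b, hb, rfl, -⟩ := hC.boundary_of_isExit hN hx₀
  obtain ⟨L, hrot, hL⟩ := hQ.exists_rotation hb
  have he₀L : e₀ ∈ G.support (G.src b) (b :: L) := by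
    obtain ⟨a, ha, -, -, hae, -⟩ := hC.boundary_of_isEntrance hN he₀
    exact mem_support.2 (.inr ⟨a, hrot.perm.mem_iff.1 ((hQ.2 a).2 ha), hae⟩)
  generalize b :: L = L at *
  obtain ⟨W, Z, e, rfl, hW, hZ, he, hWe⟩ := hL.exists_split_first (G.IsEntrance s C)
    ⟨e₀, he₀L, he₀⟩
  obtain ⟨X, Y, x, rfl, hX, hY, hx, hYx⟩ := hW.exists_split_last (G.IsExit t C)
    ⟨_, start_mem_support, hx₀⟩
  refine ⟨Z ++ X, Y, hC.splits hN hQ ?_ he hx (hZ.append hX) hY hYx fun a ha hae => ?_⟩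
  · rw [List.append_assoc]
    exact hrot.trans (List.isRotated_append (l := X ++ Y) (l' := Z))
  · rcases hY.mem_support_iff.1 (tgt_mem_support ha) with h | ⟨c, hc, hca⟩
    · exact h
    · exact absurd (hca ▸ hae) (hWe c (by simp [hc]))

end Splitting

end EmbeddedDigraph

/-! ### Program rules and search on darts. -/

namespace RAM

/-! ### Rules for running programs -/

/-- With word bound `W`, the program `p` started in `σ` halts within `B` steps in a state that
satisfies `post`. -/
def Runs (W : ℕ) (p : Program) (σ : State) (B : ℕ) (post : State → Prop) : Prop :=
  ∃ T σ', Exec W p σ T σ' ∧ T ≤ B ∧ post σ'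

section Rules

variable {W B B₁ B₂ : ℕ} {σ : State} {p q : Program} {e e₁ e₂ : Expr} {post mid : State → Prop}

lemma Runs.mono {post' : State → Prop} (h : Runs W p σ B₁ post) (hB : B₁ ≤ B)
    (hp : ∀ τ, post τ → post' τ) : Runs W p σ B post' := by
  obtain ⟨T, τ, h1, h2, h3⟩ := h
  exact ⟨T, τ, h1, h2.trans hB, hp τ h3⟩

lemma Runs.skip (h : post σ) (hB : 1 ≤ B) : Runs W .skip σ B post :=
  ⟨1, σ, .skip σ, hB, h⟩

lemma Runs.set {i : ℕ} (hf : e.Fits W σ) (hB : e.cost + 1 ≤ B)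
    (h : post (σ.setReg i (e.eval σ))) : Runs W (.set i e) σ B post :=
  ⟨_, _, .set σ i e hf, hB, h⟩

lemma Runs.store {k : ℕ} (h₁ : e₁.Fits W σ) (h₂ : e₂.Fits W σ)
    (hB : e₁.cost + e₂.cost + 1 ≤ B) (h : post (σ.setMem k (e₁.eval σ) (e₂.eval σ))) :
    Runs W (.store k e₁ e₂) σ B post :=
  ⟨_, _, .store σ k e₁ e₂ h₁ h₂, hB, h⟩

lemma Runs.seq (h₁ : Runs W p σ B₁ mid) (h₂ : ∀ τ, mid τ → Runs W q τ B₂ post)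
    (hB : B₁ + B₂ + 1 ≤ B) : Runs W (.seq p q) σ B post := by
  obtain ⟨T₁, τ, h1, h2, h3⟩ := h₁
  obtain ⟨T₂, τ', h1', h2', h3'⟩ := h₂ τ h3
  exact ⟨_, τ', .seq h1 h1', by omega, h3'⟩

lemma Runs.set_seq {i : ℕ} (hf : e.Fits W σ) (h : Runs W q (σ.setReg i (e.eval σ)) B₂ post)
    (hB : e.cost + B₂ + 2 ≤ B) : Runs W (.seq (.set i e) q) σ B post :=
  Runs.seq (mid := fun τ => τ = σ.setReg i (e.eval σ)) (.set hf le_rfl rfl)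
    (by rintro _ rfl; exact h) (by omega)

lemma Runs.store_seq {k : ℕ} (h₁ : e₁.Fits W σ) (h₂ : e₂.Fits W σ)
    (h : Runs W q (σ.setMem k (e₁.eval σ) (e₂.eval σ)) B₂ post)
    (hB : e₁.cost + e₂.cost + B₂ + 2 ≤ B) : Runs W (.seq (.store k e₁ e₂) q) σ B post :=
  Runs.seq (mid := fun τ => τ = σ.setMem k (e₁.eval σ) (e₂.eval σ)) (.store h₁ h₂ le_rfl rfl)
    (by rintro _ rfl; exact h) (by omega)

lemma Runs.ite (hf : e.Fits W σ) (h₁ : e.eval σ ≠ 0 → Runs W p σ B₁ post)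
    (h₂ : e.eval σ = 0 → Runs W q σ B₁ post) (hB : e.cost + B₁ + 1 ≤ B) :
    Runs W (.ite e p q) σ B post := by
  by_cases he : e.eval σ = 0
  · obtain ⟨T, τ, h1, h2, h3⟩ := h₂ he
    exact ⟨_, τ, .ite_false hf he h1, by omega, h3⟩
  · obtain ⟨T, τ, h1, h2, h3⟩ := h₁ he
    exact ⟨_, τ, .ite_true hf he h1, by omega, h3⟩

/-- A loop with invariant `I`, a bound `μ` on the number of rounds that are left, and a bound `B₁`
on the time of a round. -/
lemma Runs.loop (I : ℕ → State → Prop) {k : ℕ} (hI : I k σ)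
    (hf : ∀ k τ, I k τ → e.Fits W τ)
    (hbody : ∀ k τ, I k τ → e.eval τ ≠ 0 → Runs W p τ B₁ fun τ' => ∃ k' < k, I k' τ')
    (hpost : ∀ k τ, I k τ → e.eval τ = 0 → post τ)
    (hB : k * (e.cost + B₁ + 1) + e.cost + 1 ≤ B) : Runs W (.loop e p) σ B post := by
  induction k using Nat.strong_induction_on generalizing σ B with
  | _ k ih =>
    by_cases he : e.eval σ = 0
    · exact ⟨_, σ, .loop_done (hf k σ hI) he, by omega, hpost k σ hI he⟩
    · obtain ⟨T, τ, h1, h2, k', hk', hI'⟩ := hbody k σ hI he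
      have hmul : k' * (e.cost + B₁ + 1) + (e.cost + B₁ + 1) ≤ k * (e.cost + B₁ + 1) := by
        rw [← Nat.succ_mul]
        exact Nat.mul_le_mul_right _ hk'
      obtain ⟨T', τ', h1', h2', h3'⟩ :=
        ih k' hk' hI' (B := k' * (e.cost + B₁ + 1) + e.cost + 1) le_rfl
      exact ⟨_, τ', .loop_step (hf k σ hI) he h1 h1', by omega, h3'⟩

end Rules

section State

lemma Op.eval_lt_le (x y : ℕ) : Op.lt.eval x y ≤ 1 := by
  simp only [Op.eval]
  split <;> omega

lemma Op.eval_eq_le (x y : ℕ) : Op.eq.eval x y ≤ 1 := by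
  simp only [Op.eval]
  split <;> omega

variable (σ : State) (i j k x : ℕ)

@[simp] lemma setReg_reg : (σ.setReg i x).reg j = if j = i then x else σ.reg j := by
  simp [State.setReg, Function.update_apply]

@[simp] lemma setReg_mem : (σ.setReg i x).mem = σ.mem := rfl

@[simp] lemma setMem_reg : (σ.setMem k j x).reg = σ.reg := rfl

lemma setMem_mem (k' : ℕ) : (σ.setMem k j x).mem k' =
    if k' = k then Function.update (σ.mem k) j x else σ.mem k' := by
  simp only [State.setMem, Function.update_apply]

lemma setMem_mem_self (j' : ℕ) :
    (σ.setMem k j x).mem k j' = if j' = j then x else σ.mem k j' := by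
  simp [setMem_mem, Function.update_apply]

lemma setMem_mem_of_ne {k' : ℕ} (h : k' ≠ k) : (σ.setMem k j x).mem k' = σ.mem k' := by
  simp [setMem_mem, h]

end State

section DartIndex

variable {m : ℕ}

lemma dartIndex_lt (d : Fin m × Bool) : dartIndex d < 2 * m := by
  have := d.1.2
  unfold dartIndex
  split <;> omega

@[simp] lemma dartIndex_div (d : Fin m × Bool) : dartIndex d / 2 = d.1 := by
  unfold dartIndex
  split <;> omega

lemma dartIndex_mod (d : Fin m × Bool) : dartIndex d % 2 = if d.2 then 0 else 1 := by
  unfold dartIndex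
  split <;> omega

lemma dartIndex_true (a : Fin m) : dartIndex (a, true) = 2 * (a : ℕ) := by simp [dartIndex]

lemma dartIndex_false (a : Fin m) : dartIndex (a, false) = 2 * (a : ℕ) + 1 := by simp [dartIndex]

lemma dartIndex_injective : Function.Injective (dartIndex (m := m)) := by
  rintro ⟨a, b⟩ ⟨a', b'⟩ h
  have h1 := congrArg (· / 2) h
  have h2 := congrArg (· % 2) h
  simp only [dartIndex_div, dartIndex_mod] at h1 h2
  obtain rfl := Fin.ext h1
  cases b <;> cases b' <;> simp_all

end DartIndex

/-! ### Graph search -/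

section Search

/-- Mark the dart `e` and append it to the queue unless it is already marked. -/
def push (M : ℕ) (e : Expr) : Program :=
  .seq (.set 13 e) (.ite (.mem M (.reg 13)) .skip
    (.seq (.store M (.reg 13) (.lit 1)) (.seq (.store 11 (.reg 11) (.reg 13))
      (.set 11 (.op .add (.reg 11) (.lit 1))))))

/-- Search from the dart `start`, where from a dart one can move to the next one around its vertex
and to the one given by `e` when it is in register 12. The darts that are reached are marked in the
array `M`. -/
def search (M : ℕ) (start e : Expr) : Program :=
  .seq (.set 10 (.lit 0)) (.seq (.set 11 (.lit 0)) (.seq (push M start)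
    (.loop (.op .lt (.reg 10) (.reg 11))
      (.seq (.set 12 (.mem 11 (.reg 10))) (.seq (.set 10 (.op .add (.reg 10) (.lit 1)))
        (.seq (push M (.mem 2 (.reg 12))) (push M e)))))))

/-- The states `σ` and `τ` agree except for what a search that marks in array `M` may change. -/
structure SearchFrame (M : ℕ) (σ τ : State) : Prop where
  reg : ∀ i, i < 10 → τ.reg i = σ.reg i
  mem : ∀ k, k ≠ M → k ≠ 11 → τ.mem k = σ.mem k

variable {m : ℕ}

open Classical in
/-- The array `M` marks the darts of the set `S`. -/
def Marks (τ : State) (M : ℕ) (S : Set (Fin m × Bool)) : Prop :=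
  (∀ d, τ.mem M (dartIndex d) = if d ∈ S then 1 else 0) ∧ ∀ j, 2 * m ≤ j → τ.mem M j = 0

/-- The list `q` is the content of the queue, and exactly its elements are marked. -/
structure QueueHolds (M : ℕ) (τ : State) (q : List (Fin m × Bool)) : Prop where
  nodup : q.Nodup
  length : τ.reg 11 = q.length
  entry : ∀ i d, q[i]? = some d → τ.mem 11 i = dartIndex d
  marks : Marks τ M {d | d ∈ q}

/-- No dart is queued twice. This bounds both the running time of a search and the queue pointers.
-/
lemma QueueHolds.length_le {M : ℕ} {τ : State} {q : List (Fin m × Bool)}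
    (h : QueueHolds M τ q) : q.length ≤ 2 * m := by
  have := h.nodup.length_le_card
  simpa [mul_comm] using this

lemma Marks.le_one {M : ℕ} {τ : State} {S : Set (Fin m × Bool)} (h : Marks τ M S) (j : ℕ) :
    τ.mem M j ≤ 1 := by
  by_cases hj : 2 * m ≤ j
  · rw [h.2 j hj]; omega
  · have hj' : j / 2 < m := by omega
    have := h.1 (⟨j / 2, hj'⟩, decide (j % 2 = 0))
    have e : dartIndex (⟨j / 2, hj'⟩, decide (j % 2 = 0)) = j := by
      unfold dartIndex
      simp only [decide_eq_true_eq]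
      split <;> omega
    rw [e] at this
    rw [this]
    split <;> omega

/-- The list `r` is empty or `[d]`, according to whether `d` was marked before. -/
lemma runs_push {W M : ℕ} {σ τ : State} {e : Expr} {d : Fin m × Bool} {q : List (Fin m × Bool)}
    (hM : M ≠ 11) (hW : 2 * m + 2 ≤ W) (hτ : SearchFrame M σ τ) (hq : QueueHolds M τ q)
    (hf : e.Fits W τ) (he : e.eval τ = dartIndex d) :
    Runs W (push M e) τ (e.cost + 20) fun τ' => SearchFrame M σ τ' ∧ τ'.reg 10 = τ.reg 10 ∧
      τ'.reg 12 = τ.reg 12 ∧ ∃ r, QueueHolds M τ' (q ++ r) ∧ d ∈ q ++ r ∧ ∀ x ∈ r, x = d := by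
  have hlen := hq.length_le
  have hd := dartIndex_lt d
  refine .set_seq (B₂ := 18) hf (.ite (B₁ := 15) ?_ (fun h => ?_) (fun h => ?_) ?_) (by omega)
  · have := hq.marks.le_one (dartIndex d)
    simp only [Expr.Fits, Expr.eval, he, setReg_reg, setReg_mem, if_true]
    omega
  · simp only [Expr.eval, he, setReg_reg, setReg_mem, if_true] at h
    refine .skip ⟨⟨fun i hi => ?_, hτ.mem⟩, ?_, ?_, [], ?_, ?_, by simp⟩ (by omega)
    · rw [setReg_reg, if_neg (by omega), hτ.reg i hi]
    · simp
    · simp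
    · rw [List.append_nil]
      exact ⟨hq.nodup, by simp [hq.length], hq.entry, hq.marks⟩
    · rw [hq.marks.1] at h
      simpa using h
  · simp only [Expr.eval, he, setReg_reg, setReg_mem, if_true] at h
    have hdq : d ∉ q := by
      rw [hq.marks.1] at h
      simpa using h
    have hmem := hτ.mem
    refine .store_seq (B₂ := 11) ?_ ?_ (.store_seq (B₂ := 6) ?_ ?_ (.set ?_ ?_ ?_) ?_) ?_
    · simp only [Expr.Fits, he, setReg_reg, if_true]; omega
    · simp only [Expr.Fits]; omega
    · simp only [Expr.Fits, setMem_reg, setReg_reg]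
      rw [if_neg (by omega), hq.length]; omega
    · simp only [Expr.Fits, setMem_reg, he, setReg_reg, if_true]; omega
    · simp only [Expr.Fits, Expr.eval, Op.eval, setMem_reg, setReg_reg]
      rw [if_neg (by omega), hq.length]; omega
    · simp only [Expr.cost]; omega
    · refine ⟨⟨fun i hi => ?_, fun k hk hk' => ?_⟩, ?_, ?_, [d], ⟨?_, ?_, ?_, ?_, ?_⟩, by simp,
        by simp⟩
      · simp only [setMem_reg, setReg_reg]
        rw [if_neg (by omega), if_neg (by omega), hτ.reg i hi]
      · simp [setMem_mem, hk, hk', hτ.mem]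
      · simp
      · simp
      · exact List.nodup_append.2 ⟨hq.nodup, by simp, by
          rintro a ha b hb rfl
          obtain rfl : a = d := by simpa using hb
          exact hdq ha⟩
      · simp [Expr.eval, Op.eval, hq.length]
      · intro i x hx
        simp only [Expr.eval, he, setMem_reg, setReg_reg, setReg_mem, setMem_mem, if_true]
        simp only [if_neg (show (11 : ℕ) ≠ 13 by omega), if_neg hM.symm, Function.update_apply,
          hq.length]
        split_ifs with hi
        · subst hi
          simp at hx
          rw [hx]
        · refine hq.entry i x ?_
          have hi' : i < (q ++ [d]).length := (List.getElem?_eq_some_iff.1 hx).1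
          rw [List.length_append, List.length_singleton] at hi'
          rwa [List.getElem?_append_left (by omega)] at hx
      · intro x
        simp only [Expr.eval, he, setReg_reg, setReg_mem, setMem_mem, if_true]
        simp only [if_neg hM, Function.update_apply, dartIndex_injective.eq_iff,
          hq.marks.1 x]
        by_cases hxd : x = d <;> simp [hxd]
      · intro j hj
        simp only [Expr.eval, he, setReg_reg, setReg_mem, setMem_mem, if_true]
        simp only [if_neg hM, Function.update_apply]
        rw [if_neg (by omega), hq.marks.2 j hj]
    · simp only [Expr.cost]; omega
    · simp only [Expr.cost]; omega
  · simp only [Expr.cost]; omega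

variable (F₁ F₂ : Fin m × Bool → Fin m × Bool)

/-- The set of darts that can be reached from `d` with two kinds of moves. -/
def closure (d : Fin m × Bool) : Set (Fin m × Bool) :=
  {d' | Relation.ReflTransGen (fun x y => y = F₁ x ∨ y = F₂ x) d d'}

variable {F₁ F₂}

/-- The values of `start` and `e` are required in every state allowed by `SearchFrame`, since the
search changes registers, the queue and the array `M` while it evaluates them. -/
lemma runs_search {W M : ℕ} {σ : State} {start e : Expr} {d₀ : Fin m × Bool}
    (hM : M ≠ 11) (hM2 : M ≠ 2) (hW : 2 * m + 2 ≤ W) (hMz : ∀ j, σ.mem M j = 0)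
    (h₁ : ∀ d, σ.mem 2 (dartIndex d) = dartIndex (F₁ d))
    (h₂ : ∀ τ d, SearchFrame M σ τ → τ.reg 12 = dartIndex d →
      e.Fits W τ ∧ e.eval τ = dartIndex (F₂ d))
    (h₀ : ∀ τ, SearchFrame M σ τ → start.Fits W τ ∧ start.eval τ = dartIndex d₀) :
    Runs W (search M start e) σ (2 * m * (e.cost + 60) + start.cost + 40) fun τ =>
      SearchFrame M σ τ ∧ Marks τ M (closure F₁ F₂ d₀) := by
  have hf0 : SearchFrame M σ ((σ.setReg 10 0).setReg 11 0) :=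
    ⟨fun i hi => by simp [show i ≠ 10 by omega, show i ≠ 11 by omega], fun k _ _ => rfl⟩
  have hq0 : QueueHolds (m := m) M ((σ.setReg 10 0).setReg 11 0) [] :=
    ⟨by simp, by simp, by simp, fun d => by simp [hMz], fun j _ => by simp [hMz]⟩
  refine .set_seq (B₂ := 2 * m * (e.cost + 60) + start.cost + 35) ?_ (.set_seq
    (B₂ := 2 * m * (e.cost + 60) + start.cost + 30) ?_ (.seq
    (runs_push hM hW hf0 hq0 (h₀ _ hf0).1 (h₀ _ hf0).2)
    (B₂ := 2 * m * (e.cost + 60) + 5) ?_ (by omega)) ?_) ?_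
  · simp [Expr.Fits]
  · simp [Expr.Fits]
  · rintro τ ⟨hτ, hτ10, -, r, hq, hd₀, hr⟩
    -- Register 10 counts the processed darts, whose two successors are already queued. The number
    -- of rounds left is measured against the capacity `2 * m`, not against the current queue.
    refine .loop (B₁ := e.cost + 55) (k := 2 * m) (fun k τ => SearchFrame M σ τ ∧
      ∃ q : List (Fin m × Bool), QueueHolds M τ q ∧ d₀ ∈ q ∧ (∀ d ∈ q, d ∈ closure F₁ F₂ d₀) ∧
        τ.reg 10 ≤ q.length ∧
      k + τ.reg 10 = 2 * m ∧ ∀ i < τ.reg 10, ∀ d, q[i]? = some d → F₁ d ∈ q ∧ F₂ d ∈ q)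
      ⟨hτ, [] ++ r, hq, hd₀, ?_, ?_, ?_, ?_⟩ ?_ ?_ ?_ ?_
    · intro d hd
      rw [hr d hd]
      exact .refl
    · simp [hτ10, Expr.eval]
    · simp [hτ10, Expr.eval]
    · simp [hτ10, Expr.eval]
    · rintro k τ ⟨hτ, q, hq, -, -, hle, -⟩
      have := hq.length_le
      have := hq.length
      have := Op.eval_lt_le (τ.reg 10) (τ.reg 11)
      simp only [Expr.Fits, Expr.eval]
      omega
    · rintro k τ ⟨hτ, q, hq, hd₀, hcl, hle, hk, hdone⟩ hne
      have hlen := hq.length_le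
      have hlt : τ.reg 10 < q.length := by
        simp only [Expr.eval, Op.eval, hq.length] at hne
        by_contra h
        simp [h] at hne
      obtain ⟨x, hx⟩ : ∃ x, q[τ.reg 10]? = some x := ⟨_, List.getElem?_eq_getElem hlt⟩
      have hxi := hq.entry _ _ hx
      have hxq : x ∈ q := List.mem_of_getElem? hx
      have hxlt := dartIndex_lt x
      have hτ1 : SearchFrame M σ ((τ.setReg 12 (dartIndex x)).setReg 10 (τ.reg 10 + 1)) :=
        ⟨fun i hi => by
          simp [show i ≠ 10 by omega, show i ≠ 12 by omega, hτ.reg i hi],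
          fun k hk hk' => hτ.mem k hk hk'⟩
      have hq1 : QueueHolds M ((τ.setReg 12 (dartIndex x)).setReg 10 (τ.reg 10 + 1)) q :=
        ⟨hq.nodup, by simp [hq.length], hq.entry, hq.marks⟩
      refine .set_seq (B₂ := e.cost + 49) ?_ (.set_seq (B₂ := e.cost + 44) ?_
        (.seq (runs_push (σ := σ) (d := F₁ x) (q := q) hM hW ?_ ?_ ?_ ?_)
          (B₂ := e.cost + 20) ?_ ?_) ?_) ?_
      · simp only [Expr.Fits, Expr.eval, hxi]
        omega
      · simp [Expr.Fits, Expr.eval, Op.eval]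
        omega
      · simpa [Expr.eval, Op.eval, hxi] using hτ1
      · simpa [Expr.eval, Op.eval, hxi] using hq1
      · simp only [Expr.Fits, Expr.eval, Op.eval, setReg_reg, hxi, setReg_mem]
        simp [hτ.mem 2 hM2.symm, h₁]
        have := dartIndex_lt (F₁ x)
        omega
      · simp [Expr.eval, Op.eval, hxi, hτ.mem 2 hM2.symm, h₁]
      · rintro τ₁ ⟨hτ₁, h10, h12, r₁, hq₁, hx₁, hr₁⟩
        simp only [Expr.eval, Op.eval, setReg_reg, hxi] at h10 h12
        obtain ⟨hf₂, he₂⟩ := h₂ τ₁ x hτ₁ (by simpa using h12)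
        refine (runs_push (d := F₂ x) hM hW hτ₁ hq₁ hf₂ he₂).mono (by omega) ?_
        rintro τ₂ ⟨hτ₂, h10', -, r₂, hq₂, hx₂, hr₂⟩
        have h10'' : τ₂.reg 10 = τ.reg 10 + 1 := by rw [h10', h10]; simp
        refine ⟨k - 1, by omega, hτ₂, q ++ r₁ ++ r₂, hq₂, by simp [hd₀], ?_, ?_, by omega, ?_⟩
        · intro d hd
          simp only [List.mem_append] at hd
          rcases hd with (hd | hd) | hd
          · exact hcl d hd
          · rw [hr₁ d hd]
            exact (hcl x hxq).tail (.inl rfl)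
          · rw [hr₂ d hd]
            exact (hcl x hxq).tail (.inr rfl)
        · simp only [List.length_append]; omega
        · intro i hi d hd
          rw [List.append_assoc, List.getElem?_append_left (by omega)] at hd
          rcases Nat.lt_or_ge i (τ.reg 10) with h | h
          · have := hdone i h d hd
            exact ⟨by simp [this.1], by simp [this.2]⟩
          · obtain rfl : i = τ.reg 10 := by omega
            obtain rfl : x = d := by simpa [hx] using hd
            exact ⟨List.mem_append_left _ hx₁, hx₂⟩
      · simp only [Expr.cost]; omega
      · simp only [Expr.cost]; omega
      · simp only [Expr.cost]; omega
    · rintro k τ ⟨hτ, q, hq, hd₀, hcl, hle, -, hdone⟩ he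
      have hle' : q.length ≤ τ.reg 10 := by
        simp only [Expr.eval, Op.eval, hq.length] at he
        by_contra h
        simp [show τ.reg 10 < q.length by omega] at he
      refine ⟨hτ, ?_⟩
      -- Everything in the queue has been processed, so the queue contains `d₀` and is closed under
      -- both moves.
      have : closure F₁ F₂ d₀ = {d | d ∈ q} := by
        ext d
        refine ⟨fun h => ?_, hcl d⟩
        induction h with
        | refl => exact hd₀
        | tail _ h ih =>
          obtain ⟨i, hi⟩ := List.getElem?_of_mem ih
          have hi' := (List.getElem?_eq_some_iff.1 hi).1
          have := hdone i (by omega) _ hi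
          rcases h with rfl | rfl
          · exact this.1
          · exact this.2
      rw [this]
      exact hq.marks
    · simp only [Expr.cost]
      have : 2 * m * (1 + 1 + 1 + (e.cost + 55) + 1) ≤ 2 * m * (e.cost + 60) :=
        Nat.mul_le_mul_left _ (by omega)
      omega
  · simp only [Expr.cost]; omega
  · simp only [Expr.cost]; omega

end Search

end RAM

/-! ### Reachability expressed by moves of darts. -/

namespace RAM

open EmbeddedDigraph

/-! ### Values of expressions -/

/-- In the state `σ`, the expression `e` respects the word bound and has the value `x`. -/
def HasValue (W : ℕ) (σ : State) (e : Expr) (x : ℕ) : Prop := e.Fits W σ ∧ e.eval σ = x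

section HasValue

variable {W : ℕ} {σ : State} {e e₁ e₂ : Expr} {x y z : ℕ}

lemma hasValue_lit (h : x ≤ W) : HasValue W σ (.lit x) x := ⟨h, rfl⟩

lemma hasValue_reg {i : ℕ} (h : σ.reg i = x) (hx : x ≤ W) : HasValue W σ (.reg i) x :=
  ⟨h.trans_le hx, h⟩

lemma HasValue.mem {k : ℕ} (he : HasValue W σ e x) (h : σ.mem k x = y) (hy : y ≤ W) :
    HasValue W σ (.mem k e) y :=
  ⟨⟨he.1, by rwa [he.2, h]⟩, by rw [Expr.eval, he.2, h]⟩

lemma HasValue.op {o : Op} (h₁ : HasValue W σ e₁ x) (h₂ : HasValue W σ e₂ y)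
    (h : o.eval x y = z) (hz : z ≤ W) : HasValue W σ (.op o e₁ e₂) z :=
  ⟨⟨h₁.1, h₂.1, by rwa [h₁.2, h₂.2, h]⟩, by rw [Expr.eval, h₁.2, h₂.2, h]⟩

variable {B B₁ B₂ : ℕ} {p q : Program} {post : State → Prop}

lemma Runs.set' {i : ℕ} (he : HasValue W σ e x) (h : post (σ.setReg i x))
    (hB : e.cost + 1 ≤ B) : Runs W (.set i e) σ B post :=
  .set he.1 hB (by rwa [he.2])

lemma Runs.set_seq' {i : ℕ} (he : HasValue W σ e x) (h : Runs W q (σ.setReg i x) B₂ post)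
    (hB : e.cost + B₂ + 2 ≤ B) : Runs W (.seq (.set i e) q) σ B post :=
  .set_seq he.1 (by rwa [he.2]) hB

lemma Runs.store_seq' {k : ℕ} (h₁ : HasValue W σ e₁ x) (h₂ : HasValue W σ e₂ y)
    (h : Runs W q (σ.setMem k x y) B₂ post)
    (hB : e₁.cost + e₂.cost + B₂ + 2 ≤ B) : Runs W (.seq (.store k e₁ e₂) q) σ B post :=
  .store_seq h₁.1 h₂.1 (by rwa [h₁.2, h₂.2]) hB

lemma Runs.ite' (he : HasValue W σ e x) (h₁ : x ≠ 0 → Runs W p σ B₁ post)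
    (h₂ : x = 0 → Runs W q σ B₁ post) (hB : e.cost + B₁ + 1 ≤ B) :
    Runs W (.ite e p q) σ B post :=
  .ite he.1 (by rwa [he.2]) (by rwa [he.2]) hB

end HasValue

/-! ### The searches of the algorithm -/

section Moves

variable {n m : ℕ} (G : EmbeddedDigraph (Fin n) (Fin m))

open Classical in
/-- Go to the other end of an arc, starting from its tail if `b` is true and from its head
otherwise, unless the vertex from which one starts lies in `Z`. -/
noncomputable def move (b : Bool) (Z : Set (Fin n)) (d : Fin m × Bool) : Fin m × Bool :=
  if d.2 = b ∧ G.vert d ∉ Z then flip d else d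

variable {G} {Z : Set (Fin n)} {d₀ d : Fin m × Bool}

lemma mem_closure_of_vert_eq (hG : G.IsPlane) {F : Fin m × Bool → Fin m × Bool}
    {d' : Fin m × Bool} (h : d ∈ closure G.rot F d₀) (hd : G.vert d' = G.vert d) :
    d' ∈ closure G.rot F d₀ := by
  obtain ⟨k, rfl⟩ := ((hG.rot_sameCycle d d').2 hd.symm).exists_nat_pow_eq
  clear hd
  induction k with
  | zero => exact h
  | succ k ih =>
    rw [pow_succ', Equiv.Perm.mul_apply]
    exact ih.tail (.inl rfl)

/-- Blocking is tested on departure, so vertices of `Z` are reached but not left. For `Z = ∅` this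
is reachability; for `Z = C` and a start at `s`, the vertices reached in `C` are the entrances. -/
lemma mem_closure_move_true (hG : G.IsPlane) :
    d ∈ closure G.rot (move G true Z) d₀ ↔
      ∃ l, G.IsWalk (G.vert d₀) l (G.vert d) ∧ ∀ a ∈ l, G.src a ∉ Z := by
  constructor
  · intro h
    induction h with
    | refl => exact ⟨[], rfl, by simp⟩
    | @tail x y _ h ih =>
      obtain ⟨l, hl, hZ⟩ := ih
      rcases h with rfl | rfl
      · exact ⟨l, by rwa [hG.vert_rot], hZ⟩
      · unfold move
        split_ifs with h
        · obtain ⟨a, b⟩ := x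
          obtain ⟨rfl, h⟩ := h
          refine ⟨l ++ [a], hl.append ⟨rfl, rfl⟩, ?_⟩
          simp only [List.mem_append, List.mem_singleton]
          rintro c (hc | rfl)
          · exact hZ c hc
          · exact h
        · exact ⟨l, hl, hZ⟩
  · rintro ⟨l, hl, hZ⟩
    have key : ∀ (l : List (Fin m)) (x : Fin m × Bool), x ∈ closure G.rot (move G true Z) d₀ →
        G.IsWalk (G.vert x) l (G.vert d) → (∀ a ∈ l, G.src a ∉ Z) →
        d ∈ closure G.rot (move G true Z) d₀ := by
      intro l
      induction l with
      | nil => intro x hx hl _; exact mem_closure_of_vert_eq hG hx (Eq.symm hl)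
      | cons a l ih =>
        intro x hx hl hZ
        have h1 : (a, true) ∈ closure G.rot (move G true Z) d₀ :=
          mem_closure_of_vert_eq hG hx hl.1
        refine ih (a, false) (h1.tail (.inr ?_)) hl.2 fun b hb => hZ b (by simp [hb])
        rw [move, if_pos ⟨rfl, hZ a (by simp)⟩]
        rfl
    exact key l d₀ .refl hl hZ

lemma mem_closure_move_false (hG : G.IsPlane) :
    d ∈ closure G.rot (move G false Z) d₀ ↔
      ∃ l, G.IsWalk (G.vert d) l (G.vert d₀) ∧ ∀ a ∈ l, G.tgt a ∉ Z := by
  constructor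
  · intro h
    induction h with
    | refl => exact ⟨[], rfl, by simp⟩
    | @tail x y _ h ih =>
      obtain ⟨l, hl, hZ⟩ := ih
      rcases h with rfl | rfl
      · exact ⟨l, by rwa [hG.vert_rot], hZ⟩
      · unfold move
        split_ifs with h
        · obtain ⟨a, b⟩ := x
          obtain ⟨rfl, h⟩ := h
          refine ⟨a :: l, ⟨rfl, hl⟩, ?_⟩
          simp only [List.mem_cons]
          rintro c (rfl | hc)
          · exact h
          · exact hZ c hc
        · exact ⟨l, hl, hZ⟩
  · rintro ⟨l, hl, hZ⟩
    induction l generalizing d with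
    | nil => exact mem_closure_of_vert_eq hG .refl hl
    | cons a l ih =>
      have h1 := ih (d := (a, false)) hl.2 fun b hb => hZ b (by simp [hb])
      have h2 : (a, true) ∈ closure G.rot (move G false Z) d₀ := by
        refine h1.tail (.inr ?_)
        rw [move, if_pos ⟨rfl, hZ a (by simp)⟩]
        rfl
      exact mem_closure_of_vert_eq hG h2 hl.1.symm

end Moves

/-- The move along the arc of the dart in register 12 if the dart is at its tail, where `b` tells
which vertices are blocked. -/
def forward (b : Expr → Expr) : Expr :=
  .op .add (.reg 12) (.op .mul (.op .sub (.lit 1) (.op .mod (.reg 12) (.lit 2)))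
    (.op .sub (.lit 1) (b (.mem 0 (.op .div (.reg 12) (.lit 2))))))

/-- The move along the arc of the dart in register 12 if the dart is at its head, where `b` tells
which vertices are blocked. -/
def backward (b : Expr → Expr) : Expr :=
  .op .sub (.reg 12) (.op .mul (.op .mod (.reg 12) (.lit 2))
    (.op .sub (.lit 1) (b (.mem 1 (.op .div (.reg 12) (.lit 2))))))

section MoveValue

variable {n m W : ℕ} {G : EmbeddedDigraph (Fin n) (Fin m)} {Z : Set (Fin n)} {τ : State}
  {b : Expr → Expr} {d : Fin m × Bool}

open Classical in
/-- The expression `b` tells which vertices lie in `Z`. -/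
def Decides (W : ℕ) (τ : State) (b : Expr → Expr) (Z : Set (Fin n)) : Prop :=
  ∀ e (v : Fin n), HasValue W τ e v → HasValue W τ (b e) (if v ∈ Z then 1 else 0)

lemma decides_empty : Decides (n := n) W τ (fun _ => .lit 0) ∅ := by
  intro e v _
  simpa using hasValue_lit (Nat.zero_le W)

/-- Tail ends have even numbers and the head end follows directly, so crossing means adding 1. The
two factors of the product test the parity and the blocking. -/
lemma hasValue_forward (hW : n + 2 * m + 2 ≤ W) (hsrc : ∀ a : Fin m, τ.mem 0 a = G.src a)
    (hb : Decides W τ b Z) (hd : τ.reg 12 = dartIndex d) :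
    HasValue W τ (forward b) (dartIndex (move G true Z d)) := by
  have hlt := dartIndex_lt d
  have hlt' := dartIndex_lt (move G true Z d)
  have h12 := hasValue_reg (W := W) hd (by omega)
  have h2 : HasValue W τ (.lit 2) 2 := hasValue_lit (by omega)
  have h1 : HasValue W τ (.lit 1) 1 := hasValue_lit (by omega)
  have hdiv := h12.op h2 (o := .div) (dartIndex_div d) (by omega)
  have hv := hb _ _ (hdiv.mem (hsrc d.1) (by omega))
  refine h12.op (((h1.op (h12.op h2 (o := .mod) (dartIndex_mod d) ?_) (o := .sub) rfl ?_).op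
    (h1.op hv (o := .sub) rfl ?_) (o := .mul) rfl ?_)) ?_ (by omega)
  · split <;> omega
  · simp only [Op.eval]; omega
  · simp only [Op.eval]; omega
  · refine (Nat.mul_le_mul (n₂ := 1) (m₂ := 1) ?_ ?_).trans (by omega) <;>
      simp only [Op.eval] <;> omega
  · obtain ⟨a, _ | _⟩ := d
    · simp [Op.eval, move]
    · by_cases h : G.src a ∈ Z <;> simp [Op.eval, move, h, dartIndex_true, dartIndex_false]

lemma hasValue_backward (hW : n + 2 * m + 2 ≤ W) (htgt : ∀ a : Fin m, τ.mem 1 a = G.tgt a)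
    (hb : Decides W τ b Z) (hd : τ.reg 12 = dartIndex d) :
    HasValue W τ (backward b) (dartIndex (move G false Z d)) := by
  have hlt := dartIndex_lt d
  have hlt' := dartIndex_lt (move G false Z d)
  have h12 := hasValue_reg (W := W) hd (by omega)
  have h2 : HasValue W τ (.lit 2) 2 := hasValue_lit (by omega)
  have h1 : HasValue W τ (.lit 1) 1 := hasValue_lit (by omega)
  have hdiv := h12.op h2 (o := .div) (dartIndex_div d) (by omega)
  have hv := hb _ _ (hdiv.mem (htgt d.1) (by omega))
  refine h12.op (((h12.op h2 (o := .mod) (dartIndex_mod d) ?_).op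
    (h1.op hv (o := .sub) rfl ?_) (o := .mul) rfl ?_)) ?_ (by omega)
  · split <;> omega
  · simp only [Op.eval]; omega
  · refine (Nat.mul_le_mul (n₂ := 1) (m₂ := 1) ?_ ?_).trans (by omega)
    · split <;> omega
    · simp only [Op.eval]; omega
  · obtain ⟨a, _ | _⟩ := d
    · by_cases h : G.tgt a ∈ Z <;> simp [Op.eval, move, h, dartIndex_true, dartIndex_false]
    · simp [Op.eval, move]

end MoveValue

/-- Membership of a vertex in the component, when arrays 7 and 8 mark what can be reached from the
component and what can reach it. -/
def inComponent (v : Expr) : Expr := .op .mul (.mem 7 (.mem 4 v)) (.mem 8 (.mem 4 v))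

/-- The four searches: from the given vertex of the component in both directions, from the source
up to the component, and from the sink backwards to the component. -/
def searches : Program :=
  .seq (.seq (search 7 (.mem 4 (.reg 4)) (forward fun _ => .lit 0))
      (search 8 (.mem 4 (.reg 4)) (backward fun _ => .lit 0)))
    (.seq (search 9 (.mem 4 (.reg 2)) (forward inComponent))
      (.ite (.op .lt (.mem 4 (.reg 3)) (.op .mul (.lit 2) (.reg 1)))
        (search 10 (.mem 4 (.reg 3)) (backward inComponent)) .skip))

section Ready

variable {n m W : ℕ} (G : EmbeddedDigraph (Fin n) (Fin m)) (s t : Fin n) (C : Set (Fin n))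

/-- The arrays hold `G` and `C`. -/
structure ComponentReady (τ : State) : Prop where
  src : ∀ a : Fin m, τ.mem 0 a = G.src a
  tgt : ∀ a : Fin m, τ.mem 1 a = G.tgt a
  next : ∀ d, τ.mem 2 (dartIndex d) = dartIndex (G.rot d)
  first_le : ∀ v : Fin n, τ.mem 4 v ≤ 2 * m
  fwd_le : ∀ j, τ.mem 7 j ≤ 1
  bwd_le : ∀ j, τ.mem 8 j ≤ 1
  mem_comp : ∀ v ∈ C, τ.mem 7 (τ.mem 4 v) * τ.mem 8 (τ.mem 4 v) = 1
  notMem_comp : ∀ v ∉ C, τ.mem 7 (τ.mem 4 v) * τ.mem 8 (τ.mem 4 v) = 0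

open Classical in
/-- The arrays hold `G`, `C`, its entrances and its exits. -/
structure Ready (τ : State) : Prop extends ComponentReady G C τ where
  entrance : ∀ v ∈ C, τ.mem 9 (τ.mem 4 v) = if G.IsEntrance s C v then 1 else 0
  exit : ∀ v ∈ C, τ.mem 10 (τ.mem 4 v) = if G.IsExit t C v then 1 else 0

variable {G s t C} {τ : State}

lemma ComponentReady.decides (h : ComponentReady G C τ) (hW : n + 2 * m + 2 ≤ W) :
    Decides W τ inComponent C := by
  intro e v he
  have hle := h.first_le v
  have h1 := h.fwd_le (τ.mem 4 v)
  have h2 := h.bwd_le (τ.mem 4 v)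
  have h3 := he.mem (k := 4) rfl (by omega)
  refine (h3.mem rfl (by omega)).op (h3.mem rfl (by omega)) ?_ (by split <;> omega)
  by_cases hv : v ∈ C
  · simp [Op.eval, hv, h.mem_comp v hv]
  · simpa [Op.eval, hv] using h.notMem_comp v hv

lemma ComponentReady.congr {τ' : State} (h : ComponentReady G C τ)
    (h' : ∀ k, k ≤ 4 ∨ k = 7 ∨ k = 8 → τ'.mem k = τ.mem k) : ComponentReady G C τ' := by
  have e0 := h' 0 (by omega)
  have e1 := h' 1 (by omega)
  have e2 := h' 2 (by omega)
  have e4 := h' 4 (by omega)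
  have e7 := h' 7 (by omega)
  have e8 := h' 8 (by omega)
  obtain ⟨a0, a1, a2, a3, a4, a5, a6, a7⟩ := h
  constructor <;> simpa only [e0, e1, e2, e4, e7, e8]

lemma Ready.congr {τ' : State} (h : Ready G s t C τ)
    (h' : ∀ k, k ≠ 5 → k ≠ 6 → τ'.mem k = τ.mem k) : Ready G s t C τ' := by
  have e4 := h' 4 (by omega) (by omega)
  have e9 := h' 9 (by omega) (by omega)
  have e10 := h' 10 (by omega) (by omega)
  refine ⟨h.1.congr fun k _ => h' k (by omega) (by omega), ?_, ?_⟩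
  · simpa only [e4, e9] using h.entrance
  · simpa only [e4, e10] using h.exit

end Ready

end RAM

/-! ### The searches find the component, its entrances and its exits. -/

namespace RAM

open EmbeddedDigraph

section Searches

variable {n m W : ℕ} {G : EmbeddedDigraph (Fin n) (Fin m)} {s t c : Fin n} {C : Set (Fin n)}
  {σ : State}

lemma IsInput.first_le (h : IsInput G s t c σ) (v : Fin n) : σ.mem 4 v ≤ 2 * m := by
  by_cases hv : ∃ d, G.vert d = v
  · obtain ⟨d, -, hd⟩ := h.first v hv
    rw [hd]
    exact (dartIndex_lt d).le
  · exact (h.first_isolated v hv).le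

/-- The two searches from a vertex of the component determine the component. -/
lemma runs_component_searches (hW : n + 2 * m + 2 ≤ W) (hN : G.IsNormalNetwork s t)
    (hC : G.IsOutsideComponent s t C) (hc : c ∈ C) (hσ : IsInput G s t c σ) :
    Runs W (.seq (search 7 (.mem 4 (.reg 4)) (forward fun _ => .lit 0))
      (search 8 (.mem 4 (.reg 4)) (backward fun _ => .lit 0))) σ (500 * (n + m)) fun τ =>
        ComponentReady G C τ ∧ (∀ i < 10, τ.reg i = σ.reg i) ∧
          ∀ k, k ≠ 7 → k ≠ 8 → k ≠ 11 → τ.mem k = σ.mem k := by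
  have hn : 0 < n := c.pos
  obtain ⟨a, haC, ha⟩ := hC.exists_in hc
  obtain ⟨dc, hdc, hdc'⟩ := hσ.first c ⟨(a, false), ha⟩
  have hdclt := dartIndex_lt dc
  have hstart : ∀ τ : State, τ.reg 4 = σ.reg 4 → τ.mem 4 = σ.mem 4 →
      HasValue W τ (.mem 4 (.reg 4)) (dartIndex dc) := fun τ h h' =>
    (hasValue_reg (h.trans hσ.reg_c) (by omega)).mem (by rw [h', hdc']) (by omega)
  refine Runs.seq (runs_search (F₁ := G.rot) (F₂ := move G true ∅) (d₀ := dc) (by omega)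
    (by omega) (by omega) (fun j => hσ.mem_zero 7 j (by omega)) hσ.next (fun τ d hτ hd => ?_)
    (fun τ hτ => hstart τ (hτ.reg 4 (by omega)) (hτ.mem 4 (by omega) (by omega))))
    (fun τ₁ h₁ => Runs.mono (runs_search (F₁ := G.rot) (F₂ := move G false ∅) (d₀ := dc)
      (by omega) (by omega) (by omega) (fun j => ?_) ?_ (fun τ d hτ hd => ?_) (fun τ hτ => ?_))
      le_rfl (fun τ₂ h₂ => ?_)) ?_
  · refine hasValue_forward hW (fun a => ?_) decides_empty hd
    rw [hτ.mem 0 (by omega) (by omega), hσ.src]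
  · rw [h₁.1.mem 8 (by omega) (by omega)]
    exact hσ.mem_zero 8 j (by omega)
  · rw [h₁.1.mem 2 (by omega) (by omega)]
    exact hσ.next
  · refine hasValue_backward hW (fun a => ?_) decides_empty hd
    rw [hτ.mem 1 (by omega) (by omega), h₁.1.mem 1 (by omega) (by omega), hσ.tgt]
  · refine hstart τ ((hτ.reg 4 (by omega)).trans (h₁.1.reg 4 (by omega))) ?_
    rw [hτ.mem 4 (by omega) (by omega), h₁.1.mem 4 (by omega) (by omega)]
  · have hmem : ∀ k, k ≠ 7 → k ≠ 8 → k ≠ 11 → τ₂.mem k = σ.mem k := fun k h h' h'' => by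
      rw [h₂.1.mem k h' h'', h₁.1.mem k h h'']
    have hm7 : Marks τ₂ 7 (closure G.rot (move G true ∅) dc) := by
      have := h₁.2
      unfold Marks at this ⊢
      rwa [h₂.1.mem 7 (by omega) (by omega)]
    have e0 := hmem 0 (by omega) (by omega) (by omega)
    have e1 := hmem 1 (by omega) (by omega) (by omega)
    have e2 := hmem 2 (by omega) (by omega) (by omega)
    have e4 := hmem 4 (by omega) (by omega) (by omega)
    -- The component consists of the vertices that `c` reaches and that reach `c`.
    have key : ∀ v d, G.vert d = v → (v ∈ C ↔ d ∈ closure G.rot (move G true ∅) dc ∧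
        d ∈ closure G.rot (move G false ∅) dc) := by
      intro v d hd
      rw [mem_closure_move_true hN.plane, mem_closure_move_false hN.plane,
        hC.scc.eq_of_mem hc, hdc, hd]
      simp only [Set.mem_empty_iff_false, not_false_eq_true, implies_true, and_true]
      rfl
    refine ⟨⟨?_, ?_, ?_, ?_, hm7.le_one, h₂.2.le_one, ?_, ?_⟩, fun i hi => ?_, hmem⟩
    · rw [e0]; exact hσ.src
    · rw [e1]; exact hσ.tgt
    · rw [e2]; exact hσ.next
    · rw [e4]; exact hσ.first_le
    · intro v hv
      obtain ⟨a, -, ha⟩ := hC.exists_in hv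
      obtain ⟨d, hd, hd'⟩ := hσ.first v ⟨(a, false), ha⟩
      have := (key v d hd).1 hv
      rw [e4, hd', hm7.1, h₂.2.1, if_pos this.1, if_pos this.2]
    · intro v hv
      by_cases hd : ∃ d, G.vert d = v
      · obtain ⟨d, hd, hd'⟩ := hσ.first v hd
        rw [e4, hd', hm7.1, h₂.2.1]
        have := mt (key v d hd).2 hv
        split_ifs with h h' <;> simp_all
      -- An isolated vertex has the entry `2 * m` in array 4, a cell that no search marks.
      · rw [e4, hσ.first_isolated v hd, hm7.2 _ le_rfl, zero_mul]
    · rw [h₂.1.reg i hi, h₁.1.reg i hi]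
  · simp only [Expr.cost, forward, backward]
    omega

/-- The searches from `s` and from `t` stop at `C`. They certify walks only, which suffices by loop
erasure (`isEntrance_of_walk`, `isExit_of_walk`). -/
lemma runs_searches (hW : n + 2 * m + 2 ≤ W) (hN : G.IsNormalNetwork s t)
    (hC : G.IsOutsideComponent s t C) (hc : c ∈ C) (hσ : IsInput G s t c σ) :
    Runs W searches σ (1100 * (n + m)) fun τ =>
      Ready G s t C τ ∧ ∀ i < 10, τ.reg i = σ.reg i := by
  classical
  have hn : 0 < n := c.pos
  obtain ⟨as, has, -⟩ := hN.source_out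
  obtain ⟨ds, hds, hds'⟩ := hσ.first s ⟨(as, true), has⟩
  have hdslt := dartIndex_lt ds
  refine Runs.seq (runs_component_searches hW hN hC hc hσ) (B₂ := 550 * (n + m))
    (fun τ ⟨hτ, hreg, hmem⟩ => ?_) (by omega)
  have e4 := hmem 4 (by omega) (by omega) (by omega)
  refine Runs.seq (runs_search (F₁ := G.rot) (F₂ := move G true C) (d₀ := ds) (by omega)
    (by omega) (by omega) (fun j => ?_) hτ.next (fun τ' d hτ' hd => ?_) (fun τ' hτ' => ?_))
    (B₂ := 270 * (n + m)) (fun τ₁ ⟨hf₁, hm₁⟩ => ?_) ?_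
  · rw [hmem 9 (by omega) (by omega) (by omega)]
    exact hσ.mem_zero 9 j (by omega)
  · have h' : ComponentReady G C τ' :=
      hτ.congr fun k hk => hτ'.mem k (by omega) (by omega)
    exact hasValue_forward hW h'.src (h'.decides hW) hd
  · refine (hasValue_reg (x := s) ?_ (by omega)).mem ?_ (by omega)
    · rw [hτ'.reg 2 (by omega), hreg 2 (by omega), hσ.reg_s]
    · rw [hτ'.mem 4 (by omega) (by omega), e4, hds']
  · have hτ₁ : ComponentReady G C τ₁ := hτ.congr fun k hk => hf₁.mem k (by omega) (by omega)
    have e4' : τ₁.mem 4 = σ.mem 4 := (hf₁.mem 4 (by omega) (by omega)).trans e4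
    have hreg₁ : ∀ i < 10, τ₁.reg i = σ.reg i :=
      fun i hi => (hf₁.reg i hi).trans (hreg i hi)
    have hz : ∀ j, τ₁.mem 10 j = 0 := fun j => by
      rw [hf₁.mem 10 (by omega) (by omega), hmem 10 (by omega) (by omega) (by omega)]
      exact hσ.mem_zero 10 j (by omega)
    have hent : ∀ v ∈ C, τ₁.mem 9 (τ₁.mem 4 v) = if G.IsEntrance s C v then 1 else 0 := by
      intro v hv
      obtain ⟨a, -, ha⟩ := hC.exists_in hv
      obtain ⟨d, hd, hd'⟩ := hσ.first v ⟨(a, false), ha⟩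
      rw [e4', hd', hm₁.1]
      refine if_congr ?_ rfl rfl
      rw [mem_closure_move_true hN.plane, hds, hd]
      constructor
      · rintro ⟨l, hl, hlC⟩
        exact isEntrance_of_walk hv hl hlC
      · intro h
        obtain ⟨l, hl, hlC⟩ := h.exists_path
        exact ⟨l, hl.1, hlC⟩
    have hvt : HasValue W τ₁ (.mem 4 (.reg 3)) (σ.mem 4 t) :=
      (hasValue_reg ((hreg₁ 3 (by omega)).trans hσ.reg_t) (by omega)).mem (by rw [e4'])
        ((hσ.first_le t).trans (by omega))
    have hvm : HasValue W τ₁ (.op .mul (.lit 2) (.reg 1)) (2 * m) :=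
      (hasValue_lit (by omega)).op
        (hasValue_reg ((hreg₁ 1 (by omega)).trans hσ.reg_m) (by omega)) rfl (by omega)
    refine .ite' (B₁ := 260 * (n + m)) (hvt.op hvm (o := .lt) rfl
      ((Op.eval_lt_le _ _).trans (by omega))) (fun h => ?_) (fun h => ?_) ?_
    · have hlt : σ.mem 4 t < 2 * m := by
        by_contra h'
        simp [Op.eval, h'] at h
      have htd : ∃ d, G.vert d = t := by
        by_contra h'
        rw [hσ.first_isolated t h'] at hlt
        omega
      obtain ⟨dt, hdt, hdt'⟩ := hσ.first t htd
      refine Runs.mono (runs_search (F₁ := G.rot) (F₂ := move G false C) (d₀ := dt) (by omega)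
        (by omega) (by omega) hz hτ₁.next (fun τ' d hτ' hd => ?_) (fun τ' hτ' => ?_))
        ?_ (fun τ₂ ⟨hf₂, hm₂⟩ => ?_)
      · have h' : ComponentReady G C τ' :=
          hτ₁.congr fun k hk => hτ'.mem k (by omega) (by omega)
        exact hasValue_backward hW h'.tgt (h'.decides hW) hd
      · refine (hasValue_reg (x := t) ?_ (by omega)).mem ?_ ?_
        · rw [hτ'.reg 3 (by omega), hreg₁ 3 (by omega), hσ.reg_t]
        · rw [hτ'.mem 4 (by omega) (by omega), e4', hdt']
        · have := dartIndex_lt dt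
          omega
      · simp only [Expr.cost, backward, inComponent]
        omega
      · have e4'' := hf₂.mem 4 (by omega) (by omega)
        refine ⟨⟨hτ₁.congr fun k hk => hf₂.mem k (by omega) (by omega), ?_, ?_⟩,
          fun i hi => (hf₂.reg i hi).trans (hreg₁ i hi)⟩
        · rw [hf₂.mem 9 (by omega) (by omega), e4'']
          exact hent
        · intro v hv
          obtain ⟨a, -, ha⟩ := hC.exists_in hv
          obtain ⟨d, hd, hd'⟩ := hσ.first v ⟨(a, false), ha⟩
          rw [e4'', e4', hd', hm₂.1]
          refine if_congr ?_ rfl rfl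
          rw [mem_closure_move_false hN.plane, hdt, hd]
          constructor
          · rintro ⟨l, hl, hlC⟩
            exact isExit_of_walk hv hl hlC
          · intro h
            obtain ⟨l, hl, hlC⟩ := h.exists_path
            exact ⟨l, hl.1, hlC⟩
    -- An isolated sink offers no dart to start from. Then there is no exit, in accordance with
    -- array 10 being zero.
    · refine .skip ⟨⟨hτ₁, hent, fun v hv => ?_⟩, hreg₁⟩ (by omega)
      rw [hz, if_neg]
      intro hx
      have htd : ∃ d, G.vert d = t := by
        obtain ⟨l, hl, -⟩ := hx.exists_path
        obtain ⟨a, -, ha⟩ := hl.1.exists_tgt_eq_end fun h => hC.sink_notMem (h ▸ hv)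
        exact ⟨(a, false), ha⟩
      obtain ⟨d, -, hd⟩ := hσ.first t htd
      have := dartIndex_lt d
      rw [hd] at h
      simp [Op.eval, this] at h
    · simp only [Expr.cost]
      omega
  · simp only [Expr.cost, forward, inComponent]
    omega

end Searches

end RAM

/-! ### The scan and the local step along the boundary. -/

namespace RAM

open EmbeddedDigraph

/-! ### Finding the two paths -/

/-- Whether both ends of an arc lie in the component. -/
def arcInComponent (e : Expr) : Expr := .op .mul (inComponent (.mem 0 e)) (inComponent (.mem 1 e))

/-- Whether a vertex of the component is an entrance, when array 9 holds the result of the search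
from the source. -/
def isEntrance (v : Expr) : Expr := .mem 9 (.mem 4 v)

/-- Whether a vertex of the component is an exit, when array 10 holds the result of the search from
the sink. -/
def isExit (v : Expr) : Expr := .mem 10 (.mem 4 v)

/-- Look for an exit and for an entrance among the tails of the arcs of the component. Registers 6
and 7 tell whether there are any, and register 8 contains an arc that starts at an exit. -/
def scan : Program :=
  .loop (.op .lt (.reg 5) (.reg 1))
    (.seq (.ite (arcInComponent (.reg 5))
      (.seq (.ite (isExit (.mem 0 (.reg 5))) (.seq (.set 6 (.lit 1)) (.set 8 (.reg 5))) .skip)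
        (.ite (isEntrance (.mem 0 (.reg 5))) (.set 7 (.lit 1)) .skip)) .skip)
      (.set 5 (.op .add (.reg 5) (.lit 1))))

/-- Replace the boundary arc in register 8 by the next one. -/
def nextArc : Program :=
  .seq (.set 14 (.mem 2 (.op .add (.op .mul (.lit 2) (.reg 8)) (.lit 1))))
    (.seq (.ite (arcInComponent (.op .div (.reg 14) (.lit 2))) .skip (.set 14 (.mem 2 (.reg 14))))
      (.set 8 (.op .div (.reg 14) (.lit 2))))

/-- Follow the boundary to the first entrance; collect the arcs since the last exit in array 6. -/
def collectSecond : Program :=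
  .loop (.op .eq (isEntrance (.mem 0 (.reg 8))) (.lit 0))
    (.seq (.ite (isExit (.mem 0 (.reg 8))) (.set 9 (.lit 0)) .skip)
      (.seq (.store 6 (.reg 9) (.reg 8)) (.seq (.set 9 (.op .add (.reg 9) (.lit 1))) nextArc)))

/-- Follow the boundary up to the first arc in array 6; collect the arcs in array 5. -/
def collectFirst : Program :=
  .loop (.op .eq (.op .eq (.reg 8) (.mem 6 (.lit 0))) (.lit 0))
    (.seq (.store 5 (.reg 15) (.reg 8))
      (.seq (.set 15 (.op .add (.reg 15) (.lit 1))) nextArc))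

/-- The algorithm. -/
def splitBoundary : Program :=
  .seq searches (.seq scan (.ite (.op .mul (.reg 6) (.reg 7))
    (.seq collectSecond (.seq (.set 15 (.lit 0)) (.seq collectFirst
      (.seq (.set 0 (.lit 1)) (.seq (.set 1 (.reg 15)) (.set 2 (.reg 9)))))))
    (.set 0 (.lit 0))))

section Correctness

variable {n m W : ℕ} {G : EmbeddedDigraph (Fin n) (Fin m)} {s t c : Fin n} {C : Set (Fin n)}
  {σ τ : State}

open Classical in
lemma Ready.hasValue_arcInComponent (h : Ready G s t C τ) (hW : n + 2 * m + 2 ≤ W) {e : Expr}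
    {a : Fin m} (he : HasValue W τ e a) :
    HasValue W τ (arcInComponent e) (if a ∈ G.arcsOf C then 1 else 0) := by
  have h1 := h.decides hW _ _ (he.mem (h.src a) (by omega))
  have h2 := h.decides hW _ _ (he.mem (h.tgt a) (by omega))
  refine h1.op h2 ?_ (by split <;> omega)
  by_cases hs : G.src a ∈ C <;> by_cases ht : G.tgt a ∈ C <;> simp [Op.eval, arcsOf, hs, ht]

open Classical in
lemma Ready.hasValue_isEntrance (h : Ready G s t C τ) (hW : n + 2 * m + 2 ≤ W) {e : Expr}
    {a : Fin m} (he : HasValue W τ e a) (ha : a ∈ G.arcsOf C) :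
    HasValue W τ (isEntrance (.mem 0 e)) (if G.IsEntrance s C (G.src a) then 1 else 0) := by
  have h1 := (he.mem (h.src a) (by omega)).mem (k := 4) rfl
    ((h.first_le _).trans (by omega : 2 * m ≤ W))
  exact h1.mem (h.entrance _ ha.1) (by split <;> omega)

open Classical in
lemma Ready.hasValue_isExit (h : Ready G s t C τ) (hW : n + 2 * m + 2 ≤ W) {e : Expr}
    {a : Fin m} (he : HasValue W τ e a) (ha : a ∈ G.arcsOf C) :
    HasValue W τ (isExit (.mem 0 e)) (if G.IsExit t C (G.src a) then 1 else 0) := by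
  have h1 := (he.mem (h.src a) (by omega)).mem (k := 4) rfl
    ((h.first_le _).trans (by omega : 2 * m ≤ W))
  exact h1.mem (h.exit _ ha.1) (by split <;> omega)

/-- By `IsOutsideComponent.rot_of_boundary` the next boundary arc is one or two rotation steps away.
Membership of the first dart met in the component tells the cases apart. -/
lemma runs_nextArc (hW : n + 2 * m + 2 ≤ W) (hN : G.IsNormalNetwork s t)
    (hC : G.IsOutsideComponent s t C) (hτ : Ready G s t C τ) {b b' : Fin m}
    (hb : b ∈ G.boundary C) (hb' : b' ∈ G.boundary C) (hbb' : G.src b' = G.tgt b)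
    (h8 : τ.reg 8 = b) :
    Runs W nextArc τ 70 fun τ' => τ'.reg 8 = b' ∧
      (∀ i, i ≠ 8 → i ≠ 14 → τ'.reg i = τ.reg i) ∧ τ'.mem = τ.mem := by
  classical
  obtain ⟨d, hd⟩ : ∃ d, d = G.rot (b, false) := ⟨_, rfl⟩
  have hdlt := dartIndex_lt d
  have h2 : ∀ τ : State, HasValue W τ (.lit 2) 2 := fun τ => hasValue_lit (by omega)
  have hv : HasValue W τ (.mem 2 (.op .add (.op .mul (.lit 2) (.reg 8)) (.lit 1)))
      (dartIndex d) := by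
    have h1 := (((h2 τ).op (hasValue_reg h8 (by omega)) (o := .mul) rfl
      (by simp only [Op.eval]; omega)).op
      (hasValue_lit (x := 1) (by omega)) (o := .add) (dartIndex_false b).symm
      (by have := dartIndex_lt (b, false); omega))
    exact h1.mem (by rw [hτ.next, hd]) (by omega)
  have hτ₁ : Ready G s t C (τ.setReg 14 (dartIndex d)) := hτ.congr fun _ _ _ => rfl
  have hdiv : ∀ d : Fin m × Bool, ∀ τ : State, τ.reg 14 = dartIndex d →
      HasValue W τ (.op .div (.reg 14) (.lit 2)) d.1 := fun d τ h =>
    (hasValue_reg h (by have := dartIndex_lt d; omega)).op (h2 τ) (dartIndex_div d) (by omega)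
  have hfin : ∀ τ' : State, τ'.reg 14 = dartIndex (b', true) →
      (∀ i, i ≠ 8 → i ≠ 14 → τ'.reg i = τ.reg i) → τ'.mem = τ.mem →
      Runs W (.set 8 (.op .div (.reg 14) (.lit 2))) τ' 5 fun τ' => τ'.reg 8 = b' ∧
        (∀ i, i ≠ 8 → i ≠ 14 → τ'.reg i = τ.reg i) ∧ τ'.mem = τ.mem := by
    intro τ' h h' h''
    refine .set' (hdiv _ τ' h) ⟨by simp, fun i hi hi' => ?_, h''⟩ (by simp [Expr.cost])
    rw [setReg_reg, if_neg hi, h' i hi hi']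
  refine .set_seq' (B₂ := 60) hv ?_ (by simp [Expr.cost])
  refine Runs.seq (mid := fun τ' => τ'.reg 14 = dartIndex (b', true) ∧
      (∀ i, i ≠ 8 → i ≠ 14 → τ'.reg i = τ.reg i) ∧ τ'.mem = τ.mem) (B₁ := 50) (B₂ := 5) ?_
    (fun τ' h => hfin τ' h.1 h.2.1 h.2.2) (by omega)
  have hreg : ∀ x y i, i ≠ 8 → i ≠ 14 →
      ((τ.setReg 14 x).setReg 14 y).reg i = τ.reg i := fun x y i _ hi => by simp [hi]
  refine .ite' (B₁ := 5) (hτ₁.hasValue_arcInComponent hW (hdiv d _ (by simp))) (fun h => ?_)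
    (fun h => ?_) (by simp [Expr.cost, arcInComponent, inComponent])
  · have hdC : d.1 ∈ G.arcsOf C := by
      by_contra h'
      simp [h'] at h
    rcases hC.rot_of_boundary hN hb hb' hbb' with h' | ⟨h', -⟩
    · exact .skip ⟨by simp [hd, h'], fun i _ hi => by simp [hi], rfl⟩ (by omega)
    · exact absurd (hd ▸ hdC) h'
  · have hdC : d.1 ∉ G.arcsOf C := by
      intro h'
      simp [h'] at h
    rcases hC.rot_of_boundary hN hb hb' hbb' with h' | ⟨-, h'⟩
    · rw [← hd] at h'
      rw [h'] at hdC
      exact absurd hb'.1 hdC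
    · rw [← hd] at h'
      have hlt' := dartIndex_lt (b', true)
      refine .set' (x := dartIndex (b', true)) ?_ ⟨by simp, hreg _ _, rfl⟩ (by simp [Expr.cost])
      refine (hasValue_reg (x := dartIndex d) (by simp) (by omega)).mem ?_ (by omega)
      rw [setReg_mem, hτ.next, h']

/-- The register `i` tells whether some arc of the component with number less than `a` has a tail
with the property `P`. -/
def Found (G : EmbeddedDigraph (Fin n) (Fin m)) (C : Set (Fin n)) (P : Fin n → Prop) (i : ℕ)
    (a : ℕ) (τ : State) : Prop :=
  (τ.reg i = 0 ∧ ∀ b ∈ G.arcsOf C, (b : ℕ) < a → ¬ P (G.src b)) ∨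
    (τ.reg i = 1 ∧ ∃ b ∈ G.arcsOf C, P (G.src b))

lemma Found.succ {P : Fin n → Prop} {i : ℕ} {a : Fin m} (h : Found G C P i a τ)
    (ha : a ∈ G.arcsOf C → ¬ P (G.src a)) : Found G C P i (a + 1) τ := by
  refine h.imp_left fun ⟨h1, h2⟩ => ⟨h1, fun b hb hba => ?_⟩
  rcases Nat.lt_succ_iff_lt_or_eq.1 hba with h | h
  · exact h2 b hb h
  · obtain rfl := Fin.ext h
    exact ha hb

lemma Found.congr {P : Fin n → Prop} {i a : ℕ} {τ' : State} (h : Found G C P i a τ)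
    (h' : τ'.reg i = τ.reg i) : Found G C P i a τ' := by
  unfold Found
  rwa [h']

lemma runs_scan (hW : n + 2 * m + 2 ≤ W) (hτ : Ready G s t C τ) (h1 : τ.reg 1 = m)
    (h5 : τ.reg 5 = 0) (h6 : τ.reg 6 = 0) (h7 : τ.reg 7 = 0) :
    Runs W scan τ (100 * m + 10) fun τ' => τ'.mem = τ.mem ∧ τ'.reg 9 = τ.reg 9 ∧
      Found G C (G.IsExit t C) 6 m τ' ∧ Found G C (G.IsEntrance s C) 7 m τ' ∧
      (τ'.reg 6 = 1 → ∃ b ∈ G.arcsOf C, G.IsExit t C (G.src b) ∧ τ'.reg 8 = b) := by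
  classical
  -- Three indices, for the arc counter and for the progress on exits and on entrances, because
  -- these advance one after the other within a round.
  let J : ℕ → ℕ → ℕ → State → Prop := fun r x e τ' =>
    τ'.mem = τ.mem ∧ τ'.reg 1 = m ∧ τ'.reg 5 = r ∧ τ'.reg 9 = τ.reg 9 ∧
      Found G C (G.IsExit t C) 6 x τ' ∧ Found G C (G.IsEntrance s C) 7 e τ' ∧
      (τ'.reg 6 = 1 → ∃ b ∈ G.arcsOf C, G.IsExit t C (G.src b) ∧ τ'.reg 8 = b)
  have hready : ∀ {r x e τ'}, J r x e τ' → Ready G s t C τ' := fun h =>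
    hτ.congr fun k _ _ => by rw [h.1]
  refine .loop (fun k τ' => ∃ a, k + a = m ∧ J a a a τ') (k := m) (B₁ := 90)
    ⟨0, rfl, rfl, h1, h5, rfl, .inl ⟨h6, by simp⟩, .inl ⟨h7, by simp⟩, by simp [h6]⟩ ?_ ?_ ?_ ?_
  · rintro k τ' ⟨a, hk, h⟩
    have := h.2.1
    have := h.2.2.1
    exact ((hasValue_reg h.2.2.1 (by omega)).op (hasValue_reg h.2.1 (by omega)) rfl
      ((Op.eval_lt_le _ _).trans (by omega))).1
  · rintro k τ' ⟨a, hk, h⟩ hne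
    have ham : a < m := by
      by_contra h'
      simp [Expr.eval, Op.eval, h.2.1, h.2.2.1, h'] at hne
    obtain ⟨a, rfl⟩ : ∃ a' : Fin m, a = a' := ⟨⟨a, ham⟩, rfl⟩
    have hreg : ∀ {x e τ'}, J a x e τ' → HasValue W τ' (.reg 5) a := fun h =>
      hasValue_reg h.2.2.1 (by omega)
    refine Runs.seq (mid := J a (a + 1) (a + 1)) (B₁ := 80) (B₂ := 5) ?_ (fun τ' h => ?_)
      (by omega)
    · refine .ite' (B₁ := 45) ((hready h).hasValue_arcInComponent hW (hreg h)) (fun hc => ?_)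
        (fun hc => ?_) (by simp [Expr.cost, arcInComponent, inComponent])
      · have haC : a ∈ G.arcsOf C := by
          by_contra h'
          simp [h'] at hc
        refine Runs.seq (mid := J a (a + 1) a) (B₁ := 20) (B₂ := 20) ?_ (fun τ' h => ?_)
          (by omega)
        · refine .ite' (B₁ := 10) ((hready h).hasValue_isExit hW (hreg h) haC) (fun hx => ?_)
            (fun hx => ?_) (by simp [Expr.cost, isExit])
          · have hx : G.IsExit t C (G.src a) := by
              by_contra h'
              simp [h'] at hx
            refine .set_seq' (x := 1) (B₂ := 3) (hasValue_lit (by omega)) (.set' (x := a)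
              (hasValue_reg (by simp [h.2.2.1]) (by omega)) ?_ (by simp [Expr.cost]))
              (by simp [Expr.cost])
            obtain ⟨g1, g2, g3, g4, g5, g6, g7⟩ := h
            exact ⟨g1, by simp [g2], by simp [g3], by simp [g4], .inr ⟨by simp, a, haC, hx⟩,
              g6.congr (by simp), fun _ => ⟨a, haC, hx, by simp⟩⟩
          · have hx : ¬ G.IsExit t C (G.src a) := by
              intro h'
              simp [h'] at hx
            obtain ⟨g1, g2, g3, g4, g5, g6, g7⟩ := h
            exact .skip ⟨g1, g2, g3, g4, g5.succ fun _ => hx, g6, g7⟩ (by omega)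
        · refine .ite' (B₁ := 10) ((hready h).hasValue_isEntrance hW (hreg h) haC) (fun hx => ?_)
            (fun hx => ?_) (by simp [Expr.cost, isEntrance])
          · have hx : G.IsEntrance s C (G.src a) := by
              by_contra h'
              simp [h'] at hx
            refine .set' (x := 1) (hasValue_lit (by omega)) ?_ (by simp [Expr.cost])
            obtain ⟨g1, g2, g3, g4, g5, g6, g7⟩ := h
            exact ⟨g1, by simp [g2], by simp [g3], by simp [g4], g5.congr (by simp),
              .inr ⟨by simp, a, haC, hx⟩, by simpa using g7⟩
          · have hx : ¬ G.IsEntrance s C (G.src a) := by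
              intro h'
              simp [h'] at hx
            obtain ⟨g1, g2, g3, g4, g5, g6, g7⟩ := h
            exact .skip ⟨g1, g2, g3, g4, g5, g6.succ fun _ => hx, g7⟩ (by omega)
      · have haC : a ∉ G.arcsOf C := by
          intro h'
          simp [h'] at hc
        obtain ⟨g1, g2, g3, g4, g5, g6, g7⟩ := h
        exact .skip ⟨g1, g2, g3, g4, g5.succ fun h => absurd h haC,
          g6.succ fun h => absurd h haC, g7⟩ (by omega)
    · refine .set' (x := a + 1) ((hreg h).op (hasValue_lit (x := 1) (by omega)) rfl (by omega)) ?_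
        (by simp [Expr.cost])
      obtain ⟨g1, g2, g3, g4, g5, g6, g7⟩ := h
      exact ⟨k - 1, by omega, a + 1, by omega, g1, by simp [g2], by simp, by simp [g4],
        g5.congr (by simp), g6.congr (by simp), by simpa using g7⟩
  · rintro k τ' ⟨a, hk, h⟩ he
    have ham : ¬ a < m := by
      intro h'
      simp [Expr.eval, Op.eval, h.2.1, h.2.2.1, h'] at he
    obtain rfl : a = m := by omega
    obtain ⟨g1, g2, g3, g4, g5, g6, g7⟩ := h
    exact ⟨g1, g4, g5, g6, g7⟩
  · simp only [Expr.cost]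
    omega

end Correctness

end RAM

/-! ### Collecting the two paths along the boundary. -/

namespace RAM

open EmbeddedDigraph

section Collect

variable {n m W : ℕ} {G : EmbeddedDigraph (Fin n) (Fin m)} {s t c : Fin n} {C : Set (Fin n)}
  {σ τ : State}

/-- The array `k` starts with the entries of `l`. -/
def Stores (τ : State) (k : ℕ) (l : List (Fin m)) : Prop :=
  ∀ (i : ℕ) (a : Fin m), l[i]? = some a → τ.mem k i = (a : ℕ)

lemma stores_nil (k : ℕ) : Stores (m := m) τ k [] := by
  intro i a h
  simp at h

lemma Stores.concat {k : ℕ} {l : List (Fin m)} (h : Stores τ k l) (a : Fin m) :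
    Stores (τ.setMem k l.length a) k (l ++ [a]) := by
  intro i b hb
  rw [setMem_mem_self]
  have hi : i < (l ++ [a]).length := (List.getElem?_eq_some_iff.1 hb).1
  rw [List.length_append, List.length_singleton] at hi
  split_ifs with h'
  · subst h'
    rw [List.getElem?_concat_length] at hb
    obtain rfl : a = b := by simpa using hb
    rfl
  · rw [List.getElem?_append_left (by omega)] at hb
    exact h i b hb

lemma Stores.congr {k : ℕ} {l : List (Fin m)} {τ' : State} (h : Stores τ k l)
    (h' : τ'.mem k = τ.mem k) : Stores τ' k l := by
  unfold Stores
  rwa [h']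

lemma Stores.holds {k i : ℕ} {l : List (Fin m)} (h : Stores τ k l) (hi : τ.reg i = l.length) :
    Holds τ i k l :=
  ⟨hi, fun j hj => h j _ (List.getElem?_eq_getElem hj)⟩

lemma src_eq_of_isWalk {u v : Fin n} {l₁ l₂ : List (Fin m)} {a b : Fin m}
    (h : G.IsWalk u (l₁ ++ a :: b :: l₂) v) : G.src b = G.tgt a := by
  obtain ⟨w, -, h⟩ := isWalk_append.1 h
  exact h.2.1

lemma length_le_of_nodup {l : List (Fin m)} (h : l.Nodup) : l.length ≤ m := by
  simpa using h.length_le_card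

/-- The walk is cut into discarded arcs `X`, the current candidate `Y` for the second path and the
rest from `z` on. Each exit resets the candidate, so at the first entrance it starts at the last
exit met. -/
lemma runs_collectSecond (hW : n + 2 * m + 2 ≤ W) (hN : G.IsNormalNetwork s t)
    (hC : G.IsOutsideComponent s t C) (hτ : Ready G s t C τ) {L : List (Fin m)} {q : Fin m}
    {u : Fin n} (hL : G.IsWalk u (q :: L) u) (hLn : (q :: L).Nodup)
    (hLB : ∀ a ∈ q :: L, a ∈ G.boundary C) (hq : G.IsExit t C (G.src q))
    (he : ∃ a ∈ q :: L, G.IsEntrance s C (G.src a)) (h8 : τ.reg 8 = q) (h9 : τ.reg 9 = 0) :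
    Runs W collectSecond τ (120 * m + 20) fun τ' => Ready G s t C τ' ∧
      ∃ (X : List (Fin m)) (y : Fin m) (Y : List (Fin m)) (z : Fin m) (Z : List (Fin m)),
        q :: L = X ++ y :: Y ++ z :: Z ∧ τ'.reg 8 = z ∧ τ'.reg 9 = (y :: Y).length ∧
        Stores τ' 6 (y :: Y) ∧ G.IsEntrance s C (G.src z) ∧ G.IsExit t C (G.src y) ∧
        (∀ a ∈ y :: Y, ¬ G.IsEntrance s C (G.src a)) ∧ ∀ a ∈ Y, ¬ G.IsExit t C (G.src a) := by
  classical
  have hlen := length_le_of_nodup hLn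
  -- The condition on `(Y ++ [z]).head?` says that the candidate starts at an exit, also when it is
  -- still empty and `z` will be its first arc.
  refine .loop (fun k τ' => Ready G s t C τ' ∧
    ∃ (X Y : List (Fin m)) (z : Fin m) (Z : List (Fin m)),
    q :: L = X ++ Y ++ z :: Z ∧
    k = (z :: Z).length ∧ τ'.reg 8 = z ∧ τ'.reg 9 = Y.length ∧ Stores τ' 6 Y ∧
    (∀ a ∈ X ++ Y, ¬ G.IsEntrance s C (G.src a)) ∧ (∀ a ∈ Y.tail, ¬ G.IsExit t C (G.src a)) ∧
    (∀ a ∈ (Y ++ [z]).head?, G.IsExit t C (G.src a))) (k := (q :: L).length) (B₁ := 100)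
    ⟨hτ, [], [], q, L, rfl, rfl, h8, h9, stores_nil 6, by simp, by simp, by simpa using hq⟩
    ?_ ?_ ?_ ?_
  -- A preamble common to the three goals about the invariant; `try` leaves the time bound alone.
  all_goals try
    rintro k τ' ⟨hτ', X, Y, z, Z, hsplit, rfl, g8, g9, gY, gen, gex, ghd⟩
    have hzB : z ∈ G.boundary C := hLB z (by rw [hsplit]; simp)
    have hz8 : HasValue W τ' (.reg 8) z := hasValue_reg g8 (by omega)
    have hcond := (hτ'.hasValue_isEntrance hW hz8 hzB.1).op (hasValue_lit (Nat.zero_le W))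
      (o := .eq) rfl ((Op.eval_eq_le _ _).trans (by omega))
  · exact hcond.1
  · intro hne
    rw [hcond.2] at hne
    have hze : ¬ G.IsEntrance s C (G.src z) := by
      intro h
      simp [Op.eval, h] at hne
    obtain ⟨z', Z', rfl⟩ : ∃ z' Z', Z = z' :: Z' := by
      refine List.exists_cons_of_ne_nil ?_
      rintro rfl
      obtain ⟨a, ha, hae⟩ := he
      rw [hsplit, List.mem_append, List.mem_singleton] at ha
      rcases ha with ha | rfl
      · exact gen a ha hae
      · exact hze hae
    have hz'B : z' ∈ G.boundary C := hLB z' (by rw [hsplit]; simp)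
    have hzz' : G.src z' = G.tgt z := by
      rw [hsplit] at hL
      exact src_eq_of_isWalk hL
    refine Runs.seq (mid := fun τ₁ => τ₁.mem = τ'.mem ∧ τ₁.reg 8 = z ∧
      ∃ X₁ Y₁ : List (Fin m), X₁ ++ Y₁ = X ++ Y ∧ τ₁.reg 9 = Y₁.length ∧ Stores τ₁ 6 Y₁ ∧
        (∀ a ∈ (Y₁ ++ [z]).tail, ¬ G.IsExit t C (G.src a)) ∧
        (∀ a ∈ (Y₁ ++ [z]).head?, G.IsExit t C (G.src a))) (B₁ := 12) (B₂ := 85) ?_ ?_ (by omega)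
    · refine .ite' (B₁ := 5) (hτ'.hasValue_isExit hW hz8 hzB.1) (fun h => ?_) (fun h => ?_)
        (by simp [Expr.cost, isExit])
      · have hx : G.IsExit t C (G.src z) := by
          by_contra h'
          simp [h'] at h
        exact .set' (hasValue_lit (Nat.zero_le W)) ⟨rfl, by simp [g8], X ++ Y, [],
          by simp, by simp, stores_nil 6, by simp, by simpa using hx⟩ (by simp [Expr.cost])
      · have hx : ¬ G.IsExit t C (G.src z) := by
          intro h'
          simp [h'] at h
        refine .skip ⟨rfl, g8, X, Y, rfl, g9, gY, ?_, ghd⟩ (by omega)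
        cases Y with
        | nil => simp
        | cons y Y =>
          simp only [List.cons_append, List.tail_cons, List.mem_append, List.mem_singleton]
          rintro a (ha | rfl)
          · exact gex a ha
          · exact hx
    · rintro τ₁ ⟨f1, f2, X₁, Y₁, f3, f4, f5, f6, f7⟩
      have hY₁ : Y₁.length ≤ m := by
        have h1 := congrArg List.length hsplit
        have h2 := congrArg List.length f3
        simp only [List.length_append, List.length_cons] at h1 h2 hlen
        omega
      refine .store_seq' (x := Y₁.length) (y := z) (B₂ := 80) (hasValue_reg f4 (by omega))
        (hasValue_reg f2 (by omega)) (.set_seq' (x := Y₁.length + 1) (B₂ := 70)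
        ((hasValue_reg (by simp [f4]) (by omega)).op (hasValue_lit (x := 1) (by omega)) rfl
          (by omega)) (.mono (runs_nextArc (b := z) (b' := z') hW hN hC ?_ hzB hz'B hzz'
            (by simp [f2]))
            le_rfl ?_)
          (by simp [Expr.cost])) (by simp [Expr.cost])
      · refine hτ'.congr fun k _ hk => ?_
        rw [setReg_mem, setMem_mem_of_ne _ _ _ _ hk, f1]
      · rintro τ₂ ⟨e8, ereg, emem⟩
        refine ⟨(z' :: Z').length, by simp, ?_, X₁, Y₁ ++ [z], z', Z', ?_, rfl, e8, ?_, ?_, ?_,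
          f6, ?_⟩
        · refine hτ'.congr fun k _ hk => ?_
          rw [emem, setReg_mem, setMem_mem_of_ne _ _ _ _ hk, f1]
        · rw [hsplit, ← f3]
          simp
        · rw [ereg 9 (by omega) (by omega)]
          simp
        · exact (f5.concat z).congr (by rw [emem, setReg_mem])
        · rw [← List.append_assoc, f3]
          simp only [List.mem_append, List.mem_singleton] at gen ⊢
          rintro a (ha | rfl)
          · exact gen a ha
          · exact hze
        · rw [List.head?_append_of_ne_nil _ (by simp)]
          exact f7
  · intro he0
    rw [hcond.2] at he0
    have hze : G.IsEntrance s C (G.src z) := by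
      by_contra h
      simp [Op.eval, h] at he0
    -- With an empty candidate, the entrance at the tail of `z` would also be an exit.
    obtain ⟨y, Y, rfl⟩ : ∃ y Y', Y = y :: Y' := by
      refine List.exists_cons_of_ne_nil ?_
      rintro rfl
      exact hC.not_isExit hN hze (ghd z (by simp))
    exact ⟨hτ', X, y, Y, z, Z, hsplit, g8, g9, gY, hze, ghd y (by simp),
      fun a ha => gen a (List.mem_append_right _ ha), gex⟩
  · simp only [Expr.cost, isEntrance]
    have : (q :: L).length * (1 + 1 + 1 + 1 + 1 + 1 + 100 + 1) ≤ m * 120 :=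
      Nat.mul_le_mul hlen (by omega)
    omega

/-- The first arc `y` of the second path, kept in cell 0 of array 6, is the stop sign. It does not
occur earlier because the cycle repeats no arc. -/
lemma runs_collectFirst (hW : n + 2 * m + 2 ≤ W) (hN : G.IsNormalNetwork s t)
    (hC : G.IsOutsideComponent s t C) (hτ : Ready G s t C τ) {z y : Fin m} {Z Y : List (Fin m)}
    {u : Fin n} (hL : G.IsWalk u (z :: Z ++ y :: Y) u) (hLn : (z :: Z ++ y :: Y).Nodup)
    (hLB : ∀ a ∈ z :: Z ++ y :: Y, a ∈ G.boundary C) (h8 : τ.reg 8 = z) (h15 : τ.reg 15 = 0)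
    (hY : Stores τ 6 (y :: Y)) :
    Runs W collectFirst τ (120 * m + 20) fun τ' => τ'.reg 9 = τ.reg 9 ∧
      τ'.reg 15 = (z :: Z).length ∧ Stores τ' 5 (z :: Z) ∧ Stores τ' 6 (y :: Y) := by
  classical
  have hlen := length_le_of_nodup hLn
  have hyB : y ∈ G.boundary C := hLB y (by simp)
  refine .loop (fun k τ' => Ready G s t C τ' ∧ τ'.reg 9 = τ.reg 9 ∧ Stores τ' 6 (y :: Y) ∧
    ∃ (U V : List (Fin m)) (v : Fin m) (R : List (Fin m)), z :: Z = U ++ V ∧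
      V ++ y :: Y = v :: R ∧ k = V.length ∧ τ'.reg 8 = v ∧ τ'.reg 15 = U.length ∧ Stores τ' 5 U)
    (k := (z :: Z).length) (B₁ := 100)
    ⟨hτ, rfl, hY, [], z :: Z, z, Z ++ y :: Y, rfl, rfl, rfl, h8, h15, stores_nil 5⟩
    ?_ ?_ ?_ ?_
  all_goals try
    rintro k τ' ⟨hτ', g9, gY, U, V, v, R, hUV, hVY, rfl, g8, g15, gU⟩
    have hv8 : HasValue W τ' (.reg 8) v := hasValue_reg g8 (by omega)
    have hy6 : HasValue W τ' (.mem 6 (.lit 0)) y :=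
      (hasValue_lit (Nat.zero_le W)).mem (gY 0 y rfl) (by omega)
    have hcond := ((hv8.op hy6 (o := .eq) rfl ((Op.eval_eq_le _ _).trans (by omega))).op
      (hasValue_lit (Nat.zero_le W)) (o := .eq) rfl ((Op.eval_eq_le _ _).trans (by omega)))
  · exact hcond.1
  · intro hne
    rw [hcond.2] at hne
    have hvy : v ≠ y := by
      rintro rfl
      simp [Op.eval] at hne
    obtain ⟨v', V', rfl⟩ : ∃ v' V', V = v' :: V' := by
      refine List.exists_cons_of_ne_nil ?_
      rintro rfl
      simp at hVY
      exact hvy hVY.1.symm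
    obtain ⟨rfl, rfl⟩ : v' = v ∧ V' ++ y :: Y = R := by simpa using hVY
    obtain ⟨w, R', hwR⟩ : ∃ w R', V' ++ y :: Y = w :: R' :=
      List.exists_cons_of_ne_nil (by simp)
    have hall : z :: Z ++ y :: Y = U ++ v' :: w :: R' := by
      rw [hUV, List.append_assoc, List.cons_append, hwR]
    have hvB : v' ∈ G.boundary C := hLB v' (by rw [hall]; simp)
    have hwB : w ∈ G.boundary C := hLB w (by rw [hall]; simp)
    have hvw : G.src w = G.tgt v' := by
      rw [hall] at hL
      exact src_eq_of_isWalk hL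
    have hU : U.length ≤ m := by
      have h1 := congrArg List.length hUV
      simp only [List.length_append, List.length_cons] at h1 hlen
      omega
    refine .store_seq' (x := U.length) (y := v') (B₂ := 80) (hasValue_reg g15 (by omega))
      hv8 (.set_seq' (x := U.length + 1) (B₂ := 70)
      ((hasValue_reg (by simp [g15]) (by omega)).op (hasValue_lit (x := 1) (by omega)) rfl
        (by omega)) (.mono (runs_nextArc (b := v') (b' := w) hW hN hC ?_ hvB hwB hvw (by simp [g8]))
          le_rfl ?_)
        (by simp [Expr.cost])) (by simp [Expr.cost])
    · refine hτ'.congr fun k hk _ => ?_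
      rw [setReg_mem, setMem_mem_of_ne _ _ _ _ hk]
    · rintro τ₂ ⟨e8, ereg, emem⟩
      refine ⟨V'.length, by simp, ?_, ?_, ?_, U ++ [v'], V', w, R', ?_, hwR, rfl, e8, ?_, ?_⟩
      · refine hτ'.congr fun k hk _ => ?_
        rw [emem, setReg_mem, setMem_mem_of_ne _ _ _ _ hk]
      · rw [ereg 9 (by omega) (by omega)]
        simp [g9]
      · exact gY.congr (by rw [emem, setReg_mem, setMem_mem_of_ne _ _ _ _ (by omega)])
      · rw [hUV]
        simp
      · rw [ereg 15 (by omega) (by omega)]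
        simp
      · exact (gU.concat v').congr (by rw [emem, setReg_mem])
  · intro he0
    rw [hcond.2] at he0
    have hvy : v = y := by
      by_contra h
      rw [← Fin.val_inj] at h
      simp [Op.eval, h] at he0
    obtain rfl : V = [] := by
      cases V with
      | nil => rfl
      | cons v' V' =>
        exfalso
        obtain ⟨rfl, -⟩ : v' = v ∧ V' ++ y :: Y = R := by simpa using hVY
        subst hvy
        rw [hUV] at hLn
        exact (List.nodup_append.1 hLn).2.2 v' (by simp) v' (by simp) rfl
    rw [List.append_nil] at hUV
    rw [hUV]
    exact ⟨g9, g15, gU, gY⟩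
  · simp only [Expr.cost]
    simp only [List.length_append, List.length_cons] at hlen ⊢
    have : (Z.length + 1) * (1 + (1 + 1) + 1 + 1 + 1 + 100 + 1) ≤ m * 120 :=
      Nat.mul_le_mul (by omega) (by omega)
    omega

end Collect

end RAM

/-! ### Correctness of the whole algorithm. -/

namespace RAM

open EmbeddedDigraph

lemma runs_splitBoundary {n m W : ℕ} {G : EmbeddedDigraph (Fin n) (Fin m)} {s t c : Fin n}
    {C : Set (Fin n)} {σ : State} (hW : n + 2 * m + 2 ≤ W) (hN : G.IsNormalNetwork s t)
    (hC : G.IsOutsideComponent s t C) (hc : c ∈ C) (hσ : IsInput G s t c σ) :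
    Runs W splitBoundary σ (2000 * (n + m)) fun σ' =>
      (σ'.reg 0 = 0 ∧ G.AllUseless s t C) ∨
        (σ'.reg 0 = 1 ∧ ∃ Q₁ Q₂, Holds σ' 1 5 Q₁ ∧ Holds σ' 2 6 Q₂ ∧
          ∀ Q, G.IsBoundaryCycle C Q → G.Splits s t C Q Q₁ Q₂) := by
  have hn : 0 < n := c.pos
  have hout : ∀ v ∈ C, ∃ b ∈ G.arcsOf C, G.src b = v := fun v hv => hC.exists_out hv
  refine Runs.seq (runs_searches hW hN hC hc hσ) (B₂ := 800 * (n + m)) ?_ (by omega)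
  rintro τ ⟨hτ, hreg⟩
  refine Runs.seq (runs_scan hW hτ ((hreg 1 (by omega)).trans hσ.reg_m)
    ((hreg 5 (by omega)).trans (hσ.reg_zero 5 le_rfl))
    ((hreg 6 (by omega)).trans (hσ.reg_zero 6 (by omega)))
    ((hreg 7 (by omega)).trans (hσ.reg_zero 7 (by omega)))) (B₂ := 500 * (n + m)) ?_ (by omega)
  rintro τ₁ ⟨hmem, h9, hx, he, hq⟩
  have hτ₁ : Ready G s t C τ₁ := hτ.congr fun k _ _ => by rw [hmem]
  have h9' : τ₁.reg 9 = 0 := by rw [h9, hreg 9 (by omega), hσ.reg_zero 9 (by omega)]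
  have h6le : τ₁.reg 6 ≤ 1 := by rcases hx with ⟨h, -⟩ | ⟨h, -⟩ <;> omega
  have h7le : τ₁.reg 7 ≤ 1 := by rcases he with ⟨h, -⟩ | ⟨h, -⟩ <;> omega
  refine .ite' (B₁ := 450 * (n + m)) ((hasValue_reg (x := τ₁.reg 6) rfl (by omega)).op
    (hasValue_reg (x := τ₁.reg 7) rfl (by omega)) (o := .mul) rfl
    ((Nat.mul_le_mul h6le h7le).trans (by omega))) (fun h => ?_) (fun h => ?_)
    (by simp only [Expr.cost]; omega)
  · have h6 : τ₁.reg 6 = 1 := by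
      rcases hx with ⟨h', -⟩ | ⟨h', -⟩
      · simp [Op.eval, h'] at h
      · exact h'
    obtain ⟨q, hqC, hqx, h8⟩ := hq h6
    obtain ⟨b, hbC, hbe⟩ : ∃ b ∈ G.arcsOf C, G.IsEntrance s C (G.src b) := by
      rcases he with ⟨h', -⟩ | ⟨-, h'⟩
      · simp [Op.eval, h'] at h
      · exact h'
    -- The scan yields just some arc of `C` with an exit as tail. Only one arc of `C` leaves an
    -- exit, so it is a boundary arc; likewise for entrances.
    obtain ⟨q', hq'B, -, hqq'⟩ := hC.boundary_of_isExit hN hqx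
    obtain rfl := hqq' q hqC rfl
    obtain ⟨-, -, b', hb'B, -, -, hbb'⟩ := hC.boundary_of_isEntrance hN hbe
    obtain rfl := hbb' b hbC rfl
    obtain ⟨Q, hQ⟩ := hC.exists_isBoundaryCycle hN
    obtain ⟨L, hrot, hL⟩ := hQ.exists_rotation hq'B
    have hLn : (q :: L).Nodup := hrot.perm.nodup_iff.1 hQ.nodup
    have hLB : ∀ a ∈ q :: L, a ∈ G.boundary C := fun a ha =>
      (hQ.2 a).1 (hrot.perm.mem_iff.2 ha)
    refine Runs.seq (runs_collectSecond hW hN hC hτ₁ hL hLn hLB hqx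
      ⟨b, hrot.perm.mem_iff.1 ((hQ.2 b).2 hb'B), hbe⟩ h8 h9') (B₂ := 300 * (n + m)) ?_ (by omega)
    rintro τ₂ ⟨hτ₂, X, y, Y, z, Z, hsplit, g8, g9, gY, hz, hy, hne, hnx⟩
    have hX : G.IsWalk (G.src q) (X ++ (y :: Y ++ z :: Z)) (G.src q) := by
      rw [← List.append_assoc, ← hsplit]
      exact hL
    obtain ⟨x, hXw, hYZ⟩ := isWalk_append.1 hX
    obtain ⟨e, hYw, hZw⟩ := isWalk_append.1 hYZ
    obtain rfl := hYw.1
    obtain rfl := hZw.1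
    -- The first path runs from the entrance past the starting point of the traversal, so the
    -- skipped arcs `X` form its end.
    have hrot' : Q ~r z :: (Z ++ X) ++ y :: Y := by
      refine hrot.trans ?_
      rw [hsplit]
      have := List.isRotated_append (l := X ++ y :: Y) (l' := z :: Z)
      simpa using this
    have hw₁ : G.IsWalk (G.src z) (z :: (Z ++ X)) (G.src y) := hZw.append hXw
    have hsp : G.Splits s t C Q (z :: (Z ++ X)) (y :: Y) := by
      refine hC.splits hN hQ hrot' hz hy hw₁ hYw (fun a ha hax => ?_) fun a ha hae => ?_
      · rcases hYw.mem_support_iff.1 (tgt_mem_support ha) with h | ⟨d, hd, hda⟩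
        · exact hC.not_isExit hN hz (h ▸ hax)
        · rcases List.mem_cons.1 hd with hdy | hd'
          -- An arc of the second path with its head at the start of `y` would share this head with
          -- an arc of the first path.
          · have hnd : ((z :: (Z ++ X) ++ y :: Y).map G.tgt).Nodup :=
              (hrot'.perm.map G.tgt).nodup_iff.1 hQ.1.2.2
            rw [List.map_append, List.nodup_append] at hnd
            obtain ⟨a', ha', haa'⟩ := hw₁.exists_tgt_eq_end fun h =>
              hC.not_isExit hN hz (h ▸ hy)
            exact hnd.2.2 _ (List.mem_map_of_mem ha') _ (List.mem_map_of_mem ha)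
              (haa'.trans (hdy ▸ hda))
          · exact hnx d hd' (hda ▸ hax)
      · rcases hYw.mem_support_iff.1 (tgt_mem_support ha) with h | ⟨d, hd, hda⟩
        · exact h
        · exact absurd (hda ▸ hae) (hne d hd)
    refine .set_seq' (x := 0) (B₂ := 290 * (n + m)) (hasValue_lit (by omega)) ?_
      (by simp only [Expr.cost]; omega)
    have hlen := length_le_of_nodup (hrot'.perm.nodup_iff.1 hQ.nodup)
    rw [List.length_append] at hlen
    refine Runs.seq (runs_collectFirst (z := z) (Z := Z ++ X) (y := y) (Y := Y) (u := G.src z)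
      (τ := τ₂.setReg 15 0) hW hN hC
      (hτ₂.congr fun _ _ _ => rfl : Ready G s t C (τ₂.setReg 15 0))
      (hw₁.append hYw) (hrot'.perm.nodup_iff.1 hQ.nodup)
      (fun a ha => (hQ.2 a).1 (hrot'.perm.mem_iff.2 ha)) (by simp [g8]) (by simp)
      (gY.congr rfl)) (B₂ := 20) ?_ (by omega)
    rintro τ₃ ⟨f9, f15, fZ, fY⟩
    have f9' : τ₃.reg 9 = (y :: Y).length := by rw [f9]; simpa using g9
    refine .set_seq' (x := 1) (B₂ := 12) (hasValue_lit (by omega)) (.set_seq' (B₂ := 5)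
      (hasValue_reg (x := (z :: (Z ++ X)).length) (by simpa using f15) (by omega))
      (.set' (hasValue_reg (x := (y :: Y).length) (by simpa using f9') (by omega)) ?_
      (by simp [Expr.cost])) (by simp [Expr.cost])) (by simp [Expr.cost])
    refine .inr ⟨by simp, z :: (Z ++ X), y :: Y, ?_, ?_, fun Q' hQ' => ?_⟩
    · exact Stores.holds (i := 1) (fZ.congr rfl) (by simp)
    · exact Stores.holds (i := 2) (fY.congr rfl) (by simp)
    -- Only the rotation clause of `Splits` depends on the chosen cycle.
    · obtain ⟨-, h⟩ := hsp
      exact ⟨(hC.isRotated hN hQ' hQ).trans hrot', h⟩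
  · refine .set' (x := 0) (hasValue_lit (by omega)) (.inl ⟨by simp, ?_⟩)
      (by simp only [Expr.cost]; omega)
    refine allUseless_of_not_exists ?_
    rintro ⟨⟨e, he'⟩, x, hx'⟩
    have h7 : τ₁.reg 7 = 1 := by
      rcases he with ⟨-, h'⟩ | ⟨h', -⟩
      · obtain ⟨b, hb, rfl⟩ := hout e he'.1
        exact absurd he' (h' b hb b.2)
      · exact h'
    have h6 : τ₁.reg 6 = 1 := by
      rcases hx with ⟨-, h'⟩ | ⟨h', -⟩
      · obtain ⟨b, hb, rfl⟩ := hout x hx'.1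
        exact absurd hx' (h' b hb b.2)
      · exact h'
    simp [Op.eval, h6, h7] at h

end RAM

theorem mainTheorem6 :
    -- the structure of the boundary
    (∀ (V A : Type*) [Finite V] [Finite A] (G : EmbeddedDigraph V A) (s t : V) (C : Set V),
      G.IsNormalNetwork s t → G.IsOutsideComponent s t C →
        (∃ Q, G.IsBoundaryCycle C Q) ∧
        ∀ Q, G.IsBoundaryCycle C Q →
          G.AllUseless s t C ∨ ∃ Q₁ Q₂, G.Splits s t C Q Q₁ Q₂) ∧
    -- the linear-time algorithm: it reports in register 0 which case holds, and in the second case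
    -- it returns the two paths
    (∃ (P : RAM.Program) (K : ℕ), ∀ (n m : ℕ) (G : EmbeddedDigraph (Fin n) (Fin m))
      (s t c : Fin n) (C : Set (Fin n)) (σ : RAM.State),
      G.IsNormalNetwork s t → G.IsOutsideComponent s t C → c ∈ C → RAM.IsInput G s t c σ →
        ∃ (T : ℕ) (σ' : RAM.State), RAM.Exec (K * (n + m)) P σ T σ' ∧ T ≤ K * (n + m) ∧
          ((σ'.reg 0 = 0 ∧ G.AllUseless s t C) ∨
            (σ'.reg 0 = 1 ∧ ∃ Q₁ Q₂, RAM.Holds σ' 1 5 Q₁ ∧ RAM.Holds σ' 2 6 Q₂ ∧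
              ∀ Q, G.IsBoundaryCycle C Q → G.Splits s t C Q Q₁ Q₂))) := by
  refine ⟨fun V A _ _ G s t C hN hC => ⟨hC.exists_isBoundaryCycle hN, fun Q hQ =>
    hC.allUseless_or_splits hN hQ⟩, RAM.splitBoundary, 2000, ?_⟩
  intro n m G s t c C σ hN hC hc hσ
  -- A positive `n` gives `n + 2 * m + 2 ≤ 2000 * (n + m)`, so the word bound leaves room for dart
  -- numbers and queue pointers.
  have hn : 0 < n := c.pos
  exact RAM.runs_splitBoundary (by omega) hN hC hc hσ
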